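/- **Proposition (Existence and uniqueness).** *Setting.* Let $\Omega\subset\mathbb R^2$ be a bounded domain (for instance a polygonal Lipschitz domain), $\Omega=\Omega_1\cup\Omega_2\cup\Gamma^{\mathrm{if}}$ a disjoint partition into two subdomains (connected open sets) and an interface, and $\partial_D\Omega\subset\partial\Omega$. Let $k\ge1$, and let $\mathcal T_h$ be a finite conforming triangulation of $\overline\Omega$ by curved triangles $T=\psi_T(\widehat T)$, where $\widehat T$ is a fixed closed reference triangle and $\psi_T\in[\mathbb P_k(\widehat T)]^2$ is a diffeomorphism onto $T$. Conforming means: two different elements are disjoint or meet exactly in a common vertex or a common side, a side belongs to at most two elements, open elements lie in $\Omega$, and every side lies, up to endpoints, in $\Omega$ or on $\partial\Omega$. Let $\mathcal S_h$ be the set of edges that lie, up to endpoints, in $\Omega$ (inner edges, shared by two elements $T_+,T_-$) or in $\partial_D\Omega$ (boundary edges, with union $\Gamma_h^{\mathrm b}$), $\mathcal S_h^{\mathrm{if}}$ the set of edges that lie, up to endpoints, on $\Gamma^{\mathrm{if}}$, and assume that $\Gamma^{\mathrm{if}}$ is contained in the union of the edges in $\mathcal S_h^{\mathrm{if}}$.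 Let $\Gamma_h$ and $\Gamma_h^{\mathrm{if}}$ be the unions of the edges in $\mathcal S_h$ and $\mathcal S_h^{\mathrm{if}}$. Assume, with a constant $\sigma>0$, that for all $T$ $$\|D\psi_T\|_{L^\infty(\widehat T)}\le\sigma h_T,\qquad \|D\psi_T^{-1}\|_{L^\infty(T)}\le\sigma h_T^{-1},\qquad h_T=\operatorname{diam}T,$$ and that to every edge $S$ a mesh size $h_S$ is attached with $\sigma^{-1}\operatorname{diam}S\le h_S\le\sigma\operatorname{diam}S$; write $h=h_S$ on $S$. The dG space is $$\mathbb V_h^k=\{v\in L^2(\Omega):\ v|_T=\widehat v_T\circ\psi_T^{-1},\ \widehat v_T\in\mathbb P_k(\widehat T)\ \ \forall T\in\mathcal T_h\}.$$ Differential operators act elementwise. On an inner edge $[\![v]\!]=v|_{T_+}-v|_{T_-}$ and $\{\!\{v\}\!\}=\frac12(v|_{T_+}+v|_{T_-})$, and $\eta$ is a unit normal on the edge, pointing either from $T_+$ to $T_-$ or from $T_-$ to $T_+$ (one arbitrary fixed choice for each edge). On a boundary edge $\eta$ is the outward unit normal and $\{\!\{v\}\!\}=v$. For boundary data $(g,\Phi)$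 the space $\mathbb V_h^k(g,\Phi)$ is $\mathbb V_h^k$ with the boundary jumps understood as $[\![v]\!]=g-v$, $[\![\nabla v]\!]=\Phi-\nabla v$; we identify $\mathbb V_h^k=\mathbb V_h^k(0,0)$. For $\gamma_0,\gamma_1>0$ set $$\begin{aligned}a_h(u,v)={}&\sum_{T}\langle D^2u,D^2v\rangle_{L^2(T)}+\langle\{\!\{\partial_\eta\nabla u\}\!\},[\![\nabla v]\!]\rangle_{\Gamma_h\setminus\Gamma_h^{\mathrm{if}}}+\langle\{\!\{\partial_\eta\nabla v\}\!\},[\![\nabla u]\!]\rangle_{\Gamma_h\setminus\Gamma_h^{\mathrm{if}}}\\&-\langle\{\!\{\partial_\eta\Delta u\}\!\},[\![v]\!]\rangle_{\Gamma_h}-\langle\{\!\{\partial_\eta\Delta v\}\!\},[\![u]\!]\rangle_{\Gamma_h}\\&+\gamma_1\langle h^{-1}[\![\nabla u]\!],[\![\nabla v]\!]\rangle_{\Gamma_h\setminus\Gamma_h^{\mathrm{if}}}+\gamma_0\langle h^{-3}[\![u]\!],[\![v]\!]\rangle_{\Gamma_h},\end{aligned}$$ $$\|v\|_{\mathrm{dG}}^2=\sum_T\|D^2v\|_{L^2(T)}^2+\sum_{S\in\mathcal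 S_h\setminus\mathcal S_h^{\mathrm{if}}}\frac{\gamma_1}{h_S}\|[\![\nabla v]\!]\|_{L^2(S)}^2+\sum_{S\in\mathcal S_h}\frac{\gamma_0}{h_S^3}\|[\![v]\!]\|_{L^2(S)}^2 ,$$ $$\begin{aligned}\ell_h(v)={}&\langle f,v\rangle_{L^2(\Omega)}-\langle\partial_\eta\nabla v,\Phi\rangle_{\Gamma_h^{\mathrm b}}+\langle\partial_\eta\Delta v,g\rangle_{\Gamma_h^{\mathrm b}}+\gamma_1\langle h^{-1}\Phi,\nabla v\rangle_{\Gamma_h^{\mathrm b}}+\gamma_0\langle h^{-3}g,v\rangle_{\Gamma_h^{\mathrm b}},\end{aligned}$$ where $\langle\cdot,\cdot\rangle_\Gamma$ is the $L^2(\Gamma)$ inner product with respect to arc length. *Claim.* There are $\gamma_{\min}>0$ and $c>0$ that depend only on $k$ and $\sigma$ such that, for every such mesh and all $\gamma_0,\gamma_1\ge\gamma_{\min}$: (i) $a_h(v,v)\ge\frac12\|v\|_{\mathrm{dG}}^2$ for all $v\in\mathbb V_h^k$. (ii) $|a_h(v,w)|\le c\,\|v\|_{\mathrm{dG}}\|w\|_{\mathrm{dG}}$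 for all $v,w\in\mathbb V_h^k$. (iii) Assume that for $i=1,2$ the set $\partial\Omega_i\setminus\Gamma^{\mathrm{if}}$ contains a point of the relative interior of some boundary edge in $\mathcal S_h$. Then for all $f\in L^2(\Omega)$, $g\in L^2(\Gamma_h^{\mathrm b})$, $\Phi\in L^2(\Gamma_h^{\mathrm b})^2$ (in particular for compatible data $\Phi=\nabla g|_{\partial_D\Omega}$) there is exactly one $u_h\in\mathbb V_h^k(g,\Phi)$ with $a_h(u_h,v)=\langle f,v\rangle_{L^2(\Omega)}$ for all $v\in\mathbb V_h^k(0,0)$. The same $u_h$, regarded as an element of $\mathbb V_h^k=\mathbb V_h^k(0,0)$, is the only solution of $a_h(u_h,v)=\ell_h(v)$ for all $v\in\mathbb V_h^k$. -/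

import Mathlib

open MeasureTheory

noncomputable section

/-- The Euclidean plane. -/
abbrev Plane := EuclideanSpace ℝ (Fin 2)

/-- Barycentric coordinates of the reference triangle with vertices `(0,0)`, `(1,0)`, `(0,1)`. -/
def refBary (i : Fin 3) (x : Plane) : ℝ := ![1 - x 0 - x 1, x 0, x 1] i

/-- The closed reference triangle. -/
def refTri : Set Plane := {x | ∀ i, 0 ≤ refBary i x}

/-- The vertices of the reference triangle; vertex `i` is the one with `refBary i = 1`. -/
def refVertex : Fin 3 → Plane := ![!₂[0, 0], !₂[1, 0], !₂[0, 1]]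

/-- Affine parametrisation over `[0,1]` of side `i` of the reference triangle, the side opposite
to vertex `i`, on which `refBary i = 0`. -/
def refSide (i : Fin 3) (t : ℝ) : Plane :=
  AffineMap.lineMap (refVertex (i + 1)) (refVertex (i + 2)) t

/-- The map of the plane given by two polynomials in two variables. -/
def polyMap (q : Fin 2 → MvPolynomial (Fin 2) ℝ) (x : Plane) : Plane :=
  WithLp.toLp 2 fun i => MvPolynomial.eval (fun j => x j) (q i)

/-- The `i`-th partial derivative of `w`, taken within the closed set `K` (so that it is also
available, as a one-sided derivative, on the boundary of a closed element `K`). -/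
def pd (K : Set Plane) (i : Fin 2) (w : Plane → ℝ) (x : Plane) : ℝ :=
  fderivWithin ℝ w K x (EuclideanSpace.single i 1)

/-- A conforming isoparametric triangulation of `Ω` of degree `k` with `N` elements. The element
`T` is the image of the reference triangle under a polynomial diffeomorphism of degree `≤ k`. -/
structure IsoMesh (k N : ℕ) (Ω : Set Plane) where
  /-- The components of the elemental maps. -/
  poly : Fin N → Fin 2 → MvPolynomial (Fin 2) ℝ
  degree_le : ∀ T i, (poly T i).totalDegree ≤ k
  injOn : ∀ T, Set.InjOn (polyMap (poly T)) refTri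
  det_ne_zero : ∀ T, ∀ x ∈ refTri, (fderiv ℝ (polyMap (poly T)) x).det ≠ 0
  /-- The closed elements cover the closure of `Ω`. -/
  cover : closure Ω = ⋃ T, polyMap (poly T) '' refTri
  /-- The open elements are contained in `Ω`. -/
  open_subset : ∀ T, polyMap (poly T) '' interior refTri ⊆ Ω
  /-- Two different elements are disjoint, or meet exactly in a common vertex, or meet exactly
  in a common side. -/
  conforming : ∀ T T', T ≠ T' →
    Disjoint (polyMap (poly T) '' refTri) (polyMap (poly T') '' refTri) ∨
    (∃ i j, polyMap (poly T) (refVertex i) = polyMap (poly T') (refVertex j) ∧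
      polyMap (poly T) '' refTri ∩ polyMap (poly T') '' refTri =
        {polyMap (poly T) (refVertex i)}) ∨
    (∃ i j, (fun t => polyMap (poly T) (refSide i t)) '' Set.Icc 0 1 =
        (fun t => polyMap (poly T') (refSide j t)) '' Set.Icc 0 1 ∧
      polyMap (poly T) '' refTri ∩ polyMap (poly T') '' refTri =
        (fun t => polyMap (poly T) (refSide i t)) '' Set.Icc 0 1)
  /-- Up to its endpoints, every side lies in `Ω` or on the boundary of `Ω`. -/
  side_location : ∀ T i,
    (fun t => polyMap (poly T) (refSide i t)) '' Set.Ioo 0 1 ⊆ Ω ∨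
    (fun t => polyMap (poly T) (refSide i t)) '' Set.Ioo 0 1 ⊆ frontier Ω
  /-- A side belongs to at most two elements. -/
  side_two : ∀ s t t' : Fin N × Fin 3, t ≠ s → t' ≠ s →
    (fun r => polyMap (poly t.1) (refSide t.2 r)) '' Set.Icc 0 1 =
      (fun r => polyMap (poly s.1) (refSide s.2 r)) '' Set.Icc 0 1 →
    (fun r => polyMap (poly t'.1) (refSide t'.2 r)) '' Set.Icc 0 1 =
      (fun r => polyMap (poly s.1) (refSide s.2 r)) '' Set.Icc 0 1 → t = t'

/-- The discontinuous isoparametric space: a function `v` with `v|_T = p_T ∘ ψ_T⁻¹`,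
`p_T ∈ ℙ_k`, on every element `T` is given by the family of its reference polynomials `p_T`,
which it determines uniquely. -/
abbrev DGSpace (k N : ℕ) := Fin N → MvPolynomial.restrictTotalDegree (Fin 2) ℝ k

/-- A side `i` of an element `T`, as a pair `(T, i)`. -/
abbrev LocalSide (N : ℕ) := Fin N × Fin 3

/-- An edge of the mesh: `(s, some t)` is an inner edge seen as side `s` of the element `T₊` and
as side `t` of the element `T₋`, and `(s, none)` is a boundary edge. -/
abbrev MeshEdge (N : ℕ) := LocalSide N × Option (LocalSide N)

/-- The remaining data of the method: the clamped part `ΓD` of the boundary, the interface `Γif`,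
the mesh size `h S` attached to every side `S`, a choice of the unit normal on every inner edge
(`1`: it points out of `T₊`, `-1`: it points into `T₊`), and the penalty parameters. -/
structure DGParams (N : ℕ) where
  ΓD : Set Plane
  Γif : Set Plane
  h : Set Plane → ℝ
  orient : MeshEdge N → ℤˣ
  γ₀ : ℝ
  γ₁ : ℝ

namespace IsoMesh

variable {k N : ℕ} {Ω : Set Plane} (M : IsoMesh k N Ω)

/-- The elemental map `ψ_T`. -/
def psi (T : Fin N) : Plane → Plane := polyMap (M.poly T)

/-- The closed element `T`. -/
def elem (T : Fin N) : Set Plane := M.psi T '' refTri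

/-- The inverse `ψ_T⁻¹ : T → T̂`. -/
def inv (T : Fin N) : Plane → Plane := Function.invFunOn (M.psi T) refTri

/-- Parametrisation of a side over `[0,1]`. -/
def sideParam (s : LocalSide N) (t : ℝ) : Plane := M.psi s.1 (refSide s.2 t)

/-- The (closed) side as a set. -/
def side (s : LocalSide N) : Set Plane := M.sideParam s '' Set.Icc 0 1

/-- The side without its endpoints. -/
def openSide (s : LocalSide N) : Set Plane := M.sideParam s '' Set.Ioo 0 1

/-- The arc length measure on a side. -/
def sideMeasure (s : LocalSide N) : Measure Plane :=
  Measure.map (M.sideParam s)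
    ((volume.restrict (Set.Icc 0 1)).withDensity fun t => ‖deriv (M.sideParam s) t‖ₑ)

/-- The gradient, on the element `s.1`, of the barycentric coordinate that vanishes on side `s`. -/
def baryGrad (s : LocalSide N) (x : Plane) : Plane :=
  WithLp.toLp 2 fun j => pd (M.elem s.1) j (fun y => refBary s.2 (M.inv s.1 y)) x

/-- The outward unit normal of the element `s.1` on its side `s`: the barycentric coordinate
vanishes on the side and is positive inside, so its normalised gradient points inwards. -/
def normal (s : LocalSide N) (x : Plane) : Plane :=
  -(‖M.baryGrad s x‖⁻¹ • M.baryGrad s x)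

/-- Shape regularity with constant `σ`: `‖Dψ_T‖ ≤ σ h_T` and `‖Dψ_T⁻¹‖ ≤ σ h_T⁻¹` in the
supremum norms, where `h_T` is the diameter of `T`. -/
def ShapeRegular (σ : ℝ) : Prop :=
  ∀ T, (∀ x ∈ refTri, ‖fderiv ℝ (M.psi T) x‖ ≤ σ * Metric.diam (M.elem T)) ∧
    ∀ y ∈ M.elem T, ‖fderivWithin ℝ (M.inv T) (M.elem T) y‖ ≤ σ * (Metric.diam (M.elem T))⁻¹

/-- `h` is comparable, with constant `σ`, to the diameter of every side. -/
def MeshSize (σ : ℝ) (h : Set Plane → ℝ) : Prop :=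
  ∀ s, Metric.diam (M.side s) ≤ σ * h (M.side s) ∧ h (M.side s) ≤ σ * Metric.diam (M.side s)

/-- The local function `v|_T = p_T ∘ ψ_T⁻¹`. -/
def loc (v : DGSpace k N) (T : Fin N) (x : Plane) : ℝ :=
  MvPolynomial.eval (fun j => M.inv T x j) (v T : MvPolynomial (Fin 2) ℝ)

/-- The function on `Ω` (defined up to the null set of the sides) that is given by `v`. -/
def toFun (v : DGSpace k N) (x : Plane) : ℝ :=
  ∑ T, (M.psi T '' interior refTri).indicator (M.loc v T) x

/-- Elementwise `∂ᵢ v`. -/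
def d1 (v : DGSpace k N) (i : Fin 2) (T : Fin N) : Plane → ℝ := pd (M.elem T) i (M.loc v T)

/-- Elementwise `∂ⱼ ∂ᵢ v`. -/
def d2 (v : DGSpace k N) (i j : Fin 2) (T : Fin N) : Plane → ℝ := pd (M.elem T) j (M.d1 v i T)

/-- Elementwise `Δ v`. -/
def lap (v : DGSpace k N) (T : Fin N) (x : Plane) : ℝ := ∑ i, M.d2 v i i T x

open Classical in
/-- The set `𝒮_h` of all edges that lie, up to their endpoints, in `Ω` or in `ΓD`. Every inner
edge is listed once; `T₊` is the element with the smaller number. -/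
def edges (P : DGParams N) : Finset (MeshEdge N) :=
  Finset.univ.filter fun e => match e.2 with
    | some t => e.1.1 < t.1 ∧ M.side e.1 = M.side t ∧ M.openSide e.1 ⊆ Ω
    | none => M.openSide e.1 ⊆ P.ΓD

open Classical in
/-- The edges that do not lie on the interface. -/
def edgesOff (P : DGParams N) : Finset (MeshEdge N) :=
  (M.edges P).filter fun e => ¬ M.openSide e.1 ⊆ P.Γif

open Classical in
/-- The sides that lie, up to their endpoints, in `ΓD`. -/
def dirichletSides (P : DGParams N) : Finset (LocalSide N) :=
  Finset.univ.filter fun s => M.openSide s ⊆ P.ΓD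

/-- The average of the elementwise defined function `q` on an edge. -/
def avg (q : Fin N → Plane → ℝ) (e : MeshEdge N) (x : Plane) : ℝ :=
  match e.2 with
  | some t => (q e.1.1 x + q t.1 x) / 2
  | none => q e.1.1 x

/-- The jump of the elementwise defined function `q` on an edge; on boundary edges it is the
difference of the boundary value `b` and `q`. -/
def jump (b : Plane → ℝ) (q : Fin N → Plane → ℝ) (e : MeshEdge N) (x : Plane) : ℝ :=
  match e.2 with
  | some t => q e.1.1 x - q t.1 x
  | none => b x - q e.1.1 x

/-- The unit normal of an edge: the chosen one on inner edges, the outward one on boundary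
edges. -/
def edgeNormal (P : DGParams N) (e : MeshEdge N) (x : Plane) : Plane :=
  match e.2 with
  | some _ => (((P.orient e : ℤ) : ℝ)) • M.normal e.1 x
  | none => M.normal e.1 x

/-- The average of `∂_η ∂ᵢ v` on an edge. -/
def avgDnGrad (P : DGParams N) (v : DGSpace k N) (e : MeshEdge N) (i : Fin 2) (x : Plane) : ℝ :=
  avg (fun T y => ∑ j, M.edgeNormal P e y j * M.d2 v i j T y) e x

/-- The average of `∂_η Δ v` on an edge. -/
def avgDnLap (P : DGParams N) (v : DGSpace k N) (e : MeshEdge N) (x : Plane) : ℝ :=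
  avg (fun T y => ∑ j, M.edgeNormal P e y j * pd (M.elem T) j (M.lap v T) y) e x

/-- The dG form `a_h(u, v)` for `u` in the space with boundary data `(g, Φ)`, that is, with
boundary jumps `g - u` and `Φ - ∇u`, and `v` in the space with boundary data `(0, 0)`. -/
def formWithData (P : DGParams N) (g : Plane → ℝ) (Φ : Plane → Plane) (u v : DGSpace k N) : ℝ :=
  (∑ T, ∫ x in M.elem T, ∑ i, ∑ j, M.d2 u i j T x * M.d2 v i j T x)
  + (∑ e ∈ M.edgesOff P, ∫ x, ∑ i,
      M.avgDnGrad P u e i x * jump 0 (M.d1 v i) e x ∂M.sideMeasure e.1)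
  + (∑ e ∈ M.edgesOff P, ∫ x, ∑ i,
      M.avgDnGrad P v e i x * jump (fun y => Φ y i) (M.d1 u i) e x ∂M.sideMeasure e.1)
  - (∑ e ∈ M.edges P, ∫ x, M.avgDnLap P u e x * jump 0 (M.loc v) e x ∂M.sideMeasure e.1)
  - (∑ e ∈ M.edges P, ∫ x, M.avgDnLap P v e x * jump g (M.loc u) e x ∂M.sideMeasure e.1)
  + P.γ₁ * (∑ e ∈ M.edgesOff P, ∫ x, (P.h (M.side e.1))⁻¹ * ∑ i,
      jump (fun y => Φ y i) (M.d1 u i) e x * jump 0 (M.d1 v i) e x ∂M.sideMeasure e.1)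
  + P.γ₀ * (∑ e ∈ M.edges P, ∫ x, (P.h (M.side e.1) ^ 3)⁻¹ *
      (jump g (M.loc u) e x * jump 0 (M.loc v) e x) ∂M.sideMeasure e.1)

/-- The bilinear form `a_h` on the discontinuous space, with homogeneous boundary data. -/
def form (P : DGParams N) (u v : DGSpace k N) : ℝ := M.formWithData P 0 0 u v

/-- The dG norm. -/
def dgNorm (P : DGParams N) (v : DGSpace k N) : ℝ :=
  Real.sqrt
    ((∑ T, ∫ x in M.elem T, ∑ i, ∑ j, M.d2 v i j T x ^ 2)
    + (∑ e ∈ M.edgesOff P, P.γ₁ / P.h (M.side e.1) *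
        ∫ x, ∑ i, jump 0 (M.d1 v i) e x ^ 2 ∂M.sideMeasure e.1)
    + (∑ e ∈ M.edges P, P.γ₀ / P.h (M.side e.1) ^ 3 *
        ∫ x, jump 0 (M.loc v) e x ^ 2 ∂M.sideMeasure e.1))

/-- The load `⟨f, v⟩` in `L²(Ω)`. -/
def load (f : Plane → ℝ) (v : DGSpace k N) : ℝ := ∫ x in Ω, f x * M.toFun v x

/-- The linear form `ℓ_h`, into which the boundary data are collected. -/
def rhs (P : DGParams N) (f g : Plane → ℝ) (Φ : Plane → Plane) (v : DGSpace k N) : ℝ :=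
  M.load f v
  - (∑ s ∈ M.dirichletSides P, ∫ x, ∑ i,
      (∑ j, M.normal s x j * M.d2 v i j s.1 x) * Φ x i ∂M.sideMeasure s)
  + (∑ s ∈ M.dirichletSides P, ∫ x,
      (∑ j, M.normal s x j * pd (M.elem s.1) j (M.lap v s.1) x) * g x ∂M.sideMeasure s)
  + P.γ₁ * (∑ s ∈ M.dirichletSides P, ∫ x, (P.h (M.side s))⁻¹ *
      ∑ i, Φ x i * M.d1 v i s.1 x ∂M.sideMeasure s)
  + P.γ₀ * (∑ s ∈ M.dirichletSides P, ∫ x, (P.h (M.side s) ^ 3)⁻¹ *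
      (g x * M.loc v s.1 x) ∂M.sideMeasure s)

/-- `u`, in the space with boundary data `(g, Φ)`, solves the dG equation
`a_h(u, v) = ⟨f, v⟩` for all `v`. -/
def IsDGSolution (P : DGParams N) (f g : Plane → ℝ) (Φ : Plane → Plane)
    (u : DGSpace k N) : Prop :=
  ∀ v : DGSpace k N, M.formWithData P g Φ u v = M.load f v

/-- The bounded domain `Ω` is partitioned into two subdomains and an interface that is resolved
by the mesh, and `ΓD` is a part of its boundary. -/
structure IsFoldGeometry (Ω₁ Ω₂ : Set Plane) (P : DGParams N) : Prop where
  isOpen : IsOpen Ω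
  isConnected : IsConnected Ω
  isBounded : Bornology.IsBounded Ω
  isOpen₁ : IsOpen Ω₁
  isConnected₁ : IsConnected Ω₁
  isOpen₂ : IsOpen Ω₂
  isConnected₂ : IsConnected Ω₂
  partition : Ω = Ω₁ ∪ Ω₂ ∪ P.Γif
  disjoint₁₂ : Disjoint Ω₁ Ω₂
  disjoint₁ : Disjoint Ω₁ P.Γif
  disjoint₂ : Disjoint Ω₂ P.Γif
  clamped_subset : P.ΓD ⊆ frontier Ω
  /-- The interface is covered by the sides that lie on it up to their endpoints. -/
  resolved : ∀ x ∈ P.Γif, ∃ s, x ∈ M.side s ∧ M.openSide s ⊆ P.Γif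

/-- Some boundary edge in `ΓD` touches, with its relative interior, the boundary of `Ω'` away
from the interface. -/
def ClampedOn (P : DGParams N) (Ω' : Set Plane) : Prop :=
  ((⋃ s ∈ M.dirichletSides P, M.openSide s) ∩ (frontier Ω' \ P.Γif)).Nonempty

end IsoMesh

end

/-! The analysis rests on inverse inequalities whose constants depend only on the degree and on `σ`.
In reference coordinates every elementwise derivative of a dG function is a polynomial divided by a
power of the Jacobian determinant (`IsRational`), with degree and exponent fixed by `k` and the
order of the derivative. Polynomials of bounded degree form a finite-dimensional space, so on the
reference triangle their values and derivatives are controlled by the `L²` norm. Shape regularity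
makes the determinant comparable to `h_T²` from above and below, so these bounds carry over to
curved elements with the right powers of `h_T` (`exists_rational_bound`). The length of a side is at
most a constant, depending on `k`, times its diameter (`exists_sideMeasure_le`). Together this
bounds the scaled edge norms of the averages of `∂_η ∇v` and `∂_η Δv` by the Hessian energies of the
adjacent elements (`exists_trace_bound`).

Young's inequality then absorbs the consistency terms: half of the energy pays for the averages, and
large penalties pay for the jumps (`exists_form_self_bounds`). This gives coercivity and also an
upper bound for `a_h(v, v)`. Since `a_h` is symmetric and nonnegative on the diagonal, boundedness
off the diagonal is the Cauchy–Schwarz inequality (`abs_form_le`).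

For solvability, the boundary data enter the jumps additively, so the equation with data and the
equation with right-hand side `ℓ_h` agree for each test function (`formWithData_eq`). In finite
dimension it remains to see that the dG norm is definite (`eq_zero_of_dgNorm_eq_zero`). If the norm
of `v` vanishes, then `v` is affine on every element; the affine functions agree across inner edges
off the interface and vanish at the clamped edges off the interface. A connected open subdomain
remains connected after removal of the finitely many mesh vertices, and away from the vertices two
elements meet only across edges, so zero propagates from a clamped edge to every element that meets
the subdomain off the vertices (`eq_zero_of_clamped`). Clamping both subdomains makes any coupling
through the interface unnecessary. -/

noncomputable section

/-! ### Polynomials and inverse inequalities on the reference triangle. -/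

/-- Evaluation of a polynomial at a point of the plane. -/
abbrev ev (Q : MvPolynomial (Fin 2) ℝ) (x : Plane) : ℝ := MvPolynomial.eval (fun j => x j) Q

lemma continuous_ev (Q : MvPolynomial (Fin 2) ℝ) : Continuous (ev Q) :=
  (MvPolynomial.continuous_eval Q).comp (by fun_prop)

/-- The derivative of a polynomial as a function on the plane. -/
def evDeriv (Q : MvPolynomial (Fin 2) ℝ) (x : Plane) : Plane →L[ℝ] ℝ :=
  ∑ l, ev (MvPolynomial.pderiv l Q) x • EuclideanSpace.proj l

lemma evDeriv_apply (Q : MvPolynomial (Fin 2) ℝ) (x v : Plane) :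
    evDeriv Q x v = ∑ l, ev (MvPolynomial.pderiv l Q) x * v l := by
  simp [evDeriv]

lemma hasFDerivAt_ev (Q : MvPolynomial (Fin 2) ℝ) (x : Plane) :
    HasFDerivAt (ev Q) (evDeriv Q x) x := by
  induction Q using MvPolynomial.induction_on with
  | C a =>
    have : evDeriv (MvPolynomial.C a) x = 0 := by
      ext v; simp [evDeriv_apply]
    rw [this]
    have e : ev (MvPolynomial.C a) = fun _ => a := by ext y; simp [ev]
    rw [e]
    exact hasFDerivAt_const a x
  | add p q hp hq =>
    have : evDeriv (p + q) x = evDeriv p x + evDeriv q x := by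
      ext v; simp [evDeriv_apply]; ring
    have e : ev (p + q) = fun y => ev p y + ev q y := by ext y; simp [ev]
    rw [this, e]
    exact hp.add hq
  | mul_X p i hp =>
    let π : Plane →L[ℝ] ℝ := EuclideanSpace.proj i
    have h := hp.mul (π.hasFDerivAt (x := x))
    have e : evDeriv (p * MvPolynomial.X i) x
        = ev p x • π + π x • evDeriv p x := by
      ext v
      fin_cases i <;> simp [π, evDeriv_apply, MvPolynomial.pderiv_X, Derivation.leibniz] <;> ring
    rw [e]
    have : ev (p * MvPolynomial.X i) = fun y => ev p y * π y := by
      ext y; simp [ev, π]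
    rw [this]
    exact h

lemma totalDegree_pderiv_le (l : Fin 2) (Q : MvPolynomial (Fin 2) ℝ) :
    (MvPolynomial.pderiv l Q).totalDegree ≤ Q.totalDegree := by
  rw [MvPolynomial.totalDegree]
  refine Finset.sup_le fun s hs => ?_
  rw [MvPolynomial.mem_support_iff, MvPolynomial.coeff_pderiv] at hs
  have h : s + Finsupp.single l 1 ∈ Q.support :=
    MvPolynomial.mem_support_iff.2 (left_ne_zero_of_mul hs)
  refine le_trans ?_ (MvPolynomial.le_totalDegree h)
  rw [Finsupp.sum_add_index' (by simp) (by simp)]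
  omega

lemma totalDegree_aeval_le (f : Fin 2 → MvPolynomial (Fin 2) ℝ) (hf : ∀ i, (f i).totalDegree ≤ 1)
    (Q : MvPolynomial (Fin 2) ℝ) : (MvPolynomial.aeval f Q).totalDegree ≤ Q.totalDegree := by
  rw [MvPolynomial.aeval_def, MvPolynomial.eval₂_eq']
  refine (MvPolynomial.totalDegree_finsetSum _ _).trans (Finset.sup_le fun s hs => ?_)
  refine (MvPolynomial.totalDegree_mul _ _).trans ?_
  have h1 : (algebraMap ℝ (MvPolynomial (Fin 2) ℝ) (MvPolynomial.coeff s Q)).totalDegree = 0 :=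
    MvPolynomial.totalDegree_C _
  rw [h1, zero_add]
  refine (MvPolynomial.totalDegree_finsetProd _ _).trans ?_
  refine le_trans (Finset.sum_le_sum fun i _ => (MvPolynomial.totalDegree_pow _ _).trans
    (Nat.mul_le_mul_left (s i) (hf i))) ?_
  refine le_trans (le_of_eq ?_) (MvPolynomial.le_totalDegree hs)
  rw [Finsupp.sum_fintype _ _ (by simp)]
  simp

lemma continuous_refBary (i : Fin 3) : Continuous (refBary i) := by
  fin_cases i
  · exact (by fun_prop : Continuous fun x : Plane => 1 - x 0 - x 1)
  · exact (by fun_prop : Continuous fun x : Plane => x 0)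
  · exact (by fun_prop : Continuous fun x : Plane => x 1)

lemma isCompact_refTri : IsCompact refTri := by
  apply Metric.isCompact_of_isClosed_isBounded
  · have : refTri = ⋂ i, {x | 0 ≤ refBary i x} := by ext x; simp [refTri]
    rw [this]
    exact isClosed_iInter fun i => isClosed_le continuous_const (continuous_refBary i)
  · refine (Metric.isBounded_closedBall (x := (0 : Plane)) (r := 2)).subset fun x hx => ?_
    have h0 := hx 0
    have h1 := hx 1
    have h2 := hx 2
    simp [refBary] at h0 h1 h2
    rw [mem_closedBall_zero_iff, EuclideanSpace.norm_eq, Real.sqrt_le_left (by norm_num)]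
    simp only [Fin.sum_univ_two, Real.norm_eq_abs, sq_abs]
    nlinarith

lemma refSide_apply (i : Fin 3) (t : ℝ) (j : Fin 2) : refSide i t j
    = refVertex (i + 1) j + t * (refVertex (i + 2) j - refVertex (i + 1) j) := by
  simp [refSide, AffineMap.lineMap_apply]; ring

lemma refSide_mem (i : Fin 3) {t : ℝ} (ht : t ∈ Set.Icc (0 : ℝ) 1) : refSide i t ∈ refTri := by
  obtain ⟨h0, h1⟩ := ht
  intro l
  fin_cases i <;> fin_cases l <;> simp [refBary, refSide_apply, refVertex] <;> linarith

/-- The points of the reference triangle with positive barycentric coordinates. -/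
def refInt : Set Plane := {x | ∀ i, 0 < refBary i x}

lemma isOpen_refInt : IsOpen refInt := by
  have : refInt = ⋂ i, {x | 0 < refBary i x} := by ext x; simp [refInt]
  rw [this]
  exact isOpen_iInter_of_finite fun i => isOpen_lt continuous_const (continuous_refBary i)

lemma refInt_subset : refInt ⊆ refTri := fun _ hx i => (hx i).le

lemma eq_zero_of_ev_eq_zero {Q : MvPolynomial (Fin 2) ℝ} (h : ∀ x ∈ refInt, ev Q x = 0) :
    Q = 0 := by
  -- The square with these sides lies inside the triangle, and a polynomial vanishing on a product
  -- of infinite sets is zero.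
  refine MvPolynomial.funext_set (fun _ => Set.Ioo (1 / 10) (4 / 10))
    (fun _ => Set.Ioo_infinite (by norm_num)) fun x hx => ?_
  have h0 := hx 0 trivial
  have h1 := hx 1 trivial
  have := h (WithLp.toLp 2 x) (by
    intro i
    simp at h0 h1
    fin_cases i <;> simp [refBary] <;> linarith)
  simpa [ev] using this

/-- Compactness of the unit sphere makes `b` coercive in coordinates, and a family of functionals
that is bounded on each basis vector is uniformly bounded. This is the source of all inverse
inequalities: `b` will be the `L²` product and `L` a family of point evaluations of derivatives. -/
lemma exists_sq_le_of_posDef {E X : Type*} [AddCommGroup E] [Module ℝ E] [FiniteDimensional ℝ E]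
    (b : E →ₗ[ℝ] E →ₗ[ℝ] ℝ) (hb : ∀ v, v ≠ 0 → 0 < b v v) (L : X → E →ₗ[ℝ] ℝ)
    (hL : ∀ v, ∃ C, ∀ x, |L x v| ≤ C) : ∃ C > 0, ∀ x v, L x v ^ 2 ≤ C * b v v := by
  set B := Module.finBasis ℝ E
  set φ := B.equivFun.symm
  have hφ : ∀ c, φ c = ∑ i, c i • B i := fun c => B.equivFun_symm_apply c
  have hcont : Continuous fun c => b (φ c) (φ c) := by
    have : (fun c => b (φ c) (φ c)) = fun c => ∑ i, c i * (b (B i) ∘ₗ φ.toLinearMap) c := by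
      ext c
      conv_lhs => enter [1]; rw [hφ]
      simp
    rw [this]
    refine continuous_finsetSum _ fun i _ => (continuous_apply i).mul ?_
    exact LinearMap.continuous_of_finiteDimensional _
  obtain ⟨m, hm, hmb⟩ : ∃ m > 0, ∀ c, m * ‖c‖ ^ 2 ≤ b (φ c) (φ c) := by
    obtain ⟨m, hm, hmb⟩ : ∃ m > 0, ∀ c ∈ Metric.sphere (0 : Fin _ → ℝ) 1, m ≤ b (φ c) (φ c) := by
      -- The sphere is empty when `E` is trivial.
      rcases (Metric.sphere (0 : Fin (Module.finrank ℝ E) → ℝ) 1).eq_empty_or_nonempty with h | h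
      · exact ⟨1, one_pos, by simp [h]⟩
      · obtain ⟨c, hc, hmin⟩ := (isCompact_sphere _ _).exists_isMinOn h hcont.continuousOn
        refine ⟨_, hb (φ c) ?_, fun d hd => hmin hd⟩
        intro h0
        have : c = 0 := by simpa using h0
        simp [this] at hc
    refine ⟨m, hm, fun c => ?_⟩
    rcases eq_or_ne c 0 with rfl | hc
    · simp
    have hn : ‖c‖ ≠ 0 := norm_ne_zero_iff.2 hc
    have := hmb (‖c‖⁻¹ • c) (by simp [norm_smul, hn])
    simp only [map_smul, LinearMap.smul_apply, smul_eq_mul] at this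
    have e : b (φ c) (φ c) = ‖c‖ ^ 2 * (‖c‖⁻¹ * (‖c‖⁻¹ * b (φ c) (φ c))) := by field_simp
    rw [e]
    nlinarith [sq_nonneg ‖c‖]
  choose M hM using fun i => hL (B i)
  refine ⟨((∑ i, |M i|) ^ 2 + 1) / m, by positivity, fun x v => ?_⟩
  obtain ⟨c, rfl⟩ := φ.surjective v
  have h1 : |L x (φ c)| ≤ ‖c‖ * ∑ i, |M i| := by
    rw [hφ, map_sum, Finset.mul_sum]
    refine (Finset.abs_sum_le_sum_abs _ _).trans (Finset.sum_le_sum fun i _ => ?_)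
    rw [map_smul, smul_eq_mul, abs_mul]
    exact mul_le_mul (norm_le_pi_norm c i) ((hM i x).trans (le_abs_self _)) (abs_nonneg _)
      (norm_nonneg _)
  have h2 : L x (φ c) ^ 2 ≤ (∑ i, |M i|) ^ 2 * ‖c‖ ^ 2 := by
    rw [← sq_abs, ← mul_pow, mul_comm]
    exact pow_le_pow_left₀ (abs_nonneg _) h1 2
  have h3 := hmb c
  rw [div_mul_eq_mul_div, le_div_iff₀ hm]
  nlinarith [sq_nonneg (∑ i, |M i|), mul_nonneg hm.le (sq_nonneg ‖c‖)]

lemma integrableOn_refTri_ev_mul (Q R : MvPolynomial (Fin 2) ℝ) :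
    IntegrableOn (fun x => ev Q x * ev R x) refTri :=
  ((continuous_ev Q).mul (continuous_ev R)).continuousOn.integrableOn_compact isCompact_refTri

/-- The `L²` inner product of polynomials on the reference triangle. -/
def refInner : MvPolynomial (Fin 2) ℝ →ₗ[ℝ] MvPolynomial (Fin 2) ℝ →ₗ[ℝ] ℝ :=
  LinearMap.mk₂ ℝ (fun Q R => ∫ x in refTri, ev Q x * ev R x)
    (fun Q Q' R => by
      rw [← integral_add (integrableOn_refTri_ev_mul Q R) (integrableOn_refTri_ev_mul Q' R)]
      simp [ev, add_mul])
    (fun c Q R => by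
      rw [smul_eq_mul, ← integral_const_mul]
      simp [ev, mul_assoc])
    (fun Q R R' => by
      rw [← integral_add (integrableOn_refTri_ev_mul Q R) (integrableOn_refTri_ev_mul Q R')]
      simp [ev, mul_add])
    (fun c Q R => by
      rw [smul_eq_mul, ← integral_const_mul]
      simp [ev, mul_left_comm])

lemma refInner_self_pos {Q : MvPolynomial (Fin 2) ℝ} (hQ : Q ≠ 0) : 0 < refInner Q Q := by
  have h0 : 0 ≤ refInner Q Q := integral_nonneg fun x => mul_self_nonneg _
  refine h0.lt_of_ne fun h => hQ (eq_zero_of_ev_eq_zero ?_)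
  have h1 : (fun x => ev Q x * ev Q x) =ᵐ[volume.restrict refTri] 0 :=
    (integral_eq_zero_iff_of_nonneg (fun x => mul_self_nonneg _)
      (integrableOn_refTri_ev_mul Q Q)).1 h.symm
  have h2 := Measure.eqOn_open_of_ae_eq (ae_restrict_of_ae_restrict_of_subset refInt_subset h1)
    isOpen_refInt ((continuous_ev Q).mul (continuous_ev Q)).continuousOn continuousOn_const
  intro x hx
  simpa using h2 hx

/-- Inverse inequality for polynomials of bounded degree on the reference triangle. -/
lemma exists_ev_sq_le (n : ℕ) (D : MvPolynomial (Fin 2) ℝ →ₗ[ℝ] MvPolynomial (Fin 2) ℝ) :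
    ∃ C > 0, ∀ Q : MvPolynomial (Fin 2) ℝ, Q.totalDegree ≤ n → ∀ x ∈ refTri,
      ev (D Q) x ^ 2 ≤ C * ∫ y in refTri, ev Q y ^ 2 := by
  let E := MvPolynomial.restrictTotalDegree (Fin 2) ℝ n
  let evL : Plane → MvPolynomial (Fin 2) ℝ →ₗ[ℝ] ℝ := fun x =>
    (MvPolynomial.aeval (R := ℝ) (fun j => x j)).toLinearMap
  obtain ⟨C, hC, h⟩ := exists_sq_le_of_posDef (E := E) (X := refTri)
    (refInner.compl₁₂ E.subtype E.subtype)
    (fun v hv => refInner_self_pos (by simpa using hv))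
    (fun x => evL x ∘ₗ D ∘ₗ E.subtype) (fun v => by
      obtain ⟨C, hC⟩ := isCompact_refTri.exists_bound_of_continuousOn
        (continuous_ev (D v)).continuousOn
      exact ⟨C, fun x => hC x x.2⟩)
  refine ⟨C, hC, fun Q hQ x hx => ?_⟩
  have := h ⟨x, hx⟩ ⟨Q, (MvPolynomial.mem_restrictTotalDegree (Fin 2) n Q).2 hQ⟩
  simpa [evL, refInner, ev, MvPolynomial.aeval_eq_eval, sq] using this

/-- Inverse inequality on the sides of the reference triangle. -/
lemma exists_deriv_side_le (n : ℕ) : ∃ C > 0, ∀ Q : MvPolynomial (Fin 2) ℝ, Q.totalDegree ≤ n →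
    ∀ i A, (∀ t ∈ Set.Icc (0 : ℝ) 1, |ev Q (refSide i t)| ≤ A) → ∀ t ∈ Set.Icc (0 : ℝ) 1,
      |deriv (fun r => ev Q (refSide i r)) t| ≤ C * A := by
  obtain ⟨C, hC, h⟩ := exists_ev_sq_le n (MvPolynomial.pderiv 0).toLinearMap
  refine ⟨Real.sqrt (C * (volume refTri).toReal) + 1, by positivity,
    fun Q hQ i A hA t ht => ?_⟩
  have hA0 : 0 ≤ A := (abs_nonneg _).trans (hA 0 (by simp))
  -- The restriction of `Q` to the side is read as a bivariate polynomial that depends on the first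
  -- coordinate only. This coordinate ranges in `[0,1]` on the triangle, so the bound `A` holds on
  -- all of it and the two-dimensional inverse inequality applies.
  let f : Fin 2 → MvPolynomial (Fin 2) ℝ := fun j => MvPolynomial.C (refVertex (i + 1) j)
    + MvPolynomial.C (refVertex (i + 2) j - refVertex (i + 1) j) * MvPolynomial.X 0
  have hf : ∀ j, (f j).totalDegree ≤ 1 := fun j => by
    refine (MvPolynomial.totalDegree_add _ _).trans (max_le (by simp) ?_)
    refine (MvPolynomial.totalDegree_mul _ _).trans ?_
    rw [MvPolynomial.totalDegree_C, MvPolynomial.totalDegree_X]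
  have hev : ∀ x : Plane, ev (MvPolynomial.aeval f Q) x = ev Q (refSide i (x 0)) := by
    intro x
    have e : (fun j => refSide i (x 0) j) = fun j => ev (f j) x := by
      ext j; simp [f, refSide_apply, mul_comm, ev]
    simp only [ev] at e ⊢
    rw [e, MvPolynomial.aeval_def, MvPolynomial.eval₂_eq', map_sum]
    conv_rhs => rw [MvPolynomial.eval_eq']
    simp
  have hd : deriv (fun r => ev Q (refSide i r)) t
      = ev (MvPolynomial.pderiv 0 (MvPolynomial.aeval f Q)) (t • EuclideanSpace.single 0 1) := by
    have h1 : HasDerivAt (fun r : ℝ => (r • EuclideanSpace.single 0 1 : Plane))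
        (EuclideanSpace.single 0 1) t := by
      simpa using (hasDerivAt_id t).smul_const (EuclideanSpace.single 0 1 : Plane)
    have h2 := (hasFDerivAt_ev (MvPolynomial.aeval f Q) (t • EuclideanSpace.single 0 1)).comp_hasDerivAt t h1
    have h3 : (ev (MvPolynomial.aeval f Q) ∘ fun r : ℝ => (r • EuclideanSpace.single 0 1 : Plane))
        = fun r => ev Q (refSide i r) := by
      ext r; simp only [Function.comp_apply, hev]; simp
    rw [h3] at h2
    rw [h2.deriv, evDeriv_apply]
    simp
  have hint : ∫ y in refTri, ev (MvPolynomial.aeval f Q) y ^ 2 ≤ A ^ 2 * (volume refTri).toReal := by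
    have : ∫ y in refTri, A ^ 2 = A ^ 2 * (volume refTri).toReal := by
      simp [Measure.real, mul_comm]
    rw [← this]
    refine setIntegral_mono_on ?_ ?_ isCompact_refTri.measurableSet fun y hy => ?_
    · exact ((continuous_ev _).pow 2).continuousOn.integrableOn_compact isCompact_refTri
    · exact continuousOn_const.integrableOn_compact isCompact_refTri
    · rw [hev]
      have h0 := hy 0
      have h1 := hy 1
      have h2 := hy 2
      simp [refBary] at h0 h1 h2
      exact sq_le_sq' (abs_le.1 (hA (y 0) ⟨h1, by linarith⟩)).1
        (abs_le.1 (hA (y 0) ⟨h1, by linarith⟩)).2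
  have h4 := h _ ((totalDegree_aeval_le f hf Q).trans hQ) (t • EuclideanSpace.single 0 1) (by
    intro l; obtain ⟨h0, h1⟩ := ht
    fin_cases l <;> simp [refBary] <;> linarith)
  rw [hd]
  have h5 : |ev (MvPolynomial.pderiv 0 (MvPolynomial.aeval f Q)) (t • EuclideanSpace.single 0 1)|
      ≤ Real.sqrt (C * (volume refTri).toReal) * A := by
    apply abs_le_of_sq_le_sq _ (by positivity)
    rw [mul_pow, Real.sq_sqrt (by positivity)]
    calc _ ≤ _ := h4
      _ ≤ C * (A ^ 2 * (volume refTri).toReal) := by gcongr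
      _ = _ := by ring
  linarith

lemma convex_refTri : Convex ℝ refTri := by
  intro x hx y hy a b ha hb hab i
  have e : refBary i (a • x + b • y) = a * refBary i x + b * refBary i y := by
    fin_cases i
    · simp [refBary]; linear_combination -hab
    · simp [refBary]
    · simp [refBary]
  rw [e]
  exact add_nonneg (mul_nonneg ha (hx i)) (mul_nonneg hb (hy i))

lemma refInt_nonempty : refInt.Nonempty :=
  ⟨!₂[1 / 4, 1 / 4], fun i => by fin_cases i <;> norm_num [refBary]⟩

lemma refInt_subset_interior : refInt ⊆ interior refTri :=
  interior_maximal refInt_subset isOpen_refInt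

lemma uniqueDiffOn_refTri : UniqueDiffOn ℝ refTri :=
  uniqueDiffOn_convex convex_refTri (refInt_nonempty.mono refInt_subset_interior)

lemma refVertex_mem (i : Fin 3) : refVertex i ∈ refTri := by
  intro l
  fin_cases i <;> fin_cases l <;> simp [refBary, refVertex]

/-- A continuous injection on a compact set maps closed subsets to closed sets. The domain is
general because both elemental maps and side parametrisations are inverted. -/
lemma continuousOn_invFunOn {X : Type*} [TopologicalSpace X] [T2Space X] [Nonempty X] {K : Set X}
    (hK : IsCompact K) {f : X → Plane} (hf : Continuous f) (hi : Set.InjOn f K) :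
    ContinuousOn (Function.invFunOn f K) (f '' K) := by
  rw [continuousOn_iff_isClosed]
  intro C hC
  refine ⟨f '' (K ∩ C), ((hK.inter_right hC).image hf).isClosed, ?_⟩
  ext y
  constructor
  · rintro ⟨h1, h2⟩
    exact ⟨⟨Function.invFunOn f K y, ⟨Function.invFunOn_mem h2, h1⟩,
      Function.invFunOn_eq h2⟩, h2⟩
  · rintro ⟨⟨x, ⟨hx, hxC⟩, rfl⟩, h2⟩
    refine ⟨?_, h2⟩
    rw [Set.mem_preimage, hi.leftInvOn_invFunOn hx]
    exact hxC

/-! ### Elemental maps and rational functions in reference coordinates. -/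

namespace IsoMesh

variable {k N : ℕ} {Ω : Set Plane} (M : IsoMesh k N Ω)

lemma differentiable_psi (T : Fin N) : Differentiable ℝ (M.psi T) :=
  differentiable_euclidean.2 fun i x => (hasFDerivAt_ev (M.poly T i) x).differentiableAt

lemma continuous_psi (T : Fin N) : Continuous (M.psi T) := (M.differentiable_psi T).continuous

lemma fderiv_psi_apply (T : Fin N) (x v : Plane) (i : Fin 2) :
    fderiv ℝ (M.psi T) x v i = evDeriv (M.poly T i) x v := by
  have h := (EuclideanSpace.proj (𝕜 := ℝ) i : Plane →L[ℝ] ℝ).hasFDerivAt.comp x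
    (M.differentiable_psi T x).hasFDerivAt
  have := h.unique (hasFDerivAt_ev (M.poly T i) x)
  rw [← this]
  simp

/-- The Jacobian determinant of the elemental map, as a polynomial. -/
def detPoly (T : Fin N) : MvPolynomial (Fin 2) ℝ :=
  MvPolynomial.pderiv 0 (M.poly T 0) * MvPolynomial.pderiv 1 (M.poly T 1)
    - MvPolynomial.pderiv 1 (M.poly T 0) * MvPolynomial.pderiv 0 (M.poly T 1)

/-- The entries of the adjugate of the Jacobian matrix of the elemental map. -/
def adjPoly (T : Fin N) (j l : Fin 2) : MvPolynomial (Fin 2) ℝ :=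
  !![MvPolynomial.pderiv 1 (M.poly T 1), -MvPolynomial.pderiv 0 (M.poly T 1);
    -MvPolynomial.pderiv 1 (M.poly T 0), MvPolynomial.pderiv 0 (M.poly T 0)] j l

lemma totalDegree_pderiv_poly (T : Fin N) (i l : Fin 2) :
    (MvPolynomial.pderiv l (M.poly T i)).totalDegree ≤ k :=
  (totalDegree_pderiv_le _ _).trans (M.degree_le T i)

lemma totalDegree_detPoly (T : Fin N) : (M.detPoly T).totalDegree ≤ 2 * k := by
  refine (MvPolynomial.totalDegree_sub _ _).trans (max_le ?_ ?_) <;>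
  refine (MvPolynomial.totalDegree_mul _ _).trans ?_ <;> rw [two_mul] <;>
  exact add_le_add (M.totalDegree_pderiv_poly _ _ _) (M.totalDegree_pderiv_poly _ _ _)

lemma totalDegree_adjPoly (T : Fin N) (j l : Fin 2) : (M.adjPoly T j l).totalDegree ≤ k := by
  fin_cases j <;> fin_cases l <;> simp [adjPoly, M.totalDegree_pderiv_poly]

lemma det_fderiv_psi (T : Fin N) (x : Plane) :
    (fderiv ℝ (M.psi T) x).det = ev (M.detPoly T) x := by
  rw [ContinuousLinearMap.det, ← LinearMap.det_toMatrix (EuclideanSpace.basisFun (Fin 2) ℝ).toBasis,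
    Matrix.det_fin_two]
  simp [LinearMap.toMatrix_apply, fderiv_psi_apply, evDeriv_apply, detPoly, ev]

lemma ev_detPoly_ne_zero (T : Fin N) {x : Plane} (hx : x ∈ refTri) : ev (M.detPoly T) x ≠ 0 := by
  rw [← det_fderiv_psi]
  exact M.det_ne_zero T x hx

/-- The derivative of the elemental map as an isomorphism. -/
def psiEquiv (T : Fin N) {x : Plane} (hx : x ∈ refTri) : Plane ≃L[ℝ] Plane :=
  (fderiv ℝ (M.psi T) x).toContinuousLinearEquivOfDetNeZero (M.det_ne_zero T x hx)

lemma coe_psiEquiv (T : Fin N) {x : Plane} (hx : x ∈ refTri) :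
    (M.psiEquiv T hx : Plane →L[ℝ] Plane) = fderiv ℝ (M.psi T) x :=
  ContinuousLinearMap.coe_toContinuousLinearEquivOfDetNeZero _ _

lemma psiEquiv_symm_single (T : Fin N) {x : Plane} (hx : x ∈ refTri) (j l : Fin 2) :
    (M.psiEquiv T hx).symm (EuclideanSpace.single j 1) l
      = ev (M.adjPoly T j l) x / ev (M.detPoly T) x := by
  have hd := M.ev_detPoly_ne_zero T hx
  have : (M.psiEquiv T hx).symm (EuclideanSpace.single j 1)
      = WithLp.toLp 2 fun l => ev (M.adjPoly T j l) x / ev (M.detPoly T) x := by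
    rw [ContinuousLinearEquiv.symm_apply_eq]
    have e : ∀ v, M.psiEquiv T hx v = fderiv ℝ (M.psi T) x v := fun v => by
      rw [← M.coe_psiEquiv T hx]; rfl
    rw [e]
    ext i
    rw [fderiv_psi_apply, evDeriv_apply]
    simp only [Fin.sum_univ_two]
    field_simp
    fin_cases i <;> fin_cases j <;> simp [adjPoly, detPoly, ev] <;> ring
  rw [this]

lemma inv_psi (T : Fin N) {x : Plane} (hx : x ∈ refTri) : M.inv T (M.psi T x) = x :=
  (M.injOn T).leftInvOn_invFunOn hx

lemma inv_mem (T : Fin N) {y : Plane} (hy : y ∈ M.elem T) : M.inv T y ∈ refTri := by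
  obtain ⟨x, hx, rfl⟩ := hy
  rwa [inv_psi _ _ hx]

lemma psi_inv (T : Fin N) {y : Plane} (hy : y ∈ M.elem T) : M.psi T (M.inv T y) = y := by
  obtain ⟨x, hx, rfl⟩ := hy
  rw [inv_psi _ _ hx]

lemma psi_mem (T : Fin N) {x : Plane} (hx : x ∈ refTri) : M.psi T x ∈ M.elem T :=
  ⟨x, hx, rfl⟩

lemma isCompact_elem (T : Fin N) : IsCompact (M.elem T) :=
  isCompact_refTri.image (M.continuous_psi T)

lemma continuousOn_inv (T : Fin N) : ContinuousOn (M.inv T) (M.elem T) :=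
  continuousOn_invFunOn isCompact_refTri (M.continuous_psi T) (M.injOn T)

/-- Continuity of the inverse together with invertibility of the Jacobian gives differentiability
within the closed element, including at its boundary, where edge traces are taken. -/
lemma hasFDerivWithinAt_inv (T : Fin N) {x : Plane} (hx : x ∈ refTri) :
    HasFDerivWithinAt (M.inv T) ((M.psiEquiv T hx).symm : Plane →L[ℝ] Plane) (M.elem T)
      (M.psi T x) := by
  have hy := M.psi_mem T hx
  refine HasFDerivWithinAt.of_local_left_inverse (f := M.psi T) (t := refTri) ?_ ?_ hy ?_
  · exact (M.continuousOn_inv T (M.psi T x) hy).tendsto_nhdsWithin fun z hz => M.inv_mem T hz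
  · rw [coe_psiEquiv, inv_psi _ _ hx]
    exact (M.differentiable_psi T x).hasFDerivAt.hasFDerivWithinAt
  · filter_upwards [self_mem_nhdsWithin] with z hz using M.psi_inv T hz

/-- This makes derivatives within the closed element well determined up to its boundary. It is
inherited from the convex reference triangle, since the Jacobian is onto. -/
lemma uniqueDiffOn_elem (T : Fin N) : UniqueDiffOn ℝ (M.elem T) := by
  rintro _ ⟨x, hx, rfl⟩
  refine ((M.differentiable_psi T x).hasFDerivAt.hasFDerivWithinAt).uniqueDiffWithinAt
    (uniqueDiffOn_refTri x hx) ?_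
  rw [← M.coe_psiEquiv T hx]
  exact (M.psiEquiv T hx).surjective.denseRange

lemma hasFDerivWithinAt_of_comp {T : Fin N} {w W : Plane → ℝ} {W' : Plane →L[ℝ] ℝ}
    (h : ∀ x ∈ refTri, w (M.psi T x) = W x) {x : Plane} (hx : x ∈ refTri)
    (hW : HasFDerivAt W W' x) :
    HasFDerivWithinAt w (W'.comp ((M.psiEquiv T hx).symm : Plane →L[ℝ] Plane)) (M.elem T)
      (M.psi T x) := by
  have h1 : HasFDerivAt W W' (M.inv T (M.psi T x)) := by rwa [inv_psi _ _ hx]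
  have h2 := h1.comp_hasFDerivWithinAt _ (M.hasFDerivWithinAt_inv T hx)
  refine h2.congr (fun y hy => ?_) ?_
  · rw [Function.comp_apply, ← h _ (M.inv_mem T hy), psi_inv _ _ hy]
  · rw [Function.comp_apply, inv_psi _ _ hx, h x hx]

lemma apply_eq_sum_single {W' : Plane →L[ℝ] ℝ} (v : Plane) :
    W' v = ∑ l, v l * W' (EuclideanSpace.single l 1) := by
  conv_lhs => rw [← (EuclideanSpace.basisFun (Fin 2) ℝ).sum_repr v]
  simp

lemma pd_of_comp {T : Fin N} {w W : Plane → ℝ} {W' : Plane →L[ℝ] ℝ}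
    (h : ∀ x ∈ refTri, w (M.psi T x) = W x) {x : Plane} (hx : x ∈ refTri)
    (hW : HasFDerivAt W W' x) (j : Fin 2) :
    pd (M.elem T) j w (M.psi T x) = ∑ l, ev (M.adjPoly T j l) x / ev (M.detPoly T) x
      * W' (EuclideanSpace.single l 1) := by
  rw [pd, (M.hasFDerivWithinAt_of_comp h hx hW).fderivWithin
    (M.uniqueDiffOn_elem T _ (M.psi_mem T hx)), ContinuousLinearMap.comp_apply,
    apply_eq_sum_single]
  simp only [ContinuousLinearEquiv.coe_coe, psiEquiv_symm_single]

/-- On the element `T`, in reference coordinates, `w` is a polynomial of degree at most `n`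
divided by the `m`-th power of the Jacobian determinant. -/
def IsRational (T : Fin N) (m n : ℕ) (w : Plane → ℝ) : Prop :=
  ∃ Q : MvPolynomial (Fin 2) ℝ, Q.totalDegree ≤ n ∧
    ∀ x ∈ refTri, w (M.psi T x) = ev Q x / ev (M.detPoly T) x ^ m

/-- The numerator of the derivative of a rational function. -/
def derivNum (T : Fin N) (m : ℕ) (Q : MvPolynomial (Fin 2) ℝ) (l : Fin 2) :
    MvPolynomial (Fin 2) ℝ :=
  MvPolynomial.pderiv l Q * M.detPoly T
    - MvPolynomial.C (m : ℝ) * (Q * MvPolynomial.pderiv l (M.detPoly T))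

lemma hasFDerivAt_rational (T : Fin N) (m : ℕ) (Q : MvPolynomial (Fin 2) ℝ) {x : Plane}
    (hx : x ∈ refTri) : ∃ W' : Plane →L[ℝ] ℝ,
      HasFDerivAt (fun x => ev Q x / ev (M.detPoly T) x ^ m) W' x ∧
      ∀ l, W' (EuclideanSpace.single l 1)
        = ev (M.derivNum T m Q l) x / ev (M.detPoly T) x ^ (m + 1) := by
  have hd := M.ev_detPoly_ne_zero T hx
  have h1 := (hasDerivAt_zpow (-(m : ℤ)) (ev (M.detPoly T) x) (Or.inl hd)).comp_hasFDerivAt x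
    (hasFDerivAt_ev (M.detPoly T) x)
  have h2 := (hasFDerivAt_ev Q x).mul h1
  refine ⟨_, h2.congr_of_eventuallyEq (Filter.Eventually.of_forall fun y => ?_), fun l => ?_⟩
  · simp [div_eq_mul_inv]
  · have e : ev (M.detPoly T) x ^ (-(m : ℤ) - 1) = (ev (M.detPoly T) x ^ (m + 1))⁻¹ := by
      rw [← zpow_natCast, ← zpow_neg]
      congr 1
      push_cast; ring
    simp only [add_apply, smul_apply, smul_eq_mul,
      evDeriv_apply, e, Function.comp_apply, zpow_neg, zpow_natCast]
    fin_cases l <;> simp [derivNum, ev] <;> field_simp <;> ring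

variable {M}

/-- The quotient rule raises the power of the determinant by one and the degree by `2k`; the inverse
Jacobian, adjugate over determinant, contributes one more power and degree `k`. -/
lemma IsRational.pd {T : Fin N} {m n : ℕ} {w : Plane → ℝ} (h : M.IsRational T m n w)
    (j : Fin 2) : M.IsRational T (m + 2) (n + 3 * k) (pd (M.elem T) j w) := by
  obtain ⟨Q, hQ, hw⟩ := h
  refine ⟨∑ l, M.adjPoly T j l * M.derivNum T m Q l, ?_, fun x hx => ?_⟩
  · refine (MvPolynomial.totalDegree_finsetSum _ _).trans (Finset.sup_le fun l _ => ?_)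
    refine (MvPolynomial.totalDegree_mul _ _).trans ?_
    have h1 := M.totalDegree_adjPoly T j l
    have h2 : (M.derivNum T m Q l).totalDegree ≤ n + 2 * k := by
      refine (MvPolynomial.totalDegree_sub _ _).trans (max_le ?_ ?_)
      · refine (MvPolynomial.totalDegree_mul _ _).trans ?_
        exact add_le_add ((totalDegree_pderiv_le _ _).trans hQ) (M.totalDegree_detPoly T)
      · refine (MvPolynomial.totalDegree_mul _ _).trans ?_
        rw [MvPolynomial.totalDegree_C, zero_add]
        refine (MvPolynomial.totalDegree_mul _ _).trans ?_
        exact add_le_add hQ ((totalDegree_pderiv_le _ _).trans (M.totalDegree_detPoly T))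
    omega
  · obtain ⟨W', hW, hW'⟩ := M.hasFDerivAt_rational T m Q hx
    have hd := M.ev_detPoly_ne_zero T hx
    rw [M.pd_of_comp hw hx hW j]
    simp only [hW', Fin.sum_univ_two, map_add, map_mul, ev] at hd ⊢
    field_simp
    ring

lemma IsRational.add {T : Fin N} {m n : ℕ} {w w' : Plane → ℝ} (h : M.IsRational T m n w)
    (h' : M.IsRational T m n w') : M.IsRational T m n (fun x => w x + w' x) := by
  obtain ⟨Q, hQ, hw⟩ := h
  obtain ⟨Q', hQ', hw'⟩ := h'
  refine ⟨Q + Q', (MvPolynomial.totalDegree_add _ _).trans (max_le hQ hQ'), fun x hx => ?_⟩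
  simp only [hw x hx, hw' x hx, ev, map_add]
  ring

lemma IsRational.differentiableOn {T : Fin N} {m n : ℕ} {w : Plane → ℝ}
    (h : M.IsRational T m n w) : DifferentiableOn ℝ w (M.elem T) := by
  obtain ⟨Q, hQ, hw⟩ := h
  rintro _ ⟨x, hx, rfl⟩
  obtain ⟨W', hW, -⟩ := M.hasFDerivAt_rational T m Q hx
  exact (M.hasFDerivWithinAt_of_comp hw hx hW).differentiableWithinAt

variable (M)

lemma isRational_loc (v : DGSpace k N) (T : Fin N) : M.IsRational T 0 k (M.loc v T) := by
  refine ⟨v T, (MvPolynomial.mem_restrictTotalDegree _ _ _).1 (v T).2, fun x hx => ?_⟩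
  simp [loc, inv_psi _ _ hx]

lemma isRational_d1 (v : DGSpace k N) (i : Fin 2) (T : Fin N) :
    M.IsRational T 2 (4 * k) (M.d1 v i T) := by
  have := (M.isRational_loc v T).pd i
  rwa [show k + 3 * k = 4 * k by ring] at this

lemma isRational_d2 (v : DGSpace k N) (i j : Fin 2) (T : Fin N) :
    M.IsRational T 4 (7 * k) (M.d2 v i j T) := by
  have := (M.isRational_d1 v i T).pd j
  rwa [show 4 * k + 3 * k = 7 * k by ring] at this

lemma isRational_lap (v : DGSpace k N) (T : Fin N) : M.IsRational T 4 (7 * k) (M.lap v T) := by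
  have := (M.isRational_d2 v 0 0 T).add (M.isRational_d2 v 1 1 T)
  have e : M.lap v T = fun x => M.d2 v 0 0 T x + M.d2 v 1 1 T x := by
    ext x; simp [lap]
  rwa [e]

end IsoMesh

/-! ### Scaling of the Jacobian and inverse inequalities on curved elements. -/

namespace IsoMesh

variable {k N : ℕ} {Ω : Set Plane} (M : IsoMesh k N Ω)

lemma diam_elem_pos (T : Fin N) : 0 < Metric.diam (M.elem T) := by
  have h0 := M.psi_mem T (refVertex_mem 0)
  have h1 := M.psi_mem T (refVertex_mem 1)
  refine lt_of_lt_of_le (dist_pos.2 fun h => ?_)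
    (Metric.dist_le_diam_of_mem (M.isCompact_elem T).isBounded h0 h1)
  have h2 := M.injOn T (refVertex_mem 0) (refVertex_mem 1) h
  have h3 := congrArg (fun x : Plane => x 0) h2
  simp [refVertex] at h3

variable {M} in
lemma ShapeRegular.pderiv_le {σ : ℝ} (hM : M.ShapeRegular σ) (T : Fin N) {x : Plane}
    (hx : x ∈ refTri) (i l : Fin 2) :
    |ev (MvPolynomial.pderiv l (M.poly T i)) x| ≤ σ * Metric.diam (M.elem T) := by
  have h := (hM T).1 x hx
  have h1 := (fderiv ℝ (M.psi T) x).le_opNorm (EuclideanSpace.single l 1)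
  have h2 := PiLp.norm_apply_le (fderiv ℝ (M.psi T) x (EuclideanSpace.single l 1)) i
  rw [fderiv_psi_apply, evDeriv_apply] at h2
  simp at h1 h2
  exact h2.trans (h1.trans h)

variable {M} in
lemma ShapeRegular.adj_div_le {σ : ℝ} (hM : M.ShapeRegular σ) (T : Fin N) {x : Plane}
    (hx : x ∈ refTri) (j l : Fin 2) :
    |ev (M.adjPoly T j l) x / ev (M.detPoly T) x| ≤ σ / Metric.diam (M.elem T) := by
  have h := (hM T).2 _ (M.psi_mem T hx)
  rw [(M.hasFDerivWithinAt_inv T hx).fderivWithin (M.uniqueDiffOn_elem T _ (M.psi_mem T hx))] at h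
  have h1 := ((M.psiEquiv T hx).symm : Plane →L[ℝ] Plane).le_opNorm (EuclideanSpace.single j 1)
  have h2 := PiLp.norm_apply_le ((M.psiEquiv T hx).symm (EuclideanSpace.single j 1)) l
  rw [psiEquiv_symm_single] at h2
  simp only [PiLp.norm_single, norm_one, mul_one] at h1
  exact h2.trans (h1.trans h)

variable {M} in
lemma ShapeRegular.det_le {σ : ℝ} (hM : M.ShapeRegular σ) (T : Fin N) {x : Plane}
    (hx : x ∈ refTri) :
    |ev (M.detPoly T) x| ≤ 2 * σ ^ 2 * Metric.diam (M.elem T) ^ 2 := by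
  have h := fun i l => hM.pderiv_le T hx i l
  have h0 : 0 ≤ σ * Metric.diam (M.elem T) := (abs_nonneg _).trans (h 0 0)
  simp only [detPoly, ev, map_sub, map_mul] at h ⊢
  refine (abs_sub _ _).trans ?_
  rw [abs_mul, abs_mul]
  have h1 := mul_le_mul (h 0 0) (h 1 1) (abs_nonneg _) h0
  have h2 := mul_le_mul (h 0 1) (h 1 0) (abs_nonneg _) h0
  linarith

variable {M} in
lemma ShapeRegular.le_det {σ : ℝ} (hσ : 0 < σ) (hM : M.ShapeRegular σ) (T : Fin N) {x : Plane}
    (hx : x ∈ refTri) :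
    Metric.diam (M.elem T) ^ 2 / (2 * σ ^ 2) ≤ |ev (M.detPoly T) x| := by
  have hd := M.ev_detPoly_ne_zero T hx
  have hH := M.diam_elem_pos T
  have h := fun j l => hM.adj_div_le T hx j l
  have h0 : 0 ≤ σ / Metric.diam (M.elem T) := by positivity
  -- The reciprocal of the determinant is the determinant of the inverse Jacobian, whose entries are
  -- at most `σ / h_T`.
  have e : (ev (M.detPoly T) x)⁻¹
      = (ev (M.adjPoly T 0 0) x / ev (M.detPoly T) x) * (ev (M.adjPoly T 1 1) x / ev (M.detPoly T) x)
      - (ev (M.adjPoly T 0 1) x / ev (M.detPoly T) x)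
        * (ev (M.adjPoly T 1 0) x / ev (M.detPoly T) x) := by
    field_simp
    simp [adjPoly, detPoly, ev]
    ring
  have h3 : |(ev (M.detPoly T) x)⁻¹| ≤ 2 * (σ / Metric.diam (M.elem T)) ^ 2 := by
    rw [e]
    refine (abs_sub _ _).trans ?_
    rw [abs_mul, abs_mul]
    have h1 := mul_le_mul (h 0 0) (h 1 1) (abs_nonneg _) h0
    have h2 := mul_le_mul (h 0 1) (h 1 0) (abs_nonneg _) h0
    linarith
  rw [abs_inv, inv_le_comm₀ (abs_pos.2 hd) (by positivity)] at h3
  refine le_trans (le_of_eq ?_) h3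
  field_simp

lemma setIntegral_elem (T : Fin N) (g : Plane → ℝ) :
    ∫ y in M.elem T, g y = ∫ x in refTri, |ev (M.detPoly T) x| * g (M.psi T x) := by
  rw [elem, integral_image_eq_integral_abs_det_fderiv_smul volume isCompact_refTri.measurableSet
    (fun x _ => (M.differentiable_psi T x).hasFDerivAt.hasFDerivWithinAt) (M.injOn T)]
  simp only [det_fderiv_psi, smul_eq_mul]

variable {M} in
lemma IsRational.continuousOn {T : Fin N} {m n : ℕ} {w : Plane → ℝ}
    (h : M.IsRational T m n w) : ContinuousOn w (M.elem T) :=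
  h.differentiableOn.continuousOn

set_option maxHeartbeats 1000000 in
/-- Inverse inequalities on the elements for rational functions. -/
lemma exists_rational_bound (k m n : ℕ) {σ : ℝ} (hσ : 0 < σ) : ∃ C > 0,
    ∀ (N : ℕ) (Ω : Set Plane) (M : IsoMesh k N Ω), M.ShapeRegular σ → ∀ (T : Fin N) (w : Plane → ℝ),
      M.IsRational T m n w → ∀ y ∈ M.elem T,
        w y ^ 2 ≤ C / Metric.diam (M.elem T) ^ 2 * ∫ z in M.elem T, w z ^ 2 ∧
        ∀ j, pd (M.elem T) j w y ^ 2
          ≤ C / Metric.diam (M.elem T) ^ 4 * ∫ z in M.elem T, w z ^ 2 := by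
  obtain ⟨C₁, hC₁, h₁⟩ := exists_ev_sq_le n LinearMap.id
  choose C₂ hC₂ h₂ using fun l : Fin 2 => exists_ev_sq_le n (MvPolynomial.pderiv l).toLinearMap
  choose C₃ hC₃ h₃ using fun l : Fin 2 =>
    exists_ev_sq_le (2 * k) (MvPolynomial.pderiv l).toLinearMap
  set V := (volume refTri).toReal with hV
  have hV0 : 0 ≤ V := ENNReal.toReal_nonneg
  -- `κ` is the ratio of the upper bound `2σ²h_T²` to the lower bound `b = h_T² / (2σ²)` of the
  -- absolute determinant.
  set κ := 4 * σ ^ 4 with hκ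
  have hκ0 : 0 < κ := by positivity
  -- The two summands come from squaring the numerator `∂Q · det - m Q ∂det` of the quotient rule.
  set C₄ := fun l => 2 * C₂ l + 2 * m ^ 2 * C₁ * C₃ l * V * κ ^ 2 with hC₄
  have hC₄0 : ∀ l, 0 < C₄ l := fun l => by
    have := hC₂ l; have := hC₃ l
    simp only [hC₄]; positivity
  refine ⟨C₁ * κ ^ (2 * m) * (2 * σ ^ 2)
    + 2 * σ ^ 2 * ((C₄ 0 + C₄ 1) * κ ^ (2 * m) * (2 * σ ^ 2)), ?_, ?_⟩
  · have := hC₄0 0; have := hC₄0 1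
    positivity
  rintro N Ω M hM T w ⟨Q, hQ, hw⟩ _ ⟨x, hx, rfl⟩
  have hH := M.diam_elem_pos T
  set H := Metric.diam (M.elem T)
  set I := ∫ z in M.elem T, w z ^ 2 with hI
  have hI0 : 0 ≤ I := integral_nonneg fun z => sq_nonneg _
  set b := H ^ 2 / (2 * σ ^ 2) with hb
  have hb0 : 0 < b := by positivity
  have hκb : 2 * σ ^ 2 * H ^ 2 = κ * b := by rw [hκ, hb]; field_simp; ring
  have hle : ∀ z ∈ refTri, |ev (M.detPoly T) z| ≤ κ * b := fun z hz => hκb ▸ hM.det_le T hz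
  have hge : ∀ z ∈ refTri, b ≤ |ev (M.detPoly T) z| := fun z hz => hM.le_det hσ T hz
  set S := κ ^ (2 * m) * I / b with hS
  have hS0 : 0 ≤ S := by positivity
  set K := ∫ z in refTri, ev Q z ^ 2 with hK
  have hK0 : 0 ≤ K := integral_nonneg fun z => sq_nonneg _
  -- Passage from `w` back to its numerator `Q`. The change of variables costs a factor `1 / b`, and
  -- the denominator is at most `(κ b) ^ m`.
  have hKS : K ≤ S * b ^ (2 * m) := by
    have e : S * b ^ (2 * m) = ∫ z in refTri, (κ * b) ^ (2 * m) / b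
        * (|ev (M.detPoly T) z| * w (M.psi T z) ^ 2) := by
      rw [integral_const_mul, ← M.setIntegral_elem T fun z => w z ^ 2, hS, ← hI, mul_pow κ b]
      field_simp
    rw [e]
    refine setIntegral_mono_on (((continuous_ev Q).pow 2).continuousOn.integrableOn_compact
      isCompact_refTri) (ContinuousOn.integrableOn_compact isCompact_refTri ?_)
      isCompact_refTri.measurableSet fun z hz => ?_
    · refine continuousOn_const.mul ((continuous_ev _).abs.continuousOn.mul (ContinuousOn.pow ?_ 2))
      refine ContinuousOn.congr (f := fun z => ev Q z / ev (M.detPoly T) z ^ m) ?_ hw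
      exact (continuous_ev Q).continuousOn.div ((continuous_ev _).pow m).continuousOn
        fun z hz => pow_ne_zero _ (M.ev_detPoly_ne_zero T hz)
    · have hd := abs_pos.2 (M.ev_detPoly_ne_zero T hz)
      have e : (κ * b) ^ (2 * m) / b * (|ev (M.detPoly T) z| * w (M.psi T z) ^ 2)
          = (|ev (M.detPoly T) z| / b) * ((κ * b) / |ev (M.detPoly T) z|) ^ (2 * m)
            * ev Q z ^ 2 := by
        rw [hw z hz, div_pow, div_pow, ← sq_abs (_ ^ m), abs_pow, ← pow_mul, mul_comm m 2]
        field_simp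
      rw [e]
      refine le_mul_of_one_le_left (sq_nonneg _) (one_le_mul_of_one_le_of_one_le ?_ ?_)
      · rw [one_le_div hb0]; exact hge z hz
      · refine one_le_pow₀ ?_
        rw [one_le_div hd]; exact hle z hz
  have hd := M.ev_detPoly_ne_zero T hx
  have hdb : ∀ A : ℝ, 0 ≤ A → A * K / (ev (M.detPoly T) x ^ m) ^ 2 ≤ A * S := by
    intro A hA
    have h : b ^ (2 * m) ≤ (ev (M.detPoly T) x ^ m) ^ 2 := by
      rw [← sq_abs (_ ^ m), abs_pow, mul_comm, pow_mul]
      exact pow_le_pow_left₀ (by positivity) (pow_le_pow_left₀ hb0.le (hge x hx) m) 2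
    rw [div_le_iff₀ (by positivity), mul_assoc]
    exact mul_le_mul_of_nonneg_left (hKS.trans (mul_le_mul_of_nonneg_left h hS0)) hA
  have hSI : S = κ ^ (2 * m) * (2 * σ ^ 2) / H ^ 2 * I := by rw [hS, hb]; field_simp
  constructor
  · have h4 : w (M.psi T x) ^ 2 ≤ C₁ * S := by
      refine le_trans ?_ (hdb C₁ hC₁.le)
      rw [hw x hx, div_pow]
      exact div_le_div_of_nonneg_right (h₁ Q hQ x hx) (by positivity)
    refine h4.trans ?_
    have h5 : 0 ≤ 2 * σ ^ 2 * ((C₄ 0 + C₄ 1) * κ ^ (2 * m) * (2 * σ ^ 2)) := by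
      have := hC₄0 0; have := hC₄0 1
      positivity
    calc C₁ * S = C₁ * κ ^ (2 * m) * (2 * σ ^ 2) / H ^ 2 * I := by rw [hSI]; ring
      _ ≤ _ := by gcongr; linarith
  · intro j
    obtain ⟨W', hW, hW'⟩ := M.hasFDerivAt_rational T m Q hx
    have hWl : ∀ l, W' (EuclideanSpace.single l 1) ^ 2 ≤ C₄ l * S := by
      intro l
      refine le_trans ?_ (hdb (C₄ l) (hC₄0 l).le)
      -- The determinant is itself a polynomial of degree at most `2k` that varies by at most the
      -- factor `κ`, so the inverse inequality bounds its derivative by its own value at `x`.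
      have hdd : ev (MvPolynomial.pderiv l (M.detPoly T)) x ^ 2
          ≤ C₃ l * V * κ ^ 2 * ev (M.detPoly T) x ^ 2 := by
        refine (h₃ l _ (M.totalDegree_detPoly T) x hx).trans ?_
        have h6 : ∫ z in refTri, ev (M.detPoly T) z ^ 2 ≤ V * (κ * b) ^ 2 := by
          have : ∫ z in refTri, (κ * b) ^ 2 = V * (κ * b) ^ 2 := by simp [Measure.real, hV]
          rw [← this]
          refine setIntegral_mono_on (((continuous_ev _).pow 2).continuousOn.integrableOn_compact
            isCompact_refTri) (continuousOn_const.integrableOn_compact isCompact_refTri)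
            isCompact_refTri.measurableSet fun z hz => ?_
          exact sq_le_sq' (abs_le.1 (hle z hz)).1 (abs_le.1 (hle z hz)).2
        have h7 : b ^ 2 ≤ ev (M.detPoly T) x ^ 2 := by
          rw [← sq_abs (ev (M.detPoly T) x)]
          exact pow_le_pow_left₀ hb0.le (hge x hx) 2
        have := hC₃ l
        calc C₃ l * _ ≤ C₃ l * (V * (κ * b) ^ 2) := by gcongr
          _ = C₃ l * V * κ ^ 2 * b ^ 2 := by ring
          _ ≤ _ := by gcongr
      have hq := h₁ Q hQ x hx
      have hdq := h₂ l Q hQ x hx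
      simp only [LinearMap.id_apply, ← hK] at hq hdq
      have hN : ev (M.derivNum T m Q l) x ^ 2 ≤ C₄ l * K * ev (M.detPoly T) x ^ 2 := by
        have e : ev (M.derivNum T m Q l) x = ev (MvPolynomial.pderiv l Q) x * ev (M.detPoly T) x
            - m * (ev Q x * ev (MvPolynomial.pderiv l (M.detPoly T)) x) := by
          simp [derivNum, ev]
        rw [e]
        have h8 : (ev Q x * ev (MvPolynomial.pderiv l (M.detPoly T)) x) ^ 2
            ≤ (C₁ * K) * (C₃ l * V * κ ^ 2 * ev (M.detPoly T) x ^ 2) := by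
          rw [mul_pow]
          exact mul_le_mul hq hdd (sq_nonneg _) (by positivity)
        have h9 : (ev (MvPolynomial.pderiv l Q) x * ev (M.detPoly T) x) ^ 2
            ≤ C₂ l * K * ev (M.detPoly T) x ^ 2 := by
          rw [mul_pow]
          exact mul_le_mul_of_nonneg_right hdq (sq_nonneg _)
        have h10 : ∀ p q : ℝ, (p - m * q) ^ 2 ≤ 2 * p ^ 2 + 2 * m ^ 2 * q ^ 2 := fun p q => by
          nlinarith [sq_nonneg (p + m * q)]
        refine (h10 _ _).trans ?_
        have h11 := mul_le_mul_of_nonneg_left h8 (by positivity : (0 : ℝ) ≤ 2 * m ^ 2)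
        calc _ ≤ 2 * (C₂ l * K * ev (M.detPoly T) x ^ 2) + 2 * m ^ 2 *
              ((C₁ * K) * (C₃ l * V * κ ^ 2 * ev (M.detPoly T) x ^ 2)) := by gcongr
          _ = _ := by simp only [hC₄]; ring
      rw [hW', div_pow, div_le_div_iff₀ (by positivity) (by positivity)]
      calc ev (M.derivNum T m Q l) x ^ 2 * (ev (M.detPoly T) x ^ m) ^ 2
          ≤ C₄ l * K * ev (M.detPoly T) x ^ 2 * (ev (M.detPoly T) x ^ m) ^ 2 := by gcongr
        _ = _ := by ring
    have hadj : ∀ l, (ev (M.adjPoly T j l) x / ev (M.detPoly T) x) ^ 2 ≤ σ ^ 2 / H ^ 2 := by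
      intro l
      rw [← sq_abs, ← div_pow]
      exact pow_le_pow_left₀ (abs_nonneg _) (hM.adj_div_le T hx j l) 2
    rw [M.pd_of_comp hw hx hW j, Fin.sum_univ_two]
    have h12 : ∀ l, (ev (M.adjPoly T j l) x / ev (M.detPoly T) x
        * W' (EuclideanSpace.single l 1)) ^ 2 ≤ σ ^ 2 / H ^ 2 * (C₄ l * S) := by
      intro l
      rw [mul_pow]
      exact mul_le_mul (hadj l) (hWl l) (sq_nonneg _) (by positivity)
    refine add_sq_le.trans ?_
    calc _ ≤ 2 * (σ ^ 2 / H ^ 2 * (C₄ 0 * S) + σ ^ 2 / H ^ 2 * (C₄ 1 * S)) := by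
          have := h12 0; have := h12 1; gcongr
      _ = 2 * σ ^ 2 * ((C₄ 0 + C₄ 1) * κ ^ (2 * m) * (2 * σ ^ 2)) / H ^ 4 * I := by
          rw [hSI]; field_simp
      _ ≤ _ := by
          have : 0 ≤ C₁ * κ ^ (2 * m) * (2 * σ ^ 2) := by positivity
          gcongr; linarith

end IsoMesh

/-! ### Sides, arc length and normals. -/

lemma hasDerivAt_refSide (i : Fin 3) (t : ℝ) :
    HasDerivAt (refSide i) (refVertex (i + 2) - refVertex (i + 1)) t :=
  AffineMap.hasDerivAt_lineMap

lemma continuous_refSide (i : Fin 3) : Continuous (refSide i) :=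
  continuous_iff_continuousAt.2 fun t => (hasDerivAt_refSide i t).continuousAt

lemma refVertex_ne (i : Fin 3) : refVertex (i + 1) ≠ refVertex (i + 2) := by
  intro h
  have h0 := congrArg (fun x : Plane => x 0) h
  have h1 := congrArg (fun x : Plane => x 1) h
  fin_cases i <;> simp [refVertex] at h0 h1

lemma refSide_injective (i : Fin 3) : Function.Injective (refSide i) :=
  AffineMap.lineMap_injective ℝ (refVertex_ne i)

namespace IsoMesh

variable {k N : ℕ} {Ω : Set Plane} (M : IsoMesh k N Ω)

lemma hasDerivAt_sideParam (s : LocalSide N) (t : ℝ) :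
    HasDerivAt (M.sideParam s)
      (fderiv ℝ (M.psi s.1) (refSide s.2 t) (refVertex (s.2 + 2) - refVertex (s.2 + 1))) t :=
  (M.differentiable_psi s.1 (refSide s.2 t)).hasFDerivAt.comp_hasDerivAt t
    (hasDerivAt_refSide s.2 t)

lemma continuous_sideParam (s : LocalSide N) : Continuous (M.sideParam s) :=
  (M.continuous_psi s.1).comp (continuous_refSide s.2)

lemma deriv_sideParam_ne_zero (s : LocalSide N) {t : ℝ} (ht : t ∈ Set.Icc (0 : ℝ) 1) :
    deriv (M.sideParam s) t ≠ 0 := by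
  rw [(M.hasDerivAt_sideParam s t).deriv, ← M.coe_psiEquiv s.1 (refSide_mem s.2 ht)]
  intro h
  have h1 := (M.psiEquiv s.1 (refSide_mem s.2 ht)).map_eq_zero_iff.1 h
  exact refVertex_ne s.2 (sub_eq_zero.1 h1).symm

lemma injOn_sideParam (s : LocalSide N) : Set.InjOn (M.sideParam s) (Set.Icc 0 1) :=
  fun _ ha _ hb h => refSide_injective s.2
    (M.injOn s.1 (refSide_mem s.2 ha) (refSide_mem s.2 hb) h)

lemma side_subset (s : LocalSide N) : M.side s ⊆ M.elem s.1 := by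
  rintro _ ⟨t, ht, rfl⟩
  exact M.psi_mem s.1 (refSide_mem s.2 ht)

lemma openSide_subset (s : LocalSide N) : M.openSide s ⊆ M.side s :=
  Set.image_mono Set.Ioo_subset_Icc_self

lemma openSide_nonempty (s : LocalSide N) : (M.openSide s).Nonempty :=
  (Set.nonempty_Ioo.2 one_pos).image _

lemma isCompact_side (s : LocalSide N) : IsCompact (M.side s) :=
  isCompact_Icc.image (M.continuous_sideParam s)

lemma diam_side_pos (s : LocalSide N) : 0 < Metric.diam (M.side s) := by
  have h0 : M.sideParam s 0 ∈ M.side s := ⟨0, by simp, rfl⟩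
  have h1 : M.sideParam s 1 ∈ M.side s := ⟨1, by simp, rfl⟩
  refine lt_of_lt_of_le (dist_pos.2 fun h => ?_)
    (Metric.dist_le_diam_of_mem (M.isCompact_side s).isBounded h0 h1)
  exact zero_ne_one (M.injOn_sideParam s (by simp) (by simp) h)

lemma diam_side_le (s : LocalSide N) : Metric.diam (M.side s) ≤ Metric.diam (M.elem s.1) :=
  Metric.diam_mono (M.side_subset s) (M.isCompact_elem s.1).isBounded

lemma measurable_density (s : LocalSide N) : Measurable fun t => ‖deriv (M.sideParam s) t‖ₑ :=
  (measurable_deriv _).enorm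

lemma sideMeasure_univ (s : LocalSide N) :
    M.sideMeasure s Set.univ = ∫⁻ t in Set.Icc 0 1, ‖deriv (M.sideParam s) t‖ₑ := by
  rw [sideMeasure, Measure.map_apply (M.continuous_sideParam s).measurable MeasurableSet.univ,
    Set.preimage_univ, withDensity_apply _ MeasurableSet.univ, Measure.restrict_univ]

/-- The length of a side is controlled by its diameter. -/
lemma exists_sideMeasure_le (k : ℕ) : ∃ C > 0, ∀ (N : ℕ) (Ω : Set Plane) (M : IsoMesh k N Ω)
    (s : LocalSide N), M.sideMeasure s Set.univ ≤ ENNReal.ofReal (C * Metric.diam (M.side s)) := by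
  obtain ⟨C, hC, h⟩ := exists_deriv_side_le k
  refine ⟨2 * C, by positivity, fun N Ω M s => ?_⟩
  rw [sideMeasure_univ]
  have hb : ∀ t ∈ Set.Icc (0 : ℝ) 1, ‖deriv (M.sideParam s) t‖ₑ
      ≤ ENNReal.ofReal (2 * C * Metric.diam (M.side s)) := by
    intro t ht
    have hi : ∀ i, |deriv (M.sideParam s) t i| ≤ C * Metric.diam (M.side s) := by
      intro i
      -- Subtracting the value at an endpoint leaves a polynomial bounded on the side by the
      -- diameter of the side, without changing the derivative.
      let Q := M.poly s.1 i - MvPolynomial.C (M.sideParam s 0 i)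
      have hQ : ∀ r, ev Q (refSide s.2 r) = M.sideParam s r i - M.sideParam s 0 i := fun r => by
        simp only [Q, ev, map_sub, MvPolynomial.eval_C]
        rfl
      have hdeg : Q.totalDegree ≤ k := by
        refine (MvPolynomial.totalDegree_sub _ _).trans (max_le (M.degree_le _ _) ?_)
        simp
      have h1 := h Q hdeg s.2 (Metric.diam (M.side s)) (fun r hr => by
        rw [hQ]
        refine le_trans ?_ (Metric.dist_le_diam_of_mem (M.isCompact_side s).isBounded
          (⟨r, hr, rfl⟩ : M.sideParam s r ∈ M.side s)
          (⟨0, by simp, rfl⟩ : M.sideParam s 0 ∈ M.side s))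
        rw [dist_eq_norm]
        exact PiLp.norm_apply_le (M.sideParam s r - M.sideParam s 0) i) t ht
      have h2 : HasDerivAt (fun r => ev Q (refSide s.2 r)) (deriv (M.sideParam s) t i) t := by
        simp only [hQ]
        have h3 := (M.hasDerivAt_sideParam s t).differentiableAt.hasDerivAt
        exact ((EuclideanSpace.proj (𝕜 := ℝ) i : Plane →L[ℝ] ℝ).hasFDerivAt.comp_hasDerivAt t
          h3).sub_const _
      rwa [h2.deriv] at h1
    rw [← ofReal_norm]
    refine ENNReal.ofReal_le_ofReal ?_
    have hp : 0 ≤ C * Metric.diam (M.side s) := by have := M.diam_side_pos s; positivity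
    rw [EuclideanSpace.norm_eq, Real.sqrt_le_left (by linarith), Fin.sum_univ_two]
    simp only [Real.norm_eq_abs]
    nlinarith [hi 0, hi 1, abs_nonneg (deriv (M.sideParam s) t 0),
      abs_nonneg (deriv (M.sideParam s) t 1)]
  calc _ ≤ ∫⁻ t in Set.Icc (0 : ℝ) 1, ENNReal.ofReal (2 * C * Metric.diam (M.side s)) :=
        setLIntegral_mono' measurableSet_Icc hb
    _ = _ := by simp

instance (s : LocalSide N) : IsFiniteMeasure (M.sideMeasure s) := by
  obtain ⟨C, -, h⟩ := exists_sideMeasure_le k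
  exact ⟨(h N Ω M s).trans_lt ENNReal.ofReal_lt_top⟩

lemma ae_mem_side (s : LocalSide N) : ∀ᵐ x ∂M.sideMeasure s, x ∈ M.side s := by
  refine (ae_map_iff (p := fun x => x ∈ M.side s) (M.continuous_sideParam s).aemeasurable
    (M.isCompact_side s).measurableSet).2 ?_
  refine (withDensity_absolutelyContinuous _ _).ae_le ?_
  filter_upwards [ae_restrict_mem measurableSet_Icc] with t ht using ⟨t, ht, rfl⟩

/-- The speed of the parametrisation never vanishes. This is what later turns a vanishing edge norm
into an actual point of the edge where the jump is zero. -/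
lemma sideMeasure_ne_zero (s : LocalSide N) : M.sideMeasure s ≠ 0 := by
  intro h
  have h1 := M.sideMeasure_univ s
  rw [h, Measure.coe_zero, Pi.zero_apply, eq_comm, lintegral_eq_zero_iff (M.measurable_density s)]
    at h1
  have h2 : ∀ᵐ t ∂(volume.restrict (Set.Icc (0 : ℝ) 1)), False := by
    filter_upwards [h1, ae_restrict_mem measurableSet_Icc] with t ht ht'
    exact M.deriv_sideParam_ne_zero s ht' (by simpa using ht)
  rw [Filter.eventually_false_iff_eq_bot, ae_eq_bot, Measure.restrict_eq_zero] at h2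
  simp at h2

lemma aestronglyMeasurable_of_continuousOn {s : LocalSide N} {f : Plane → ℝ}
    (hf : ContinuousOn f (M.side s)) : AEStronglyMeasurable f (M.sideMeasure s) := by
  rw [← Measure.restrict_eq_self_of_ae_mem (M.ae_mem_side s)]
  exact hf.aestronglyMeasurable (M.isCompact_side s).measurableSet

lemma memLp_of_continuousOn {s : LocalSide N} {f : Plane → ℝ}
    (hf : ContinuousOn f (M.side s)) : MemLp f ⊤ (M.sideMeasure s) := by
  obtain ⟨C, hC⟩ := (M.isCompact_side s).exists_bound_of_continuousOn hf
  exact memLp_top_of_bound (M.aestronglyMeasurable_of_continuousOn hf) C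
    ((M.ae_mem_side s).mono hC)

lemma isRational_baryGrad (s : LocalSide N) (j : Fin 2) :
    M.IsRational s.1 2 (1 + 3 * k) (fun x => M.baryGrad s x j) := by
  refine IsRational.pd (w := fun y => refBary s.2 (M.inv s.1 y)) (m := 0) (n := 1) ?_ j
  refine ⟨![1 - MvPolynomial.X 0 - MvPolynomial.X 1, MvPolynomial.X 0, MvPolynomial.X 1] s.2,
    ?_, fun x hx => ?_⟩
  · generalize s.2 = i
    fin_cases i
    · refine (MvPolynomial.totalDegree_sub _ _).trans (max_le ?_ (by simp))
      exact (MvPolynomial.totalDegree_sub _ _).trans (max_le (by simp) (by simp))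
    · simp
    · simp
  · simp only [inv_psi _ _ hx]
    generalize s.2 = i
    fin_cases i <;> simp [refBary, ev]

/-- The inequality holds even where the gradient might vanish, by the convention `0⁻¹ = 0`, and it
is the only size information about normals that the estimates need. -/
lemma norm_normal_le (s : LocalSide N) (x : Plane) : ‖M.normal s x‖ ≤ 1 := by
  rw [normal, norm_neg, norm_smul, norm_inv, norm_norm]
  exact inv_mul_le_one

lemma memLp_normal (s : LocalSide N) (j : Fin 2) :
    MemLp (fun x => M.normal s x j) ⊤ (M.sideMeasure s) := by
  have hg : ∀ j, AEMeasurable (fun x => M.baryGrad s x j) (M.sideMeasure s) := fun j =>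
    (M.aestronglyMeasurable_of_continuousOn
      ((M.isRational_baryGrad s j).continuousOn.mono (M.side_subset s))).aemeasurable
  have e : (fun x => M.normal s x j) = fun x =>
      -((Real.sqrt (M.baryGrad s x 0 ^ 2 + M.baryGrad s x 1 ^ 2))⁻¹ * M.baryGrad s x j) := by
    ext x
    simp [normal, EuclideanSpace.norm_eq]
  refine memLp_top_of_bound ?_ 1 (Filter.Eventually.of_forall fun x =>
    (PiLp.norm_apply_le _ j).trans (M.norm_normal_le s x))
  rw [e]
  exact ((((hg 0).pow_const 2).add ((hg 1).pow_const 2)).sqrt.inv.mul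
    (hg j)).neg.aestronglyMeasurable

end IsoMesh

/-! ### Linearity of integrals and integrability of products. -/

section Linear

variable {V : Type*} [AddCommGroup V] [Module ℝ V]

lemma isLinearMap_iff_comb {f : V → ℝ} :
    IsLinearMap ℝ f ↔ ∀ (c : ℝ) (u v : V), f (c • u + v) = c * f u + f v := by
  refine ⟨fun h c u v => by rw [h.map_add, h.map_smul, smul_eq_mul], fun h => ⟨fun u v => ?_,
    fun c u => ?_⟩⟩
  · simpa using h 1 u v
  · have h0 : f 0 = 0 := by simpa using h (-1) 0 0
    simpa [h0] using h c u 0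

lemma IsLinearMap.add' {f g : V → ℝ} (hf : IsLinearMap ℝ f) (hg : IsLinearMap ℝ g) :
    IsLinearMap ℝ (fun v => f v + g v) := (hf.mk' f + hg.mk' g).isLinear

lemma IsLinearMap.sub' {f g : V → ℝ} (hf : IsLinearMap ℝ f) (hg : IsLinearMap ℝ g) :
    IsLinearMap ℝ (fun v => f v - g v) := (hf.mk' f - hg.mk' g).isLinear

lemma IsLinearMap.const_mul' {f : V → ℝ} (hf : IsLinearMap ℝ f) (c : ℝ) :
    IsLinearMap ℝ (fun v => c * f v) := (c • hf.mk' f).isLinear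

lemma IsLinearMap.mul_const' {f : V → ℝ} (hf : IsLinearMap ℝ f) (c : ℝ) :
    IsLinearMap ℝ (fun v => f v * c) := by
  simpa only [mul_comm] using hf.const_mul' c

lemma IsLinearMap.sum' {ι : Type*} {s : Finset ι} {f : ι → V → ℝ}
    (hf : ∀ i ∈ s, IsLinearMap ℝ (f i)) : IsLinearMap ℝ (fun v => ∑ i ∈ s, f i v) :=
  isLinearMap_iff_comb.2 fun c u v => by
    rw [Finset.mul_sum, ← Finset.sum_add_distrib]
    exact Finset.sum_congr rfl fun i hi => isLinearMap_iff_comb.1 (hf i hi) c u v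

/-- Linearity of the integrand is asked only almost everywhere, because derivatives within a closed
element are shown to be linear only at points of that element. -/
lemma isLinearMap_integral {μ : Measure Plane} {F : V → Plane → ℝ}
    (hint : ∀ v, Integrable (F v) μ) (hlin : ∀ᵐ x ∂μ, IsLinearMap ℝ fun v => F v x) :
    IsLinearMap ℝ fun v => ∫ x, F v x ∂μ := by
  refine isLinearMap_iff_comb.2 fun c u v => ?_
  rw [← integral_const_mul, ← integral_add ((hint u).const_mul c) (hint v)]
  refine integral_congr_ae ?_
  filter_upwards [hlin] with x hx using isLinearMap_iff_comb.1 hx c u v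

end Linear

lemma integrable_mul_of_memLp {μ : Measure Plane} {f g : Plane → ℝ} (hf : MemLp f 2 μ)
    (hg : MemLp g 2 μ) : Integrable (fun x => f x * g x) μ := hf.integrable_mul hg

lemma integrable_sum_mul_of_memLp {ι : Type*} [Fintype ι] {μ : Measure Plane}
    {f g : ι → Plane → ℝ} (hf : ∀ i, MemLp (f i) 2 μ) (hg : ∀ i, MemLp (g i) 2 μ) :
    Integrable (fun x => ∑ i, f i x * g i x) μ :=
  integrable_finsetSum _ fun i _ => integrable_mul_of_memLp (hf i) (hg i)

/-! ### Edges, jumps and averages; linearity and symmetry of the form. -/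

namespace IsoMesh

variable {k N : ℕ} {Ω : Set Plane} (M : IsoMesh k N Ω)

section Edges

variable {M} {P : DGParams N}

lemma mem_edges_some {s t : LocalSide N} :
    (s, some t) ∈ M.edges P ↔ s.1 < t.1 ∧ M.side s = M.side t ∧ M.openSide s ⊆ Ω := by
  simp [edges]

lemma mem_edges_none {s : LocalSide N} : (s, none) ∈ M.edges P ↔ s ∈ M.dirichletSides P := by
  simp [edges, dirichletSides]

lemma mem_edgesOff {e : MeshEdge N} :
    e ∈ M.edgesOff P ↔ e ∈ M.edges P ∧ ¬ M.openSide e.1 ⊆ P.Γif := by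
  simp [edgesOff]

/-- The sum of `B` over the elements that share an edge. -/
def edgeSum (B : Fin N → ℝ) (e : MeshEdge N) : ℝ :=
  B e.1.1 + match e.2 with
    | some t => B t.1
    | none => 0

lemma edgeSum_nonneg {B : Fin N → ℝ} (hB : ∀ T, 0 ≤ B T) (e : MeshEdge N) : 0 ≤ edgeSum B e := by
  rcases e with ⟨s, _ | t⟩
  · simpa [edgeSum] using hB _
  · exact add_nonneg (hB _) (hB _)

lemma eq_of_side_eq {s t t' : LocalSide N} (h : t ≠ s) (h' : t' ≠ s) (e : M.side t = M.side s)
    (e' : M.side t' = M.side s) : t = t' :=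
  M.side_two s t t' h h' e e'

/-- The factor is three sides per element times two values of the flag. -/
lemma sum_local_le {B : Fin N → ℝ} (hB : ∀ T, 0 ≤ B T) {A : Finset (MeshEdge N)}
    (g : MeshEdge N → LocalSide N × Bool) (hg : Set.InjOn g A) :
    ∑ e ∈ A, B (g e).1.1 ≤ 6 * ∑ T, B T := by
  classical
  calc ∑ e ∈ A, B (g e).1.1 = ∑ p ∈ A.image g, B p.1.1 := 
        (Finset.sum_image (f := fun p : LocalSide N × Bool => B p.1.1) hg).symm
    _ ≤ ∑ p : LocalSide N × Bool, B p.1.1 :=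
        Finset.sum_le_sum_of_subset_of_nonneg (Finset.subset_univ _) fun _ _ _ => hB _
    _ = _ := by
        simp only [Fintype.sum_prod_type, Finset.sum_const, Finset.card_univ, Fintype.card_bool,
          Fintype.card_fin, Finset.mul_sum, nsmul_eq_mul]
        exact Finset.sum_congr rfl fun T _ => by norm_num; ring

/-- Every element belongs to a bounded number of edges. -/
lemma sum_edgeSum_le {B : Fin N → ℝ} (hB : ∀ T, 0 ≤ B T) :
    ∑ e ∈ M.edges P, edgeSum B e ≤ 12 * ∑ T, B T := by
  -- The flag separates boundary from inner edges. An inner edge is determined by either of its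
  -- sides, since a side belongs to at most two elements. The second sum counts the other side, with
  -- the side itself as a harmless default on boundary edges.
  have h1 := sum_local_le hB (A := M.edges P) (fun e => (e.1, e.2.isSome)) (by
    rintro ⟨s, _ | t⟩ he ⟨s', _ | t'⟩ he' h <;> simp at h
    · rw [h]
    · subst h
      have h1 := mem_edges_some.1 he
      have h2 := mem_edges_some.1 he'
      rw [eq_of_side_eq (fun h => h1.1.ne' (congrArg Prod.fst h))
        (fun h => h2.1.ne' (congrArg Prod.fst h)) h1.2.1.symm h2.2.1.symm])
  have h2 := sum_local_le hB (A := M.edges P) (fun e => (e.2.getD e.1, e.2.isSome)) (by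
    rintro ⟨s, _ | t⟩ he ⟨s', _ | t'⟩ he' h <;> simp at h
    · rw [h]
    · subst h
      have h1 := mem_edges_some.1 he
      have h2 := mem_edges_some.1 he'
      rw [eq_of_side_eq (fun h => h1.1.ne (congrArg Prod.fst h))
        (fun h => h2.1.ne (congrArg Prod.fst h)) h1.2.1 h2.2.1])
  have h3 : ∑ e ∈ M.edges P, edgeSum B e
      ≤ ∑ e ∈ M.edges P, (B e.1.1 + B (e.2.getD e.1).1) := by
    refine Finset.sum_le_sum fun e _ => ?_
    rcases e with ⟨s, _ | t⟩
    · simpa [edgeSum] using hB _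
    · simp [edgeSum]
  rw [Finset.sum_add_distrib] at h3
  simp only at h1 h2
  linarith

lemma mem_elem_of_mem_side {s t : LocalSide N} (h : (s, some t) ∈ M.edges P) {x : Plane}
    (hx : x ∈ M.side s) : x ∈ M.elem t.1 :=
  M.side_subset t ((mem_edges_some.1 h).2.1 ▸ hx)

lemma memLp_of_edge {s t : LocalSide N} (h : (s, some t) ∈ M.edges P) {q : Fin N → Plane → ℝ}
    (hq : ∀ T, ContinuousOn (q T) (M.elem T)) : MemLp (q t.1) ⊤ (M.sideMeasure s) :=
  M.memLp_of_continuousOn ((hq t.1).mono fun _ hx => mem_elem_of_mem_side h hx)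

lemma memLp_jump {e : MeshEdge N} (he : e ∈ M.edges P) {b : Plane → ℝ}
    (hb : e.1 ∈ M.dirichletSides P → MemLp b 2 (M.sideMeasure e.1)) {q : Fin N → Plane → ℝ}
    (hq : ∀ T, ContinuousOn (q T) (M.elem T)) : MemLp (jump b q e) 2 (M.sideMeasure e.1) := by
  rcases e with ⟨s, _ | t⟩
  · exact (hb (mem_edges_none.1 he)).sub
      ((M.memLp_of_continuousOn ((hq s.1).mono (M.side_subset s))).mono_exponent le_top)
  · exact ((M.memLp_of_continuousOn ((hq s.1).mono (M.side_subset s))).sub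
      (memLp_of_edge he hq)).mono_exponent le_top

lemma memLp_jump_zero {e : MeshEdge N} (he : e ∈ M.edges P) {q : Fin N → Plane → ℝ}
    (hq : ∀ T, ContinuousOn (q T) (M.elem T)) : MemLp (jump 0 q e) 2 (M.sideMeasure e.1) :=
  memLp_jump he (fun _ => MemLp.zero) hq

variable (M P) in
/-- The average on an edge of the normal component of an elementwise vector field. -/
def avgDn (q : Fin 2 → Fin N → Plane → ℝ) (e : MeshEdge N) (x : Plane) : ℝ :=
  avg (fun T y => ∑ j, M.edgeNormal P e y j * q j T y) e x

lemma memLp_edgeNormal (e : MeshEdge N) (j : Fin 2) :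
    MemLp (fun x => M.edgeNormal P e x j) ⊤ (M.sideMeasure e.1) := by
  rcases e with ⟨s, _ | t⟩
  · exact M.memLp_normal s j
  · exact (M.memLp_normal s j).const_mul _

lemma memLp_avgDn {e : MeshEdge N} (he : e ∈ M.edges P) {q : Fin 2 → Fin N → Plane → ℝ}
    (hq : ∀ j T, ContinuousOn (q j T) (M.elem T)) :
    MemLp (M.avgDn P q e) 2 (M.sideMeasure e.1) := by
  refine MemLp.mono_exponent (q := ⊤) ?_ le_top
  have h1 : MemLp (fun y => ∑ j, M.edgeNormal P e y j * q j e.1.1 y) ⊤ (M.sideMeasure e.1) :=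
    memLp_finsetSum _ fun j _ => MemLp.mul
      (M.memLp_of_continuousOn ((hq j e.1.1).mono (M.side_subset e.1))) (memLp_edgeNormal e j)
  rcases e with ⟨s, _ | t⟩
  · exact h1
  · have h2 : MemLp (fun y => ∑ j, M.edgeNormal P (s, some t) y j * q j t.1 y) ⊤
        (M.sideMeasure s) :=
      memLp_finsetSum _ fun j _ => MemLp.mul (memLp_of_edge he (hq j))
        (memLp_edgeNormal (s, some t) j)
    have h3 := (h1.add h2).const_mul (1 / 2)
    refine h3.congr_norm ?_ (Filter.Eventually.of_forall fun x => ?_)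
    · refine h3.1.congr (Filter.Eventually.of_forall fun x => ?_)
      simp [avgDn, avg]; ring
    · congr 1
      simp [avgDn, avg]; ring

lemma edgeNormal_sq_le (e : MeshEdge N) (x : Plane) : ∑ j, M.edgeNormal P e x j ^ 2 ≤ 1 := by
  have h : ∑ j, M.normal e.1 x j ^ 2 ≤ 1 := by
    have := M.norm_normal_le e.1 x
    rw [EuclideanSpace.norm_eq, Real.sqrt_le_left zero_le_one] at this
    simpa using this
  rcases e with ⟨s, _ | t⟩
  · exact h
  · simp only [edgeNormal, PiLp.smul_apply, smul_eq_mul, mul_pow]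
    rcases Int.units_eq_one_or (P.orient (s, some t)) with h' | h' <;> simpa [h'] using h

/-- Cauchy–Schwarz with a normal of length at most one bounds each one-sided normal component; the
square of the average is then at most the sum of the squares. -/
lemma avgDn_sq_le {e : MeshEdge N} (he : e ∈ M.edges P) {q : Fin 2 → Fin N → Plane → ℝ}
    {B : Fin N → ℝ} (hB : ∀ T, ∀ y ∈ M.elem T, ∑ j, q j T y ^ 2 ≤ B T) {x : Plane}
    (hx : x ∈ M.side e.1) : M.avgDn P q e x ^ 2 ≤ edgeSum B e := by
  have h : ∀ T, x ∈ M.elem T → (∑ j, M.edgeNormal P e x j * q j T x) ^ 2 ≤ B T := fun T hT => by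
    refine (Finset.sum_mul_sq_le_sq_mul_sq _ _ _).trans ?_
    have h1 := hB T x hT
    have h2 := M.edgeNormal_sq_le (P := P) e x
    exact (mul_le_of_le_one_left (Finset.sum_nonneg fun _ _ => sq_nonneg _) h2).trans h1
  rcases e with ⟨s, _ | t⟩
  · simpa [edgeSum, avgDn, avg] using h s.1 (M.side_subset s hx)
  · have h1 := h s.1 (M.side_subset s hx)
    have h2 := h t.1 (mem_elem_of_mem_side he hx)
    simp only [edgeSum, avgDn, avg]
    nlinarith [sq_nonneg ((∑ j, M.edgeNormal P (s, some t) x j * q j s.1 x)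
      - ∑ j, M.edgeNormal P (s, some t) x j * q j t.1 x),
      sq_nonneg ((∑ j, M.edgeNormal P (s, some t) x j * q j s.1 x)
      + ∑ j, M.edgeNormal P (s, some t) x j * q j t.1 x)]

end Edges

section Linear

variable {V : Type*} [AddCommGroup V] [Module ℝ V] {M} {P : DGParams N}

lemma isLinearMap_pd {T : Fin N} {F : V → Plane → ℝ}
    (hF : ∀ y ∈ M.elem T, IsLinearMap ℝ fun v => F v y)
    (hd : ∀ v, DifferentiableOn ℝ (F v) (M.elem T)) (j : Fin 2) {x : Plane} (hx : x ∈ M.elem T) :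
    IsLinearMap ℝ fun v => pd (M.elem T) j (F v) x := by
  refine isLinearMap_iff_comb.2 fun c u v => ?_
  have hU := M.uniqueDiffOn_elem T x hx
  have e : Set.EqOn (F (c • u + v)) (c • F u + F v) (M.elem T) := fun y hy =>
    isLinearMap_iff_comb.1 (hF y hy) c u v
  simp only [pd]
  rw [fderivWithin_congr e (e hx), fderivWithin_add hU ((hd u x hx).const_smul c) (hd v x hx),
    fderivWithin_const_smul hU (hd u x hx)]
  rfl

lemma isLinearMap_jump {e : MeshEdge N} (he : e ∈ M.edges P) {q : V → Fin N → Plane → ℝ}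
    (hq : ∀ T, ∀ y ∈ M.elem T, IsLinearMap ℝ fun v => q v T y) {x : Plane}
    (hx : x ∈ M.side e.1) : IsLinearMap ℝ fun v => jump 0 (q v) e x := by
  rcases e with ⟨s, _ | t⟩
  · simpa [jump] using (hq s.1 x (M.side_subset s hx)).const_mul' (-1)
  · exact (hq s.1 x (M.side_subset s hx)).sub' (hq t.1 x (mem_elem_of_mem_side he hx))

lemma isLinearMap_avgDn {e : MeshEdge N} (he : e ∈ M.edges P)
    {q : V → Fin 2 → Fin N → Plane → ℝ}
    (hq : ∀ j T, ∀ y ∈ M.elem T, IsLinearMap ℝ fun v => q v j T y) {x : Plane}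
    (hx : x ∈ M.side e.1) : IsLinearMap ℝ fun v => M.avgDn P (q v) e x := by
  have h : ∀ T, x ∈ M.elem T →
      IsLinearMap ℝ fun v => ∑ j, M.edgeNormal P e x j * q v j T x := fun T hT =>
    IsLinearMap.sum' fun j _ => (hq j T x hT).const_mul' _
  rcases e with ⟨s, _ | t⟩
  · exact h s.1 (M.side_subset s hx)
  · simpa [avgDn, avg, div_eq_mul_inv] using ((h s.1 (M.side_subset s hx)).add'
      (h t.1 (mem_elem_of_mem_side he hx))).mul_const' (1 / 2)

variable (M)

lemma isLinearMap_loc (T : Fin N) (x : Plane) : IsLinearMap ℝ fun v => M.loc v T x :=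
  isLinearMap_iff_comb.2 fun c u v => by simp [loc, MvPolynomial.smul_eval]

lemma isLinearMap_d1 (i : Fin 2) {T : Fin N} {x : Plane} (hx : x ∈ M.elem T) :
    IsLinearMap ℝ fun v => M.d1 v i T x :=
  isLinearMap_pd (fun y _ => M.isLinearMap_loc T y)
    (fun v => (M.isRational_loc v T).differentiableOn) i hx

lemma isLinearMap_d2 (i j : Fin 2) {T : Fin N} {x : Plane} (hx : x ∈ M.elem T) :
    IsLinearMap ℝ fun v => M.d2 v i j T x :=
  isLinearMap_pd (fun _ hy => M.isLinearMap_d1 i hy)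
    (fun v => (M.isRational_d1 v i T).differentiableOn) j hx

lemma isLinearMap_lap {T : Fin N} {x : Plane} (hx : x ∈ M.elem T) :
    IsLinearMap ℝ fun v => M.lap v T x :=
  IsLinearMap.sum' fun i _ => M.isLinearMap_d2 i i hx

lemma isLinearMap_pd_lap (j : Fin 2) {T : Fin N} {x : Plane} (hx : x ∈ M.elem T) :
    IsLinearMap ℝ fun v => pd (M.elem T) j (M.lap v T) x :=
  isLinearMap_pd (fun _ hy => M.isLinearMap_lap hy)
    (fun v => (M.isRational_lap v T).differentiableOn) j hx

end Linear

lemma continuousOn_loc (v : DGSpace k N) (T : Fin N) : ContinuousOn (M.loc v T) (M.elem T) :=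
  (M.isRational_loc v T).continuousOn

lemma continuousOn_d1 (v : DGSpace k N) (i : Fin 2) (T : Fin N) :
    ContinuousOn (M.d1 v i T) (M.elem T) :=
  (M.isRational_d1 v i T).continuousOn

lemma continuousOn_d2 (v : DGSpace k N) (i j : Fin 2) (T : Fin N) :
    ContinuousOn (M.d2 v i j T) (M.elem T) :=
  (M.isRational_d2 v i j T).continuousOn

lemma continuousOn_pd_lap (v : DGSpace k N) (j : Fin 2) (T : Fin N) :
    ContinuousOn (pd (M.elem T) j (M.lap v T)) (M.elem T) :=
  ((M.isRational_lap v T).pd j).continuousOn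

lemma avgDnGrad_eq (P : DGParams N) (v : DGSpace k N) (e : MeshEdge N) (i : Fin 2) :
    M.avgDnGrad P v e i = M.avgDn P (fun j => M.d2 v i j) e := rfl

variable {M} {P : DGParams N}

lemma memLp_avgDnGrad {e : MeshEdge N} (he : e ∈ M.edges P) (v : DGSpace k N) (i : Fin 2) :
    MemLp (M.avgDnGrad P v e i) 2 (M.sideMeasure e.1) :=
  memLp_avgDn he fun j T => M.continuousOn_d2 v i j T

lemma memLp_avgDnLap {e : MeshEdge N} (he : e ∈ M.edges P) (v : DGSpace k N) :
    MemLp (M.avgDnLap P v e) 2 (M.sideMeasure e.1) :=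
  memLp_avgDn he fun j T => M.continuousOn_pd_lap v j T

lemma isLinearMap_avgDnGrad {e : MeshEdge N} (he : e ∈ M.edges P) (i : Fin 2) {x : Plane}
    (hx : x ∈ M.side e.1) : IsLinearMap ℝ fun v => M.avgDnGrad P v e i x :=
  isLinearMap_avgDn he (fun j _ _ hy => M.isLinearMap_d2 i j hy) hx

lemma isLinearMap_avgDnLap {e : MeshEdge N} (he : e ∈ M.edges P) {x : Plane}
    (hx : x ∈ M.side e.1) : IsLinearMap ℝ fun v => M.avgDnLap P v e x :=
  isLinearMap_avgDn he (fun j _ _ hy => M.isLinearMap_pd_lap j hy) hx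

variable (M) in
/-- The discrete equation is linear in the test function. -/
lemma isLinearMap_formWithData {g : Plane → ℝ} {Φ : Plane → Plane}
    (hg : ∀ s ∈ M.dirichletSides P, MemLp g 2 (M.sideMeasure s))
    (hΦ : ∀ s ∈ M.dirichletSides P, ∀ i, MemLp (fun x => Φ x i) 2 (M.sideMeasure s))
    (u : DGSpace k N) : IsLinearMap ℝ fun v => M.formWithData P g Φ u v := by
  have hoff : ∀ e ∈ M.edgesOff P, e ∈ M.edges P := fun e he => (mem_edgesOff.1 he).1
  have jg : ∀ e ∈ M.edges P, MemLp (jump g (M.loc u) e) 2 (M.sideMeasure e.1) := fun e he =>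
    memLp_jump he (hg e.1) (M.continuousOn_loc u)
  have jΦ : ∀ e ∈ M.edges P, ∀ i,
      MemLp (jump (fun y => Φ y i) (M.d1 u i) e) 2 (M.sideMeasure e.1) := fun e he i =>
    memLp_jump he (fun h => hΦ e.1 h i) (M.continuousOn_d1 u i)
  have j1 : ∀ e ∈ M.edges P, ∀ v i, MemLp (jump 0 (M.d1 v i) e) 2 (M.sideMeasure e.1) :=
    fun e he v i => memLp_jump_zero he (M.continuousOn_d1 v i)
  have j0 : ∀ e ∈ M.edges P, ∀ v, MemLp (jump 0 (M.loc v) e) 2 (M.sideMeasure e.1) :=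
    fun e he v => memLp_jump_zero he (M.continuousOn_loc v)
  have l1 : ∀ e ∈ M.edges P, ∀ x ∈ M.side e.1, ∀ i,
      IsLinearMap ℝ fun v => jump 0 (M.d1 v i) e x := fun e he x hx i =>
    isLinearMap_jump he (fun _ _ hy => M.isLinearMap_d1 i hy) hx
  have l0 : ∀ e ∈ M.edges P, ∀ x ∈ M.side e.1,
      IsLinearMap ℝ fun v => jump 0 (M.loc v) e x := fun e he x hx =>
    isLinearMap_jump he (fun T y _ => M.isLinearMap_loc T y) hx
  have hae := fun e : MeshEdge N => M.ae_mem_side e.1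
  unfold formWithData
  refine ((((((?_ : IsLinearMap ℝ _).add' ?_).add' ?_).sub' ?_).sub' ?_).add'
    (IsLinearMap.const_mul' ?_ _)).add' (IsLinearMap.const_mul' ?_ _)
  · refine IsLinearMap.sum' fun T _ => isLinearMap_integral (fun v => ?_) ?_
    · refine ContinuousOn.integrableOn_compact (M.isCompact_elem T) ?_
      exact continuousOn_finsetSum _ fun i _ => continuousOn_finsetSum _ fun j _ =>
        (M.continuousOn_d2 u i j T).mul (M.continuousOn_d2 v i j T)
    · filter_upwards [ae_restrict_mem (M.isCompact_elem T).measurableSet] with x hx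
      exact IsLinearMap.sum' fun i _ => IsLinearMap.sum' fun j _ =>
        (M.isLinearMap_d2 i j hx).const_mul' _
  · refine IsLinearMap.sum' fun e he => isLinearMap_integral (fun v => ?_) ?_
    · exact integrable_sum_mul_of_memLp (memLp_avgDnGrad (hoff e he) u) (j1 e (hoff e he) v)
    · filter_upwards [hae e] with x hx
      exact IsLinearMap.sum' fun i _ => (l1 e (hoff e he) x hx i).const_mul' _
  · refine IsLinearMap.sum' fun e he => isLinearMap_integral (fun v => ?_) ?_
    · exact integrable_sum_mul_of_memLp (memLp_avgDnGrad (hoff e he) v) (jΦ e (hoff e he))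
    · filter_upwards [hae e] with x hx
      exact IsLinearMap.sum' fun i _ => (isLinearMap_avgDnGrad (hoff e he) i hx).mul_const' _
  · refine IsLinearMap.sum' fun e he => isLinearMap_integral (fun v => ?_) ?_
    · exact integrable_mul_of_memLp (memLp_avgDnLap he u) (j0 e he v)
    · filter_upwards [hae e] with x hx
      exact (l0 e he x hx).const_mul' _
  · refine IsLinearMap.sum' fun e he => isLinearMap_integral (fun v => ?_) ?_
    · exact integrable_mul_of_memLp (memLp_avgDnLap he v) (jg e he)
    · filter_upwards [hae e] with x hx
      exact (isLinearMap_avgDnLap he hx).mul_const' _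
  · refine IsLinearMap.sum' fun e he => isLinearMap_integral (fun v => ?_) ?_
    · exact (integrable_sum_mul_of_memLp (jΦ e (hoff e he)) (j1 e (hoff e he) v)).const_mul _
    · filter_upwards [hae e] with x hx
      exact (IsLinearMap.sum' fun i _ => (l1 e (hoff e he) x hx i).const_mul' _).const_mul' _
  · refine IsLinearMap.sum' fun e he => isLinearMap_integral (fun v => ?_) ?_
    · exact (integrable_mul_of_memLp (jg e he) (j0 e he v)).const_mul _
    · filter_upwards [hae e] with x hx
      exact ((l0 e he x hx).const_mul' _).const_mul' _

variable (M)

lemma isLinearMap_form_right (u : DGSpace k N) : IsLinearMap ℝ fun v => M.form P u v :=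
  M.isLinearMap_formWithData (fun _ _ => MemLp.zero) (fun _ _ _ => MemLp.zero) u

/-- For homogeneous data, exchanging the arguments swaps the two consistency terms within each pair.
-/
lemma form_comm (u v : DGSpace k N) : M.form P u v = M.form P v u := by
  simp only [form, formWithData, Pi.zero_apply, PiLp.zero_apply, mul_comm (M.d2 u _ _ _ _),
    mul_comm (jump _ (M.loc u) _ _), mul_comm (jump _ (M.d1 u _) _ _)]
  have e : (fun _ => 0 : Plane → ℝ) = 0 := rfl
  simp only [e]
  ring

end IsoMesh

/-! ### Trace inequalities, coercivity and boundedness. -/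

/-- Weighted Young inequality. The weight will be a small constant times `h_S` for the gradient
terms and times `h_S³` for the value terms, matching the penalties. -/
lemma abs_two_mul_integral_le {ι : Type*} [Fintype ι] {μ : Measure Plane} {a b : ι → Plane → ℝ}
    (ha : ∀ i, MemLp (a i) 2 μ) (hb : ∀ i, MemLp (b i) 2 μ) {τ : ℝ} (hτ : 0 < τ) :
    |2 * ∫ x, ∑ i, a i x * b i x ∂μ|
      ≤ τ * ∫ x, ∑ i, a i x ^ 2 ∂μ + τ⁻¹ * ∫ x, ∑ i, b i x ^ 2 ∂μ := by
  have h1 : Integrable (fun x => ∑ i, a i x ^ 2) μ :=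
    integrable_finsetSum _ fun i _ => (ha i).integrable_sq
  have h2 : Integrable (fun x => ∑ i, b i x ^ 2) μ :=
    integrable_finsetSum _ fun i _ => (hb i).integrable_sq
  rw [← integral_const_mul, ← integral_const_mul, ← integral_const_mul,
    ← integral_add (h1.const_mul _) (h2.const_mul _)]
  refine abs_integral_le_integral_abs.trans (integral_mono_of_nonneg
    (Filter.Eventually.of_forall fun x => abs_nonneg _) ((h1.const_mul _).add (h2.const_mul _))
    (Filter.Eventually.of_forall fun x => ?_))
  simp only [Finset.mul_sum, ← Finset.sum_add_distrib]
  refine (Finset.abs_sum_le_sum_abs _ _).trans (Finset.sum_le_sum fun i _ => ?_)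
  have e : ∀ p q : ℝ, |2 * (p * q)| ≤ τ * p ^ 2 + τ⁻¹ * q ^ 2 := by
    intro p q
    have h3 : 0 ≤ τ⁻¹ * (τ * p - q) ^ 2 := by positivity
    have h4 : 0 ≤ τ⁻¹ * (τ * p + q) ^ 2 := by positivity
    have e3 : τ⁻¹ * (τ * p - q) ^ 2 = τ * p ^ 2 + τ⁻¹ * q ^ 2 - 2 * (p * q) := by
      field_simp; ring
    have e4 : τ⁻¹ * (τ * p + q) ^ 2 = τ * p ^ 2 + τ⁻¹ * q ^ 2 + 2 * (p * q) := by
      field_simp; ring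
    rw [abs_le]
    constructor <;> linarith
  exact e _ _

namespace IsoMesh

variable {k N : ℕ} {Ω : Set Plane} (M : IsoMesh k N Ω)

/-- The squared `L²` norm of the Hessian on an element. -/
def energy (v : DGSpace k N) (T : Fin N) : ℝ :=
  ∫ x in M.elem T, ∑ i, ∑ j, M.d2 v i j T x ^ 2

lemma energy_nonneg (v : DGSpace k N) (T : Fin N) : 0 ≤ M.energy v T :=
  integral_nonneg fun _ => Finset.sum_nonneg fun _ _ => Finset.sum_nonneg fun _ _ => sq_nonneg _

lemma integrableOn_energy (v : DGSpace k N) (T : Fin N) :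
    IntegrableOn (fun x => ∑ i, ∑ j, M.d2 v i j T x ^ 2) (M.elem T) :=
  ContinuousOn.integrableOn_compact (M.isCompact_elem T) <|
    continuousOn_finsetSum _ fun i _ => continuousOn_finsetSum _ fun j _ =>
      (M.continuousOn_d2 v i j T).pow 2

lemma integral_d2_sq_le (v : DGSpace k N) (T : Fin N) (i j : Fin 2) :
    ∫ x in M.elem T, M.d2 v i j T x ^ 2 ≤ M.energy v T := by
  refine integral_mono_of_nonneg (Filter.Eventually.of_forall fun x => sq_nonneg _)
    (M.integrableOn_energy v T) (Filter.Eventually.of_forall fun x => ?_)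
  refine (Finset.single_le_sum (f := fun j => M.d2 v i j T x ^ 2) (fun _ _ => sq_nonneg _)
    (Finset.mem_univ j)).trans ?_
  exact Finset.single_le_sum (f := fun i => ∑ j, M.d2 v i j T x ^ 2)
    (fun _ _ => Finset.sum_nonneg fun _ _ => sq_nonneg _) (Finset.mem_univ i)

lemma integral_lap_sq_le (v : DGSpace k N) (T : Fin N) :
    ∫ x in M.elem T, M.lap v T x ^ 2 ≤ 2 * M.energy v T := by
  rw [energy, ← integral_const_mul]
  refine integral_mono_of_nonneg (Filter.Eventually.of_forall fun x => sq_nonneg _)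
    ((M.integrableOn_energy v T).const_mul 2) (Filter.Eventually.of_forall fun x => ?_)
  simp only [lap, Fin.sum_univ_two]
  nlinarith [sq_nonneg (M.d2 v 0 0 T x - M.d2 v 1 1 T x), sq_nonneg (M.d2 v 0 1 T x),
    sq_nonneg (M.d2 v 1 0 T x)]

variable {M} {P : DGParams N}

lemma MeshSize.pos {σ : ℝ} (hσ : 0 < σ) (h : M.MeshSize σ P.h) (s : LocalSide N) :
    0 < P.h (M.side s) :=
  pos_of_mul_pos_right ((M.diam_side_pos s).trans_le (h s).1) hσ.le

/-- A side has no larger diameter than an element containing it, so the powers of the diameters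
cancel. No reverse comparison of side and element is needed. -/
lemma diam_pow_mul_edgeSum_le {e : MeshEdge N} (he : e ∈ M.edges P) {X : Fin N → ℝ}
    (hX : ∀ T, 0 ≤ X T) (p : ℕ) {K : ℝ} (hK : 0 ≤ K) :
    Metric.diam (M.side e.1) ^ p * edgeSum (fun T => K / Metric.diam (M.elem T) ^ p * X T) e
      ≤ K * edgeSum X e := by
  have h : ∀ T, Metric.diam (M.side e.1) ≤ Metric.diam (M.elem T) →
      Metric.diam (M.side e.1) ^ p * (K / Metric.diam (M.elem T) ^ p * X T) ≤ K * X T := by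
    intro T hT
    have hp : 0 < Metric.diam (M.elem T) ^ p := pow_pos (M.diam_elem_pos T) p
    have hD := pow_le_pow_left₀ (M.diam_side_pos e.1).le hT p
    calc _ = K * X T * (Metric.diam (M.side e.1) ^ p / Metric.diam (M.elem T) ^ p) := by ring
      _ ≤ K * X T * 1 := by
        refine mul_le_mul_of_nonneg_left ?_ (mul_nonneg hK (hX T))
        rwa [div_le_one hp]
      _ = _ := mul_one _
  rcases e with ⟨s, _ | t⟩
  · simpa [edgeSum] using h s.1 (M.diam_side_le s)
  · simp only [edgeSum, mul_add]
    refine add_le_add (h s.1 (M.diam_side_le s)) (h t.1 ?_)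
    rw [(mem_edges_some.1 he).2.1]
    exact M.diam_side_le t

/-- Discrete trace inequalities for the averages. -/
lemma exists_trace_bound (k : ℕ) {σ : ℝ} (hσ : 0 < σ) : ∃ C > 0,
    ∀ (N : ℕ) (Ω : Set Plane) (M : IsoMesh k N Ω) (P : DGParams N), M.ShapeRegular σ →
      M.MeshSize σ P.h → ∀ (v : DGSpace k N), ∀ e ∈ M.edges P,
        P.h (M.side e.1) * ∫ x, ∑ i, M.avgDnGrad P v e i x ^ 2 ∂M.sideMeasure e.1
          ≤ C * edgeSum (M.energy v) e ∧
        P.h (M.side e.1) ^ 3 * ∫ x, M.avgDnLap P v e x ^ 2 ∂M.sideMeasure e.1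
          ≤ C * edgeSum (M.energy v) e := by
  obtain ⟨C₀, hC₀, h₀⟩ := exists_rational_bound k 4 (7 * k) hσ
  obtain ⟨C₁, hC₁, h₁⟩ := exists_sideMeasure_le k
  refine ⟨σ * C₁ * (4 * C₀) + σ ^ 3 * C₁ * (4 * C₀), by positivity,
    fun N Ω M P hM hS v e he => ?_⟩
  have hX := M.energy_nonneg v
  have hE := edgeSum_nonneg hX e
  have hh := hS.pos hσ e.1
  have hD := M.diam_side_pos e.1
  have hint : ∀ (f : Plane → ℝ) (A : ℝ), 0 ≤ A → (∀ x ∈ M.side e.1, |f x| ≤ A) →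
      ∫ x, f x ∂M.sideMeasure e.1 ≤ A * (C₁ * Metric.diam (M.side e.1)) := by
    intro f A hA hf
    refine (Real.le_norm_self _).trans ((norm_integral_le_of_norm_le_const (f := f)
      ((M.ae_mem_side e.1).mono hf)).trans (mul_le_mul_of_nonneg_left ?_ hA))
    exact ENNReal.toReal_le_of_le_ofReal (by positivity) (h₁ N Ω M e.1)
  constructor
  · have hB : ∀ i, ∀ T, ∀ y ∈ M.elem T, ∑ j, M.d2 v i j T y ^ 2
        ≤ 2 * C₀ / Metric.diam (M.elem T) ^ 2 * M.energy v T := by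
      intro i T y hy
      have hH := M.diam_elem_pos T
      have h2 : ∀ j, M.d2 v i j T y ^ 2 ≤ C₀ / Metric.diam (M.elem T) ^ 2 * M.energy v T :=
        fun j => ((h₀ N Ω M hM T _ (M.isRational_d2 v i j T) y hy).1).trans
          (mul_le_mul_of_nonneg_left (M.integral_d2_sq_le v T i j) (by positivity))
      rw [Fin.sum_univ_two]
      refine (add_le_add (h2 0) (h2 1)).trans (le_of_eq (by ring))
    set A := edgeSum (fun T => 2 * C₀ / Metric.diam (M.elem T) ^ 2 * M.energy v T) e with hA
    have hA0 : 0 ≤ A := edgeSum_nonneg (fun T => by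
      have := M.diam_elem_pos T; have := hX T; positivity) e
    have h3 := hint (fun x => ∑ i, M.avgDnGrad P v e i x ^ 2) (2 * A) (by positivity)
      (fun x hx => by
        rw [abs_of_nonneg (Finset.sum_nonneg fun _ _ => sq_nonneg _), Fin.sum_univ_two]
        have h4 := fun i => avgDn_sq_le he (hB i) hx
        have h5 := h4 0
        have h6 := h4 1
        rw [← avgDnGrad_eq] at h5 h6
        linarith)
    have h7 := diam_pow_mul_edgeSum_le he hX 2 (by positivity : 0 ≤ 2 * C₀)
    rw [← hA] at h7
    -- One power of the side's diameter comes from `h_S` and one from the length; together they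
    -- balance `h_T⁻²` in `A`.
    calc _ ≤ (σ * Metric.diam (M.side e.1)) * (2 * A * (C₁ * Metric.diam (M.side e.1))) :=
          mul_le_mul (hS e.1).2 h3 (integral_nonneg fun _ => Finset.sum_nonneg fun _ _ =>
            sq_nonneg _) (by positivity)
      _ = 2 * σ * C₁ * (Metric.diam (M.side e.1) ^ 2 * A) := by ring
      _ ≤ 2 * σ * C₁ * (2 * C₀ * edgeSum (M.energy v) e) :=
          mul_le_mul_of_nonneg_left h7 (by positivity)
      _ = σ * C₁ * (4 * C₀) * edgeSum (M.energy v) e := by ring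
      _ ≤ _ := by
          refine mul_le_mul_of_nonneg_right ?_ hE
          have : 0 < σ ^ 3 * C₁ * (4 * C₀) := by positivity
          linarith
  · have hB : ∀ T, ∀ y ∈ M.elem T, ∑ j, pd (M.elem T) j (M.lap v T) y ^ 2
        ≤ 4 * C₀ / Metric.diam (M.elem T) ^ 4 * M.energy v T := by
      intro T y hy
      have hH := M.diam_elem_pos T
      have h2 : ∀ j, pd (M.elem T) j (M.lap v T) y ^ 2
          ≤ C₀ / Metric.diam (M.elem T) ^ 4 * (2 * M.energy v T) :=
        fun j => ((h₀ N Ω M hM T _ (M.isRational_lap v T) y hy).2 j).trans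
          (mul_le_mul_of_nonneg_left (M.integral_lap_sq_le v T) (by positivity))
      rw [Fin.sum_univ_two]
      refine (add_le_add (h2 0) (h2 1)).trans (le_of_eq (by ring))
    set A := edgeSum (fun T => 4 * C₀ / Metric.diam (M.elem T) ^ 4 * M.energy v T) e with hA
    have hA0 : 0 ≤ A := edgeSum_nonneg (fun T => by
      have := M.diam_elem_pos T; have := hX T; positivity) e
    have h3 := hint (fun x => M.avgDnLap P v e x ^ 2) A hA0 (fun x hx => by
      rw [abs_of_nonneg (sq_nonneg _)]
      exact avgDn_sq_le he hB hx)
    have h7 := diam_pow_mul_edgeSum_le he hX 4 (by positivity : 0 ≤ 4 * C₀)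
    rw [← hA] at h7
    calc _ ≤ (σ * Metric.diam (M.side e.1)) ^ 3 * (A * (C₁ * Metric.diam (M.side e.1))) :=
          mul_le_mul (pow_le_pow_left₀ hh.le (hS e.1).2 3) h3 (integral_nonneg fun _ =>
            sq_nonneg _) (by positivity)
      _ = σ ^ 3 * C₁ * (Metric.diam (M.side e.1) ^ 4 * A) := by ring
      _ ≤ σ ^ 3 * C₁ * (4 * C₀ * edgeSum (M.energy v) e) :=
          mul_le_mul_of_nonneg_left h7 (by positivity)
      _ = σ ^ 3 * C₁ * (4 * C₀) * edgeSum (M.energy v) e := by ring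
      _ ≤ _ := by
          refine mul_le_mul_of_nonneg_right ?_ hE
          have : 0 < σ * C₁ * (4 * C₀) := by positivity
          linarith

variable (M P)

/-- The scaled squared jumps of the gradient. -/
def gradJumps (v : DGSpace k N) : ℝ :=
  ∑ e ∈ M.edgesOff P, (P.h (M.side e.1))⁻¹ *
    ∫ x, ∑ i, jump 0 (M.d1 v i) e x ^ 2 ∂M.sideMeasure e.1

/-- The scaled squared jumps. -/
def valueJumps (v : DGSpace k N) : ℝ :=
  ∑ e ∈ M.edges P, (P.h (M.side e.1) ^ 3)⁻¹ * ∫ x, jump 0 (M.loc v) e x ^ 2 ∂M.sideMeasure e.1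

/-- The consistency term for the gradient. -/
def gradCons (v : DGSpace k N) : ℝ :=
  ∑ e ∈ M.edgesOff P, ∫ x, ∑ i, M.avgDnGrad P v e i x * jump 0 (M.d1 v i) e x ∂M.sideMeasure e.1

/-- The consistency term for the values. -/
def valueCons (v : DGSpace k N) : ℝ :=
  ∑ e ∈ M.edges P, ∫ x, M.avgDnLap P v e x * jump 0 (M.loc v) e x ∂M.sideMeasure e.1

lemma form_self (v : DGSpace k N) : M.form P v v = ∑ T, M.energy v T + 2 * M.gradCons P v
    - 2 * M.valueCons P v + P.γ₁ * M.gradJumps P v + P.γ₀ * M.valueJumps P v := by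
  have e : (fun _ => 0 : Plane → ℝ) = 0 := rfl
  simp only [form, formWithData, energy, gradCons, valueCons, gradJumps, valueJumps,
    Pi.zero_apply, PiLp.zero_apply, e, integral_const_mul, sq]
  ring

variable {M P}

lemma gradJumps_nonneg (hh : ∀ s, 0 < P.h (M.side s)) (v : DGSpace k N) :
    0 ≤ M.gradJumps P v :=
  Finset.sum_nonneg fun e _ => mul_nonneg (inv_nonneg.2 (hh e.1).le)
    (integral_nonneg fun _ => Finset.sum_nonneg fun _ _ => sq_nonneg _)

lemma valueJumps_nonneg (hh : ∀ s, 0 < P.h (M.side s)) (v : DGSpace k N) :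
    0 ≤ M.valueJumps P v :=
  Finset.sum_nonneg fun e _ => mul_nonneg (inv_nonneg.2 (pow_pos (hh e.1) 3).le)
    (integral_nonneg fun _ => sq_nonneg _)

lemma dgNorm_sq (hh : ∀ s, 0 < P.h (M.side s)) (h₀ : 0 ≤ P.γ₀) (h₁ : 0 ≤ P.γ₁)
    (v : DGSpace k N) : M.dgNorm P v ^ 2
      = ∑ T, M.energy v T + P.γ₁ * M.gradJumps P v + P.γ₀ * M.valueJumps P v := by
  have e : (∑ T, M.energy v T + P.γ₁ * M.gradJumps P v + P.γ₀ * M.valueJumps P v)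
      = (∑ T, ∫ x in M.elem T, ∑ i, ∑ j, M.d2 v i j T x ^ 2)
    + (∑ e ∈ M.edgesOff P, P.γ₁ / P.h (M.side e.1) *
        ∫ x, ∑ i, jump 0 (M.d1 v i) e x ^ 2 ∂M.sideMeasure e.1)
    + (∑ e ∈ M.edges P, P.γ₀ / P.h (M.side e.1) ^ 3 *
        ∫ x, jump 0 (M.loc v) e x ^ 2 ∂M.sideMeasure e.1) := by
    simp only [energy, gradJumps, valueJumps, Finset.mul_sum, div_eq_mul_inv, mul_assoc]
  rw [dgNorm, ← e, Real.sq_sqrt]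
  have := Finset.sum_nonneg fun T (_ : T ∈ Finset.univ) => M.energy_nonneg v T
  have := gradJumps_nonneg hh v
  have := valueJumps_nonneg hh v
  positivity

/-- The consistency terms are dominated by the energy and the jumps. -/
lemma exists_cons_bound (k : ℕ) {σ : ℝ} (hσ : 0 < σ) : ∃ C > 0,
    ∀ (N : ℕ) (Ω : Set Plane) (M : IsoMesh k N Ω) (P : DGParams N), M.ShapeRegular σ →
      M.MeshSize σ P.h → ∀ (v : DGSpace k N),
        |2 * M.gradCons P v| ≤ 1 / 4 * ∑ T, M.energy v T + C * M.gradJumps P v ∧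
        |2 * M.valueCons P v| ≤ 1 / 4 * ∑ T, M.energy v T + C * M.valueJumps P v := by
  obtain ⟨C, hC, h⟩ := exists_trace_bound k hσ
  refine ⟨48 * C, by positivity, fun N Ω M P hM hS v => ?_⟩
  have hh := hS.pos hσ
  have hE := M.energy_nonneg v
  have hsum := sum_edgeSum_le (M := M) (P := P) hE
  -- Chosen so that `τ * C * 12 = 1 / 4`, where 12 bounds the overlap in the sum over edges. Its
  -- inverse becomes the constant in front of the jumps.
  set τ := 1 / (48 * C) with hτ
  have hτ0 : 0 < τ := by positivity
  have hτi : τ⁻¹ = 48 * C := by rw [hτ]; simp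
  have hτC : τ * C * (12 * ∑ T, M.energy v T) = 1 / 4 * ∑ T, M.energy v T := by
    rw [hτ]; field_simp; ring
  have hoff : ∀ e ∈ M.edgesOff P, e ∈ M.edges P := fun e he => (mem_edgesOff.1 he).1
  constructor
  · have h1 : ∀ e ∈ M.edgesOff P,
        |2 * ∫ x, ∑ i, M.avgDnGrad P v e i x * jump 0 (M.d1 v i) e x ∂M.sideMeasure e.1|
        ≤ τ * C * edgeSum (M.energy v) e + 48 * C * ((P.h (M.side e.1))⁻¹ *
          ∫ x, ∑ i, jump 0 (M.d1 v i) e x ^ 2 ∂M.sideMeasure e.1) := by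
      intro e he
      have h2 := abs_two_mul_integral_le (memLp_avgDnGrad (hoff e he) v)
        (fun i => memLp_jump_zero (hoff e he) (M.continuousOn_d1 v i))
        (mul_pos hτ0 (hh e.1))
      refine h2.trans (add_le_add ?_ (le_of_eq ?_))
      · rw [mul_assoc, mul_assoc]
        exact mul_le_mul_of_nonneg_left (h N Ω M P hM hS v e (hoff e he)).1 hτ0.le
      · rw [mul_inv, hτi, mul_assoc]
    rw [gradCons, Finset.mul_sum]
    refine (Finset.abs_sum_le_sum_abs _ _).trans ((Finset.sum_le_sum h1).trans ?_)
    rw [Finset.sum_add_distrib, ← Finset.mul_sum, ← Finset.mul_sum, ← hτC]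
    refine add_le_add (mul_le_mul_of_nonneg_left (le_trans ?_ hsum) (by positivity)) le_rfl
    exact Finset.sum_le_sum_of_subset_of_nonneg hoff fun e _ _ => edgeSum_nonneg hE e
  · have h1 : ∀ e ∈ M.edges P,
        |2 * ∫ x, M.avgDnLap P v e x * jump 0 (M.loc v) e x ∂M.sideMeasure e.1|
        ≤ τ * C * edgeSum (M.energy v) e + 48 * C * ((P.h (M.side e.1) ^ 3)⁻¹ *
          ∫ x, jump 0 (M.loc v) e x ^ 2 ∂M.sideMeasure e.1) := by
      intro e he
      have h2 := abs_two_mul_integral_le (ι := Unit) (fun _ => memLp_avgDnLap he v)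
        (fun i => memLp_jump_zero he (M.continuousOn_loc v))
        (mul_pos hτ0 (pow_pos (hh e.1) 3))
      simp only [Finset.univ_unique, Finset.sum_singleton] at h2
      refine h2.trans (add_le_add ?_ (le_of_eq ?_))
      · rw [mul_assoc, mul_assoc]
        exact mul_le_mul_of_nonneg_left (h N Ω M P hM hS v e he).2 hτ0.le
      · rw [mul_inv, hτi, mul_assoc]
    rw [valueCons, Finset.mul_sum]
    refine (Finset.abs_sum_le_sum_abs _ _).trans ((Finset.sum_le_sum h1).trans ?_)
    rw [Finset.sum_add_distrib, ← Finset.mul_sum, ← Finset.mul_sum, ← hτC]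
    exact add_le_add (mul_le_mul_of_nonneg_left hsum (by positivity)) le_rfl

/-- Coercivity and boundedness of the form on the diagonal. -/
lemma exists_form_self_bounds (k : ℕ) {σ : ℝ} (hσ : 0 < σ) : ∃ γmin > 0,
    ∀ (N : ℕ) (Ω : Set Plane) (M : IsoMesh k N Ω) (P : DGParams N), M.ShapeRegular σ →
      M.MeshSize σ P.h → γmin ≤ P.γ₀ → γmin ≤ P.γ₁ → ∀ v : DGSpace k N,
        1 / 2 * M.dgNorm P v ^ 2 ≤ M.form P v v ∧ M.form P v v ≤ 2 * M.dgNorm P v ^ 2 := by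
  obtain ⟨C, hC, h⟩ := exists_cons_bound k hσ
  -- The two consistency terms take away at most `1/4 + 1/4` of the energy, and `γ ≥ 2C` leaves at
  -- least half of each penalty. The same estimates with the opposite sign give the factor `3/2`,
  -- hence 2, above.
  refine ⟨2 * C, by positivity, fun N Ω M P hM hS h0 h1 v => ?_⟩
  have hh := hS.pos hσ
  have hE := Finset.sum_nonneg fun T (_ : T ∈ Finset.univ) => M.energy_nonneg v T
  have h2 := abs_le.1 (h N Ω M P hM hS v).1
  have h3 := abs_le.1 (h N Ω M P hM hS v).2
  have h4 := mul_le_mul_of_nonneg_right h1 (gradJumps_nonneg hh v)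
  have h5 := mul_le_mul_of_nonneg_right h0 (valueJumps_nonneg hh v)
  have h6 := mul_nonneg hC.le (gradJumps_nonneg hh v)
  have h7 := mul_nonneg hC.le (valueJumps_nonneg hh v)
  rw [dgNorm_sq hh (by linarith) (by linarith), form_self]
  constructor <;> linarith [h2.1, h2.2, h3.1, h3.2]

variable (M P)

/-- The form as a bilinear map. -/
def formBilin : DGSpace k N →ₗ[ℝ] DGSpace k N →ₗ[ℝ] ℝ :=
  LinearMap.mk₂ ℝ (fun u v => M.form P u v)
    (fun u u' v => by
      simp only [M.form_comm _ v]; exact (M.isLinearMap_form_right v).map_add u u')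
    (fun c u v => by
      simp only [M.form_comm _ v]; exact (M.isLinearMap_form_right v).map_smul c u)
    (fun u v v' => (M.isLinearMap_form_right u).map_add v v')
    (fun c u v => (M.isLinearMap_form_right u).map_smul c v)

lemma formBilin_apply (u v : DGSpace k N) : M.formBilin P u v = M.form P u v := rfl

variable {M P}

lemma abs_form_le (h : ∀ v : DGSpace k N, 0 ≤ M.form P v v ∧ M.form P v v ≤ 2 * M.dgNorm P v ^ 2)
    (v w : DGSpace k N) : |M.form P v w| ≤ 2 * M.dgNorm P v * M.dgNorm P w := by
  have hv : 0 ≤ M.dgNorm P v := Real.sqrt_nonneg _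
  have hw : 0 ≤ M.dgNorm P w := Real.sqrt_nonneg _
  -- Cauchy–Schwarz by the discriminant of `t ↦ a_h(t v + w, t v + w)`; the individual terms of the
  -- form need no separate estimate.
  have hq : ∀ t : ℝ, 0 ≤ M.form P v v * (t * t) + 2 * M.form P v w * t + M.form P w w := by
    intro t
    have h1 := (h (t • v + w)).1
    rw [← formBilin_apply] at h1
    simp only [map_add, map_smul, LinearMap.add_apply, LinearMap.smul_apply, smul_eq_mul,
      formBilin_apply, M.form_comm w v] at h1
    linarith
  have hd := discrim_le_zero hq
  rw [discrim] at hd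
  have h1 : M.form P v w ^ 2 ≤ M.form P v v * M.form P w w := by linarith
  refine abs_le_of_sq_le_sq (h1.trans ?_) (by positivity)
  calc _ ≤ (2 * M.dgNorm P v ^ 2) * (2 * M.dgNorm P w ^ 2) :=
        mul_le_mul (h v).2 (h w).2 (h w).1 (by positivity)
    _ = _ := by ring

end IsoMesh

/-! ### Connectedness of planar open sets after removal of a countable set. -/

/-- The ball is homeomorphic to the plane, where complements of countable sets are connected because
the dimension exceeds one. -/
lemma isPreconnected_ball_diff_countable {F : Set Plane} (hF : F.Countable) (x : Plane) {r : ℝ}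
    (hr : 0 < r) : IsPreconnected (Metric.ball x r \ F) := by
  let φ := OpenPartialHomeomorph.univBall x r
  have hs : φ.source = Set.univ := OpenPartialHomeomorph.univBall_source x r
  have ht : φ.target = Metric.ball x r := OpenPartialHomeomorph.univBall_target x hr
  have hinj : Set.InjOn φ Set.univ := hs ▸ φ.injOn
  have hc : (φ ⁻¹' F).Countable := hF.preimage_of_injOn (hinj.mono (Set.subset_univ _))
  have h1 : IsConnected (φ ⁻¹' F)ᶜ := hc.isConnected_compl_of_one_lt_rank
    (Module.one_lt_rank_of_one_lt_finrank (by simp))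
  have h2 : Metric.ball x r \ F = φ '' (φ ⁻¹' F)ᶜ := by
    rw [← Set.preimage_compl, Set.image_preimage_eq_inter_range, ← Set.image_univ, ← hs,
      φ.image_source_eq_target, ht, Set.inter_comm, Set.sdiff_eq]
  rw [h2]
  exact h1.isPreconnected.image φ ((hs ▸ φ.continuousOn).mono (Set.subset_univ _))

lemma IsPreconnected.diff_countable {U F : Set Plane} (hU : IsOpen U) (hc : IsPreconnected U)
    (hF : F.Countable) : IsPreconnected (U \ F) := by
  rw [isPreconnected_closed_iff]
  intro t t' ht ht' hcov ⟨p, hp, hpt⟩ ⟨p', hp', hpt'⟩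
  by_contra hne
  rw [Set.not_nonempty_iff_eq_empty] at hne
  -- Points around which `t` contains a whole ball of `U` up to `F`. Connectedness of balls minus
  -- `F` makes `W t` and `W t'` cover `U`, so a separation of `U \ F` would extend to one of `U`;
  -- density of the complement of `F` supplies the contradiction.
  let W : Set Plane → Set Plane := fun t =>
    {x | ∃ r > 0, Metric.ball x r ⊆ U ∧ Metric.ball x r \ F ⊆ t}
  have hW : ∀ t, IsOpen (W t) := fun t => Metric.isOpen_iff.2 fun x ⟨r, hr, h1, h2⟩ =>
    ⟨r, hr, fun y hy => by
      have hs := Metric.ball_subset_ball' (x := y) (ε₁ := r - dist y x) (y := x) (ε₂ := r) (by linarith)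
      exact ⟨r - dist y x, sub_pos.2 hy, hs.trans h1, (Set.sdiff_subset_sdiff_left hs).trans h2⟩⟩
  have hcovW : U ⊆ W t ∪ W t' := by
    intro x hx
    obtain ⟨r, hr, hrU⟩ := Metric.isOpen_iff.1 hU x hx
    have hb := isPreconnected_ball_diff_countable hF x hr
    have hsub := Set.sdiff_subset_sdiff_left (t := F) hrU
    by_contra hn
    have h1 : ¬ Metric.ball x r \ F ⊆ t := fun h => hn (Or.inl ⟨r, hr, hrU, h⟩)
    have h2 : ¬ Metric.ball x r \ F ⊆ t' := fun h => hn (Or.inr ⟨r, hr, hrU, h⟩)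
    obtain ⟨y, hy, hyt⟩ := Set.not_subset.1 h1
    obtain ⟨z, hz, hzt⟩ := Set.not_subset.1 h2
    obtain ⟨w, hw, hw'⟩ := isPreconnected_closed_iff.1 hb t t' ht ht' (hsub.trans hcov)
      ⟨z, hz, (hcov (hsub hz)).resolve_right hzt⟩ ⟨y, hy, (hcov (hsub hy)).resolve_left hyt⟩
    exact (hne ▸ ⟨hsub hw, hw'⟩ : w ∈ (∅ : Set Plane))
  have hmem : ∀ t x, x ∈ W t → x ∉ F → x ∈ t := fun t x ⟨r, hr, _, h⟩ hx =>
    h ⟨Metric.mem_ball_self hr, hx⟩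
  have hpW : p ∈ W t := (hcovW hp.1).resolve_right fun h =>
    (hne ▸ ⟨hp, hpt, hmem t' p h hp.2⟩ : p ∈ (∅ : Set Plane))
  have hpW' : p' ∈ W t' := (hcovW hp'.1).resolve_left fun h =>
    (hne ▸ ⟨hp', hmem t p' h hp'.2, hpt'⟩ : p' ∈ (∅ : Set Plane))
  obtain ⟨x, hxU, hx, hx'⟩ := hc _ _ (hW t) (hW t') hcovW ⟨p, hp.1, hpW⟩ ⟨p', hp'.1, hpW'⟩
  obtain ⟨y, ⟨⟨hy1, hy2⟩, hy3⟩, hyF⟩ := (hF.dense_compl ℝ).inter_open_nonempty _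
    ((hU.inter (hW t)).inter (hW t')) ⟨x, ⟨hxU, hx⟩, hx'⟩
  exact (hne ▸ ⟨⟨hy1, hyF⟩, hmem t y hy2 hyF, hmem t' y hy3 hyF⟩ : y ∈ (∅ : Set Plane))

/-! ### Incidence of sides, vertices and elements. -/

lemma refBary_refSide (i : Fin 3) (t : ℝ) : refBary i (refSide i t) = 0 ∧
    refBary (i + 1) (refSide i t) = 1 - t ∧ refBary (i + 2) (refSide i t) = t := by
  fin_cases i <;> (refine ⟨?_, ?_, ?_⟩) <;>
    simp [refBary, refSide_apply, refVertex, ← sub_eq_add_neg]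

lemma refBary_refVertex (i : Fin 3) : refBary (i + 1) (refVertex i) = 0 := by
  fin_cases i <;> simp [refBary, refVertex]

lemma eq_of_refSide_eq {i j : Fin 3} {t r : ℝ} (ht : t ∈ Set.Ioo (0 : ℝ) 1)
    (h : refSide i t = refSide j r) : i = j := by
  have h1 := refBary_refSide i t
  have h2 := (refBary_refSide j r).1
  rw [← h] at h2
  obtain ⟨h3, h4⟩ := ht
  have hj : ∀ i j : Fin 3, j = i ∨ j = i + 1 ∨ j = i + 2 := by decide
  rcases hj i j with rfl | rfl | rfl
  · rfl
  · linarith [h1.2.1]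
  · linarith [h1.2.2]

lemma refSide_ne_refVertex {i j : Fin 3} {t : ℝ} (ht : t ∈ Set.Ioo (0 : ℝ) 1) :
    refSide i t ≠ refVertex j := by
  intro h
  have e1 : refVertex j = refSide (j + 2) 0 := by
    have : j + 2 + 1 = j := by clear h; revert j; decide
    simp [refSide, this]
  have e2 : refVertex j = refSide (j + 1) 1 := by
    have : j + 1 + 2 = j := by clear h e1; revert j; decide
    simp [refSide, this]
  have h1 := eq_of_refSide_eq ht (h.trans e1)
  have h2 := eq_of_refSide_eq ht (h.trans e2)
  have : j + 2 ≠ j + 1 := by clear h e1 e2 h1 h2; revert j; decide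
  exact this (h1.symm.trans h2)

namespace IsoMesh

variable {k N : ℕ} {Ω : Set Plane} (M : IsoMesh k N Ω)

/-- The vertices of the mesh. -/
def verts : Set Plane := Set.range fun p : Fin N × Fin 3 => M.psi p.1 (refVertex p.2)

lemma countable_verts : M.verts.Countable := (Set.finite_range _).countable

lemma sideParam_mem_verts (s : LocalSide N) {r : ℝ} (hr : r ∈ Set.Icc (0 : ℝ) 1)
    (h : r ∉ Set.Ioo (0 : ℝ) 1) : M.sideParam s r ∈ M.verts := by
  obtain rfl | rfl : r = 0 ∨ r = 1 := by
    by_contra hn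
    push Not at hn
    exact h ⟨hr.1.lt_of_ne' hn.1, hr.2.lt_of_ne hn.2⟩
  · exact ⟨(s.1, s.2 + 1), by simp [sideParam, refSide]⟩
  · exact ⟨(s.1, s.2 + 2), by simp [sideParam, refSide]⟩

lemma exists_mem_side_of_mem_verts {x : Plane} (hx : x ∈ M.verts) : ∃ s, x ∈ M.side s := by
  obtain ⟨⟨T, i⟩, rfl⟩ := hx
  refine ⟨(T, i + 2), 0, by simp, ?_⟩
  have : i + 2 + 1 = i := by revert i; decide
  simp [sideParam, refSide, this]

/-- Another element meets `T` only in a vertex or side of `T` itself, and by injectivity of the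
elemental map an interior point lies on neither. -/
lemma notMem_side_of_refInt {T : Fin N} {x : Plane} (hx : x ∈ refInt) (s : LocalSide N) :
    M.psi T x ∉ M.side s := by
  have key : ∀ i : Fin 3, M.psi T x ∉ M.side (T, i) := by
    rintro i ⟨r, hr, h⟩
    have := M.injOn T (refSide_mem i hr) (refInt_subset hx) h
    have h1 := (refBary_refSide i r).1
    rw [this] at h1
    exact (hx i).ne' h1
  intro h
  rcases eq_or_ne T s.1 with rfl | hT
  · exact key s.2 h
  have hmem : M.psi T x ∈ M.elem T ∩ M.elem s.1 :=
    ⟨M.psi_mem T (refInt_subset hx), M.side_subset s h⟩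
  rcases M.conforming T s.1 hT with hd | ⟨i, j, -, hij⟩ | ⟨i, j, -, hij⟩
  · exact Set.disjoint_left.1 hd hmem.1 hmem.2
  · have h1 : M.psi T x = M.psi T (refVertex i) := by
      have h2 := hij.subset hmem
      exact h2
    have h3 := M.injOn T (refInt_subset hx) (refVertex_mem i) h1
    have h4 := hx (i + 1)
    rw [h3, refBary_refVertex] at h4
    exact h4.ne rfl
  · exact key i (hij.subset hmem)

/-- Conformity identifies only the closed sides. The change of parameter is a continuous injection
of `[0,1]` into itself, hence strictly monotone, and so it keeps interior parameters in the
interior. -/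
lemma openSide_subset_of_side_eq {s t : LocalSide N} (h : M.side s = M.side t) :
    M.openSide s ⊆ M.openSide t := by
  let φ : ℝ → ℝ := fun r => Function.invFunOn (M.sideParam t) (Set.Icc 0 1) (M.sideParam s r)
  have hmem : ∀ r ∈ Set.Icc (0 : ℝ) 1, M.sideParam s r ∈ M.sideParam t '' Set.Icc 0 1 :=
    fun r hr => h.subset ⟨r, hr, rfl⟩
  have hφ : ∀ r ∈ Set.Icc (0 : ℝ) 1, φ r ∈ Set.Icc (0 : ℝ) 1 := fun r hr =>
    Function.invFunOn_mem (hmem r hr)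
  have heq : ∀ r ∈ Set.Icc (0 : ℝ) 1, M.sideParam t (φ r) = M.sideParam s r := fun r hr =>
    Function.invFunOn_eq (hmem r hr)
  have hcont : ContinuousOn φ (Set.Icc 0 1) :=
    (continuousOn_invFunOn isCompact_Icc (M.continuous_sideParam t) (M.injOn_sideParam t)).comp
      (M.continuous_sideParam s).continuousOn hmem
  have hinj : Set.InjOn φ (Set.Icc 0 1) := fun a ha b hb hab =>
    M.injOn_sideParam s ha hb (by rw [← heq a ha, ← heq b hb, hab])
  rintro _ ⟨r, hr, rfl⟩
  have hr' := Set.Ioo_subset_Icc_self hr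
  have h0 : (0 : ℝ) ∈ Set.Icc (0 : ℝ) 1 := by simp
  have h1 : (1 : ℝ) ∈ Set.Icc (0 : ℝ) 1 := by simp
  refine ⟨φ r, ?_, heq r hr'⟩
  rcases hcont.strictMonoOn_of_injOn_Icc' zero_le_one hinj with hm | hm
  · exact ⟨(hφ 0 h0).1.trans_lt (hm h0 hr' hr.1), (hm hr' h1 hr.2).trans_le (hφ 1 h1).2⟩
  · exact ⟨(hφ 1 h1).1.trans_lt (hm hr' h1 hr.2), (hm h0 hr' hr.1).trans_le (hφ 0 h0).2⟩

lemma openSide_eq_of_side_eq {s t : LocalSide N} (h : M.side s = M.side t) :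
    M.openSide s = M.openSide t :=
  (M.openSide_subset_of_side_eq h).antisymm (M.openSide_subset_of_side_eq h.symm)

lemma exists_side_eq {s : LocalSide N} {y : Plane} (hy : y ∈ M.openSide s) {T : Fin N}
    (hT : s.1 ≠ T) (hyT : y ∈ M.elem T) : ∃ t : LocalSide N, t.1 = T ∧ M.side s = M.side t := by
  have hmem : y ∈ M.elem s.1 ∩ M.elem T := ⟨M.side_subset s (M.openSide_subset s hy), hyT⟩
  obtain ⟨r, hr, rfl⟩ := hy
  have hr' := refSide_mem s.2 (Set.Ioo_subset_Icc_self hr)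
  rcases M.conforming s.1 T hT with hd | ⟨i, j, -, hij⟩ | ⟨i, j, hs, hij⟩
  · exact (Set.disjoint_left.1 hd hmem.1 hmem.2).elim
  · have h1 : M.psi s.1 (refSide s.2 r) = M.psi s.1 (refVertex i) := by
      have h2 := hij.subset hmem
      exact h2
    exact (refSide_ne_refVertex hr (M.injOn s.1 hr' (refVertex_mem i) h1)).elim
  · obtain ⟨r', hr2, h⟩ := hij.subset hmem
    have h1 := M.injOn s.1 (refSide_mem i hr2) hr' h
    obtain rfl := eq_of_refSide_eq hr h1.symm
    exact ⟨(T, j), rfl, hs⟩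

lemma exists_mem_openSide {T T' : Fin N} (hT : T ≠ T') {x : Plane} (hx : x ∈ M.elem T)
    (hx' : x ∈ M.elem T') (hv : x ∉ M.verts) : ∃ i, x ∈ M.openSide (T, i) := by
  rcases M.conforming T T' hT with hd | ⟨i, j, -, hij⟩ | ⟨i, j, -, hij⟩
  · exact (Set.disjoint_left.1 hd hx hx').elim
  · have h1 : x = M.psi T (refVertex i) := by
      have h2 := hij.subset ⟨hx, hx'⟩
      exact h2
    exact (hv ⟨(T, i), h1.symm⟩).elim
  · obtain ⟨r, hr, rfl⟩ := hij.subset ⟨hx, hx'⟩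
    refine ⟨i, r, ?_, rfl⟩
    by_contra hn
    exact hv (M.sideParam_mem_verts (T, i) hr hn)

/-! ### Functions with vanishing dG norm. -/

section Affine

variable {M}

/-- A curved element need not be convex, so the function is pulled back to the reference triangle.
-/
lemma eq_of_pd_eq_zero {T : Fin N} {w : Plane → ℝ} (hd : DifferentiableOn ℝ w (M.elem T))
    (h : ∀ j, ∀ y ∈ M.elem T, pd (M.elem T) j w y = 0) {y z : Plane} (hy : y ∈ M.elem T)
    (hz : z ∈ M.elem T) : w y = w z := by
  have h0 : ∀ y ∈ M.elem T, fderivWithin ℝ w (M.elem T) y = 0 := fun y hy => by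
    ext v
    rw [apply_eq_sum_single]
    exact Finset.sum_eq_zero fun l _ => by
      have := h l y hy
      rw [pd] at this
      rw [this, mul_zero]
  have h1 : ∀ x ∈ refTri, HasFDerivWithinAt (w ∘ M.psi T) (0 : Plane →L[ℝ] ℝ) refTri x := by
    intro x hx
    have h2 := (hd _ (M.psi_mem T hx)).hasFDerivWithinAt
    rw [h0 _ (M.psi_mem T hx)] at h2
    have h3 := h2.comp x (M.differentiable_psi T x).hasFDerivAt.hasFDerivWithinAt
      (fun z hz => M.psi_mem T hz)
    rwa [ContinuousLinearMap.zero_comp] at h3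
  obtain ⟨x, hx, rfl⟩ := hy
  obtain ⟨x', hx', rfl⟩ := hz
  exact convex_refTri.is_const_of_fderivWithin_eq_zero (𝕜 := ℝ) (f := w ∘ M.psi T)
    (fun x hx => (h1 x hx).differentiableWithinAt)
    (fun x hx => (h1 x hx).fderivWithin (uniqueDiffOn_refTri x hx)) hx hx'

/-- The inverse inequality turns vanishing energy into pointwise vanishing on the whole closed
element, edges included. -/
lemma d2_eq_zero {σ : ℝ} (hσ : 0 < σ) (hM : M.ShapeRegular σ) {v : DGSpace k N} {T : Fin N}
    (h : M.energy v T = 0) (i j : Fin 2) {y : Plane} (hy : y ∈ M.elem T) :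
    M.d2 v i j T y = 0 := by
  obtain ⟨C, hC, hb⟩ := exists_rational_bound k 4 (7 * k) hσ
  have h1 := (hb N Ω M hM T _ (M.isRational_d2 v i j T) y hy).1
  have h2 := M.integral_d2_sq_le v T i j
  have hH := M.diam_elem_pos T
  have h3 : C / Metric.diam (M.elem T) ^ 2 * ∫ z in M.elem T, M.d2 v i j T z ^ 2 ≤ 0 :=
    mul_nonpos_of_nonneg_of_nonpos (by positivity) (h ▸ h2)
  exact pow_eq_zero_iff two_ne_zero |>.1 (le_antisymm (h1.trans h3) (sq_nonneg _))

/-- A function with vanishing Hessian is affine on every element. -/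
lemma exists_affine {v : DGSpace k N} {T : Fin N}
    (h : ∀ i j, ∀ y ∈ M.elem T, M.d2 v i j T y = 0) : ∃ A : Fin 2 → ℝ, ∃ c : ℝ,
      ∀ y ∈ M.elem T, (∀ i, M.d1 v i T y = A i) ∧ M.loc v T y = ∑ i, A i * y i + c := by
  have hp := M.psi_mem T (refVertex_mem 0)
  set p := M.psi T (refVertex 0)
  have h1 : ∀ i, ∀ y ∈ M.elem T, M.d1 v i T y = M.d1 v i T p := fun i y hy =>
    eq_of_pd_eq_zero (M.isRational_d1 v i T).differentiableOn (fun j z hz => h i j z hz) hy hp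
  let L : Plane →L[ℝ] ℝ := ∑ i, M.d1 v i T p • EuclideanSpace.proj i
  have hL : ∀ y, L y = ∑ i, M.d1 v i T p * y i := fun y => by simp [L]
  have hdl := (M.isRational_loc v T).differentiableOn
  have h2 : ∀ y ∈ M.elem T, (M.loc v T - L) y = (M.loc v T - L) p := fun y hy =>
    eq_of_pd_eq_zero (hdl.sub L.differentiable.differentiableOn) (fun j z hz => by
      have hU := M.uniqueDiffOn_elem T z hz
      rw [pd, fderivWithin_sub hU (hdl z hz) L.differentiableAt.differentiableWithinAt,
        L.fderivWithin hU]
      have h3 := h1 j z hz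
      rw [d1, pd] at h3
      rw [sub_apply, h3, hL]
      fin_cases j <;> simp [d1]) hy hp
  refine ⟨fun i => M.d1 v i T p, (M.loc v T - L) p, fun y hy => ⟨fun i => h1 i y hy, ?_⟩⟩
  rw [← h2 y hy, Pi.sub_apply, hL]
  ring

/-- A single point suffices for what follows: on affine pieces the gradient jump is constant, and
once the slopes agree so is the value jump. -/
lemma exists_mem_side_eq_zero {s : LocalSide N} {f : Plane → ℝ} (hf : MemLp f 2 (M.sideMeasure s))
    (h : ∫ x, f x ^ 2 ∂M.sideMeasure s = 0) : ∃ x ∈ M.side s, f x = 0 := by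
  have h1 := (integral_eq_zero_iff_of_nonneg (fun _ => sq_nonneg _) hf.integrable_sq).1 h
  have : (ae (M.sideMeasure s)).NeBot := ae_neBot.2 (M.sideMeasure_ne_zero s)
  obtain ⟨x, hx, hx'⟩ := (h1.and (M.ae_mem_side s)).exists
  exact ⟨x, hx', by simpa using hx⟩

variable {P : DGParams N}

lemma exists_gradJump_eq_zero (hh : ∀ s, 0 < P.h (M.side s)) {v : DGSpace k N}
    (h : M.gradJumps P v = 0) {e : MeshEdge N} (he : e ∈ M.edgesOff P) (i : Fin 2) :
    ∃ x ∈ M.side e.1, jump 0 (M.d1 v i) e x = 0 := by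
  have hm := fun i => memLp_jump_zero (mem_edgesOff.1 he).1 (M.continuousOn_d1 v i)
  refine exists_mem_side_eq_zero (hm i) (le_antisymm ?_ (integral_nonneg fun _ => sq_nonneg _))
  have h1 := (Finset.sum_eq_zero_iff_of_nonneg fun e _ => mul_nonneg (inv_nonneg.2 (hh e.1).le)
    (integral_nonneg fun _ => Finset.sum_nonneg fun _ _ => sq_nonneg _)).1 h e he
  have h2 := (mul_eq_zero.1 h1).resolve_left (inv_ne_zero (hh e.1).ne')
  rw [← h2]
  refine integral_mono (hm i).integrable_sq
    (integrable_finsetSum _ fun i _ => (hm i).integrable_sq) fun x => ?_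
  exact Finset.single_le_sum (f := fun i => jump 0 (M.d1 v i) e x ^ 2) (fun _ _ => sq_nonneg _)
    (Finset.mem_univ i)

lemma exists_valueJump_eq_zero (hh : ∀ s, 0 < P.h (M.side s)) {v : DGSpace k N}
    (h : M.valueJumps P v = 0) {e : MeshEdge N} (he : e ∈ M.edges P) :
    ∃ x ∈ M.side e.1, jump 0 (M.loc v) e x = 0 := by
  refine exists_mem_side_eq_zero (memLp_jump_zero he (M.continuousOn_loc v)) ?_
  have h1 := (Finset.sum_eq_zero_iff_of_nonneg fun e _ => mul_nonneg
    (inv_nonneg.2 (pow_pos (hh e.1) 3).le) (integral_nonneg fun _ => sq_nonneg _)).1 h e he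
  exact (mul_eq_zero.1 h1).resolve_left (inv_ne_zero (pow_pos (hh e.1) 3).ne')

end Affine

section Definite

variable {M} {P : DGParams N}

/-- A quantity attached to the elements that is transmitted through the inner edges off the
interface and vanishes at the clamped boundary edges vanishes on a clamped subdomain. -/
lemma eq_zero_of_clamped {α : Type*} {A : Fin N → α} {z : α}
    (hinner : ∀ s t, (s, some t) ∈ M.edgesOff P → A s.1 = A t.1)
    (hbdry : ∀ s, (s, none) ∈ M.edgesOff P → A s.1 = z) (hΩ : IsOpen Ω) {Ω' : Set Plane}
    (ho : IsOpen Ω') (hc : IsConnected Ω') (hsub : Ω' ⊆ Ω) (hdisj : Disjoint Ω' P.Γif)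
    (hcl : M.ClampedOn P Ω') {T : Fin N} (hT : (M.elem T ∩ (Ω' \ M.verts)).Nonempty) :
    A T = z := by
  -- A shared point that is not a vertex is interior to a common side. This side contains a point of
  -- `Ω'`, so it is an inner edge and not an interface edge, and transmission applies.
  have hagree : ∀ T T' x, x ∈ Ω' \ M.verts → x ∈ M.elem T → x ∈ M.elem T' → A T = A T' := by
    intro T T' x hx hT hT'
    rcases eq_or_ne T T' with rfl | hne
    · rfl
    obtain ⟨i, hi⟩ := M.exists_mem_openSide hne hT hT' hx.2
    obtain ⟨t, rfl, hst⟩ := M.exists_side_eq hi hne hT'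
    have hΓ : x ∉ P.Γif := Set.disjoint_left.1 hdisj hx.1
    have hloc : M.openSide (T, i) ⊆ Ω := (M.side_location T i).resolve_right fun h => by
      have h1 := h hi
      rw [hΩ.frontier_eq] at h1
      exact h1.2 (hsub hx.1)
    have ho := M.openSide_eq_of_side_eq hst
    rcases lt_or_gt_of_ne hne with hlt | hlt
    · exact hinner (T, i) t (mem_edgesOff.2
        ⟨mem_edges_some.2 ⟨hlt, hst, hloc⟩, fun h => hΓ (h hi)⟩)
    · exact (hinner t (T, i) (mem_edgesOff.2
        ⟨mem_edges_some.2 ⟨hlt, hst.symm, ho ▸ hloc⟩, fun h => hΓ (h (ho ▸ hi))⟩)).symm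
  have hcover : Ω' \ M.verts ⊆ ⋃ T, M.elem T := fun x hx => by
    have := M.cover.subset (subset_closure (hsub hx.1))
    exact this
  -- The clamped point `x` is a limit of points of `Ω'` off the vertices. As there are finitely many
  -- elements, one of them meets that set and contains `x`; it has the clamped side as one of its
  -- own sides.
  obtain ⟨T₀, hT₀, hz⟩ : ∃ T₀, (M.elem T₀ ∩ (Ω' \ M.verts)).Nonempty ∧ A T₀ = z := by
    obtain ⟨x, hxs, hxf, hxΓ⟩ := hcl
    simp only [Set.mem_iUnion] at hxs
    obtain ⟨s, hs, hx⟩ := hxs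
    have hbd : ∀ t, M.openSide t = M.openSide s → A t.1 = z := fun t ht => by
      refine hbdry t (mem_edgesOff.2 ⟨mem_edges_none.2 ?_, fun h => hxΓ (h (ht ▸ hx))⟩)
      simp only [dirichletSides, Finset.mem_filter, Finset.mem_univ, true_and] at hs ⊢
      rwa [ht]
    have h1 : x ∈ closure (Ω' \ M.verts) := by
      have h2 := (M.countable_verts.dense_compl ℝ).open_subset_closure_inter ho
      rw [← Set.sdiff_eq] at h2
      exact closure_minimal h2 isClosed_closure hxf.1
    have h2 : x ∈ ⋃ T, closure (M.elem T ∩ (Ω' \ M.verts)) := by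
      rw [← closure_iUnion_of_finite, ← Set.iUnion_inter, Set.inter_eq_right.2 hcover]
      exact h1
    obtain ⟨T', hT'⟩ := Set.mem_iUnion.1 h2
    have hxT : x ∈ M.elem T' :=
      (M.isCompact_elem T').isClosed.closure_subset_iff.2 Set.inter_subset_left hT'
    refine ⟨T', closure_nonempty_iff.1 ⟨x, hT'⟩, ?_⟩
    rcases eq_or_ne s.1 T' with rfl | hne
    · exact hbd s rfl
    · obtain ⟨t, rfl, hst⟩ := M.exists_side_eq hx hne hxT
      exact hbd t (M.openSide_eq_of_side_eq hst).symm
  -- The elements with value `z` and the others form two closed sets that cover the connected set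
  -- `Ω' \ M.verts`. Both meet it, so they share a point of it, contradicting `hagree`.
  by_contra hTz
  have hpre := IsPreconnected.diff_countable ho hc.isPreconnected M.countable_verts
  have hcl : ∀ p : Fin N → Prop, IsClosed (⋃ T ∈ {T | p T}, M.elem T) := fun p =>
    (Set.toFinite _).isClosed_biUnion fun T _ => (M.isCompact_elem T).isClosed
  obtain ⟨x, hx, hx0, hx1⟩ := isPreconnected_closed_iff.1 hpre _ _
    (hcl fun T => A T = z) (hcl fun T => A T ≠ z) (fun x hx => by
      obtain ⟨T, hT⟩ := Set.mem_iUnion.1 (hcover hx)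
      by_cases h : A T = z
      · exact Or.inl (Set.mem_biUnion (show T ∈ {T | A T = z} from h) hT)
      · exact Or.inr (Set.mem_biUnion (show T ∈ {T | A T ≠ z} from h) hT))
    (by
      obtain ⟨x, hx, hx'⟩ := hT₀
      exact ⟨x, hx', Set.mem_biUnion (show T₀ ∈ {T | A T = z} from hz) hx⟩)
    (by
      obtain ⟨x, hx, hx'⟩ := hT
      exact ⟨x, hx', Set.mem_biUnion (show T ∈ {T | A T ≠ z} from hTz) hx⟩)
  simp only [Set.mem_iUnion, exists_prop] at hx0 hx1
  obtain ⟨T1, h1, h1'⟩ := hx0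
  obtain ⟨T2, h2, h2'⟩ := hx1
  exact h2 ((hagree T1 T2 x hx h1' h2').symm.trans h1)

/-- Image points of the open reference triangle lie on no side, hence neither at a vertex nor on the
interface, which is covered by sides. -/
lemma exists_touching {Ω₁ Ω₂ : Set Plane} (hG : M.IsFoldGeometry Ω₁ Ω₂ P) (T : Fin N) :
    (M.elem T ∩ (Ω₁ \ M.verts)).Nonempty ∨ (M.elem T ∩ (Ω₂ \ M.verts)).Nonempty := by
  have hv : ∀ x ∈ M.psi T '' refInt, x ∉ M.verts := by
    rintro _ ⟨x, hx, rfl⟩ h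
    obtain ⟨s, hs⟩ := M.exists_mem_side_of_mem_verts h
    exact M.notMem_side_of_refInt hx s hs
  obtain ⟨x, hx⟩ := refInt_nonempty
  have hΩ : M.psi T x ∈ Ω := M.open_subset T ⟨x, refInt_subset_interior hx, rfl⟩
  have hxT := M.psi_mem T (refInt_subset hx)
  have hxv := hv _ ⟨x, hx, rfl⟩
  rcases hG.partition.subset hΩ with (h | h) | h
  · exact Or.inl ⟨_, hxT, h, hxv⟩
  · exact Or.inr ⟨_, hxT, h, hxv⟩
  · obtain ⟨s, hs, -⟩ := hG.resolved _ h
    exact (M.notMem_side_of_refInt hx s hs).elim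

/-- The dG norm is definite if both subdomains are clamped. -/
lemma eq_zero_of_dgNorm_eq_zero {σ : ℝ} (hσ : 0 < σ) {Ω₁ Ω₂ : Set Plane}
    (hG : M.IsFoldGeometry Ω₁ Ω₂ P) (hM : M.ShapeRegular σ) (hS : M.MeshSize σ P.h)
    (h₀ : 0 < P.γ₀) (h₁ : 0 < P.γ₁) (hc₁ : M.ClampedOn P Ω₁) (hc₂ : M.ClampedOn P Ω₂)
    {v : DGSpace k N} (hv : M.dgNorm P v = 0) : v = 0 := by
  have hh := hS.pos hσ
  have hsq := dgNorm_sq hh h₀.le h₁.le v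
  rw [hv, zero_pow two_ne_zero] at hsq
  have hE := Finset.sum_nonneg fun T (_ : T ∈ Finset.univ) => M.energy_nonneg v T
  have hJ₁ := gradJumps_nonneg hh v
  have hJ₀ := valueJumps_nonneg hh v
  have p₁ := mul_nonneg h₁.le hJ₁
  have p₀ := mul_nonneg h₀.le hJ₀
  have hE0 : ∑ T, M.energy v T = 0 := by linarith
  have hJ₁0 : M.gradJumps P v = 0 :=
    (mul_eq_zero.1 (by linarith : P.γ₁ * M.gradJumps P v = 0)).resolve_left h₁.ne'
  have hJ₀0 : M.valueJumps P v = 0 :=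
    (mul_eq_zero.1 (by linarith : P.γ₀ * M.valueJumps P v = 0)).resolve_left h₀.ne'
  have hET : ∀ T, M.energy v T = 0 := fun T =>
    (Finset.sum_eq_zero_iff_of_nonneg fun T _ => M.energy_nonneg v T).1 hE0 T (Finset.mem_univ T)
  choose A c hAc using fun T => exists_affine fun i j y hy => d2_eq_zero hσ hM (hET T) i j hy
  -- The gradient jump matches the slopes first; the value jump then matches the constants.
  have hinner : ∀ s t, (s, some t) ∈ M.edgesOff P → (A s.1, c s.1) = (A t.1, c t.1) := by
    intro s t he
    have he' := (mem_edgesOff.1 he).1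
    have hA : A s.1 = A t.1 := by
      ext i
      obtain ⟨x, hx, hj⟩ := exists_gradJump_eq_zero hh hJ₁0 he i
      rw [← (hAc s.1 x (M.side_subset s hx)).1 i, ← (hAc t.1 x (mem_elem_of_mem_side he' hx)).1 i]
      exact sub_eq_zero.1 hj
    obtain ⟨x, hx, hj⟩ := exists_valueJump_eq_zero hh hJ₀0 he'
    have h2 : M.loc v s.1 x = M.loc v t.1 x := sub_eq_zero.1 hj
    rw [(hAc s.1 x (M.side_subset s hx)).2, (hAc t.1 x (mem_elem_of_mem_side he' hx)).2, hA,
      add_right_inj] at h2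
    rw [hA, h2]
  have hbdry : ∀ s, (s, none) ∈ M.edgesOff P → (A s.1, c s.1) = (0, 0) := by
    intro s he
    have he' := (mem_edgesOff.1 he).1
    have hA : A s.1 = 0 := by
      ext i
      obtain ⟨x, hx, hj⟩ := exists_gradJump_eq_zero hh hJ₁0 he i
      rw [← (hAc s.1 x (M.side_subset s hx)).1 i]
      exact (sub_eq_zero.1 hj).symm
    obtain ⟨x, hx, hj⟩ := exists_valueJump_eq_zero hh hJ₀0 he'
    have h2 : M.loc v s.1 x = 0 := (sub_eq_zero.1 hj).symm
    rw [(hAc s.1 x (M.side_subset s hx)).2, hA] at h2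
    simp only [Pi.zero_apply, zero_mul, Finset.sum_const_zero, zero_add] at h2
    rw [hA, h2]
  have hsub₁ : Ω₁ ⊆ Ω := fun x hx => hG.partition ▸ Or.inl (Or.inl hx)
  have hsub₂ : Ω₂ ⊆ Ω := fun x hx => hG.partition ▸ Or.inl (Or.inr hx)
  have hz : ∀ T, (A T, c T) = (0, 0) := fun T => by
    rcases exists_touching hG T with h | h
    · exact eq_zero_of_clamped (A := fun T => (A T, c T)) hinner hbdry hG.isOpen hG.isOpen₁
        hG.isConnected₁ hsub₁ hG.disjoint₁ hc₁ h
    · exact eq_zero_of_clamped (A := fun T => (A T, c T)) hinner hbdry hG.isOpen hG.isOpen₂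
        hG.isConnected₂ hsub₂ hG.disjoint₂ hc₂ h
  funext T
  refine Subtype.ext (eq_zero_of_ev_eq_zero fun x hx => ?_)
  have h1 := (hAc T _ (M.psi_mem T (refInt_subset hx))).2
  have h2 := Prod.mk.injEq _ _ _ _ ▸ hz T
  simp only [h2.1, h2.2, loc, M.inv_psi T (refInt_subset hx), Pi.zero_apply, zero_mul,
    Finset.sum_const_zero, add_zero] at h1
  exact h1

end Definite

end IsoMesh

/-! ### Boundary data and unique solvability. -/

namespace IsoMesh

variable {k N : ℕ} {Ω : Set Plane} (M : IsoMesh k N Ω) {P : DGParams N}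

lemma isLinearMap_toFun (x : Plane) : IsLinearMap ℝ fun v => M.toFun v x :=
  IsLinearMap.sum' fun T _ => by
    by_cases h : x ∈ M.psi T '' interior refTri
    · simpa only [Set.indicator_of_mem h] using M.isLinearMap_loc T x
    · simpa only [Set.indicator_of_notMem h] using isLinearMap_iff_comb.2 (by simp)

lemma memLp_toFun (hΩ : Bornology.IsBounded Ω) (v : DGSpace k N) :
    MemLp (M.toFun v) 2 (volume.restrict Ω) := by
  have : IsFiniteMeasure (volume.restrict Ω) := ⟨by simpa using hΩ.measure_lt_top⟩
  refine MemLp.mono_exponent (q := ⊤) ?_ le_top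
  refine memLp_finsetSum _ fun T _ => ?_
  obtain ⟨C, hC⟩ := (M.isCompact_elem T).exists_bound_of_continuousOn (M.continuousOn_loc v T)
  have hS : M.psi T '' interior refTri ⊆ M.elem T := Set.image_mono interior_subset
  have hm : MeasurableSet (M.psi T '' interior refTri) :=
    isOpen_interior.measurableSet.image_of_continuousOn_injOn (M.continuous_psi T).continuousOn
      ((M.injOn T).mono interior_subset)
  refine memLp_top_of_bound ?_ (max C 0) (Filter.Eventually.of_forall fun x => ?_)
  · exact ((aestronglyMeasurable_indicator_iff hm).2
      (((M.continuousOn_loc v T).mono hS).aestronglyMeasurable hm)).restrict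
  · by_cases h : x ∈ M.psi T '' interior refTri
    · rw [Set.indicator_of_mem h]
      exact (hC x (hS h)).trans (le_max_left _ _)
    · rw [Set.indicator_of_notMem h, norm_zero]
      exact le_max_right _ _

lemma isLinearMap_load (hΩ : Bornology.IsBounded Ω) {f : Plane → ℝ}
    (hf : MemLp f 2 (volume.restrict Ω)) : IsLinearMap ℝ fun v => M.load f v :=
  isLinearMap_integral (fun v => integrable_mul_of_memLp hf (M.memLp_toFun hΩ v))
    (Filter.Eventually.of_forall fun x => (M.isLinearMap_toFun x).const_mul' _)

/-- A quantity on the boundary edges, extended by zero to the inner edges. -/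
def boundaryTerm {R : Type*} [Zero R] (F : LocalSide N → R) (e : MeshEdge N) : R :=
  match e.2 with
  | some _ => 0
  | none => F e.1

variable {M}

lemma sum_boundaryTerm (F : LocalSide N → ℝ) :
    ∑ e ∈ M.edges P, boundaryTerm F e = ∑ s ∈ M.dirichletSides P, F s := by
  have e : ∑ s ∈ M.dirichletSides P, F s = ∑ e ∈ (M.dirichletSides P).map
      ⟨fun s => (s, none), fun s s' h => congrArg Prod.fst h⟩, boundaryTerm F e := by
    rw [Finset.sum_map]
    rfl
  rw [e]
  refine (Finset.sum_subset (fun e he => ?_) fun e he he' => ?_).symm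
  · obtain ⟨s, hs, rfl⟩ := Finset.mem_map.1 he
    exact mem_edges_none.2 hs
  · rcases e with ⟨s, _ | t⟩
    · exact (he' (Finset.mem_map.2 ⟨s, mem_edges_none.1 he, rfl⟩)).elim
    · rfl

/-- A Dirichlet edge is never an interface edge: `ΓD` lies in the frontier of the open set `Ω`,
whereas the interface lies in `Ω`. -/
lemma sum_boundaryTerm_off {Ω₁ Ω₂ : Set Plane} (hG : M.IsFoldGeometry Ω₁ Ω₂ P)
    (F : LocalSide N → ℝ) :
    ∑ e ∈ M.edgesOff P, boundaryTerm F e = ∑ s ∈ M.dirichletSides P, F s := by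
  rw [← sum_boundaryTerm]
  refine Finset.sum_subset (fun e he => (mem_edgesOff.1 he).1) fun e he he' => ?_
  rcases e with ⟨s, _ | t⟩
  · refine (he' (mem_edgesOff.2 ⟨he, fun h => ?_⟩)).elim
    obtain ⟨x, hx⟩ := M.openSide_nonempty s
    have h1 : x ∈ Ω := hG.partition.symm.subset (Or.inr (h hx))
    have h2 : x ∈ frontier Ω := hG.clamped_subset (by
      have h3 := mem_edges_none.1 he
      simp only [dirichletSides, Finset.mem_filter, Finset.mem_univ, true_and] at h3
      exact h3 hx)
    rw [hG.isOpen.frontier_eq] at h2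
    exact h2.2 h1
  · rfl

lemma jump_eq_add (b : Plane → ℝ) (q : Fin N → Plane → ℝ) (e : MeshEdge N) (x : Plane) :
    jump b q e x = jump 0 q e x + boundaryTerm (fun _ => b) e x := by
  rcases e with ⟨s, _ | t⟩
  · simp [jump, boundaryTerm]; ring
  · simp [jump, boundaryTerm]

lemma memLp_boundaryTerm {b : Plane → ℝ}
    (hb : ∀ s ∈ M.dirichletSides P, MemLp b 2 (M.sideMeasure s)) {e : MeshEdge N}
    (he : e ∈ M.edges P) : MemLp (boundaryTerm (fun _ => b) e) 2 (M.sideMeasure e.1) := by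
  rcases e with ⟨s, _ | t⟩
  · exact hb s (mem_edges_none.1 he)
  · exact MemLp.zero

/-- The boundary data can be collected into the right-hand side. -/
lemma formWithData_eq {Ω₁ Ω₂ : Set Plane} (hG : M.IsFoldGeometry Ω₁ Ω₂ P) (f : Plane → ℝ)
    {g : Plane → ℝ} {Φ : Plane → Plane}
    (hg : ∀ s ∈ M.dirichletSides P, MemLp g 2 (M.sideMeasure s))
    (hΦ : ∀ i, ∀ s ∈ M.dirichletSides P, MemLp (fun x => Φ x i) 2 (M.sideMeasure s))
    (u v : DGSpace k N) :
    M.formWithData P g Φ u v = M.form P u v - M.rhs P f g Φ v + M.load f v := by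
  have hoff : ∀ e ∈ M.edgesOff P, e ∈ M.edges P := fun e he => (mem_edgesOff.1 he).1
  have j1 : ∀ e ∈ M.edges P, ∀ w i, MemLp (jump 0 (M.d1 w i) e) 2 (M.sideMeasure e.1) :=
    fun e he w i => memLp_jump_zero he (M.continuousOn_d1 w i)
  have j0 : ∀ e ∈ M.edges P, ∀ w, MemLp (jump 0 (M.loc w) e) 2 (M.sideMeasure e.1) :=
    fun e he w => memLp_jump_zero he (M.continuousOn_loc w)
  have t3 : (∑ e ∈ M.edgesOff P, ∫ x, ∑ i,
      M.avgDnGrad P v e i x * jump (fun y => Φ y i) (M.d1 u i) e x ∂M.sideMeasure e.1)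
      = (∑ e ∈ M.edgesOff P, ∫ x, ∑ i,
        M.avgDnGrad P v e i x * jump 0 (M.d1 u i) e x ∂M.sideMeasure e.1)
      + ∑ s ∈ M.dirichletSides P, ∫ x, ∑ i,
        (∑ j, M.normal s x j * M.d2 v i j s.1 x) * Φ x i ∂M.sideMeasure s := by
    rw [← sum_boundaryTerm_off hG, ← Finset.sum_add_distrib]
    refine Finset.sum_congr rfl fun e he => ?_
    simp only [jump_eq_add (fun y => Φ y _), mul_add, Finset.sum_add_distrib]
    rw [integral_add (integrable_sum_mul_of_memLp (memLp_avgDnGrad (hoff e he) v)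
      (j1 e (hoff e he) u)) (integrable_sum_mul_of_memLp (memLp_avgDnGrad (hoff e he) v)
      fun i => memLp_boundaryTerm (hΦ i) (hoff e he))]
    rcases e with ⟨s, _ | t⟩
    · rfl
    · simp [boundaryTerm]
  have t5 : (∑ e ∈ M.edges P, ∫ x,
      M.avgDnLap P v e x * jump g (M.loc u) e x ∂M.sideMeasure e.1)
      = (∑ e ∈ M.edges P, ∫ x, M.avgDnLap P v e x * jump 0 (M.loc u) e x ∂M.sideMeasure e.1)
      + ∑ s ∈ M.dirichletSides P, ∫ x,
        (∑ j, M.normal s x j * pd (M.elem s.1) j (M.lap v s.1) x) * g x ∂M.sideMeasure s := by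
    rw [← sum_boundaryTerm, ← Finset.sum_add_distrib]
    refine Finset.sum_congr rfl fun e he => ?_
    simp only [jump_eq_add g, mul_add]
    rw [integral_add (integrable_mul_of_memLp (memLp_avgDnLap he v) (j0 e he u))
      (integrable_mul_of_memLp (memLp_avgDnLap he v) (memLp_boundaryTerm hg he))]
    rcases e with ⟨s, _ | t⟩
    · rfl
    · simp [boundaryTerm]
  have t6 : (∑ e ∈ M.edgesOff P, ∫ x, (P.h (M.side e.1))⁻¹ * ∑ i,
      jump (fun y => Φ y i) (M.d1 u i) e x * jump 0 (M.d1 v i) e x ∂M.sideMeasure e.1)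
      = (∑ e ∈ M.edgesOff P, ∫ x, (P.h (M.side e.1))⁻¹ * ∑ i,
        jump 0 (M.d1 u i) e x * jump 0 (M.d1 v i) e x ∂M.sideMeasure e.1)
      - ∑ s ∈ M.dirichletSides P, ∫ x, (P.h (M.side s))⁻¹ *
        ∑ i, Φ x i * M.d1 v i s.1 x ∂M.sideMeasure s := by
    rw [← sum_boundaryTerm_off hG, ← Finset.sum_sub_distrib]
    refine Finset.sum_congr rfl fun e he => ?_
    simp only [jump_eq_add (fun y => Φ y _), add_mul, Finset.sum_add_distrib]
    simp only [integral_const_mul]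
    rw [integral_add (integrable_sum_mul_of_memLp (j1 e (hoff e he) u) (j1 e (hoff e he) v))
      (integrable_sum_mul_of_memLp (fun i => memLp_boundaryTerm (hΦ i) (hoff e he))
        (j1 e (hoff e he) v))]
    rcases e with ⟨s, _ | t⟩
    -- The homogeneous boundary jump of the test function is minus its trace; hence the minus sign
    -- in the penalty terms.
    · have e : ∀ x i, boundaryTerm (fun _ y => Φ y i) ((s, none) : MeshEdge N) x
          * jump 0 (M.d1 v i) (s, none) x = -(Φ x i * M.d1 v i s.1 x) := fun x i => by
        simp [boundaryTerm, jump]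
      simp only [e, Finset.sum_neg_distrib, integral_neg]
      simp only [boundaryTerm]
      ring
    · simp [boundaryTerm]
  have t7 : (∑ e ∈ M.edges P, ∫ x, (P.h (M.side e.1) ^ 3)⁻¹ *
      (jump g (M.loc u) e x * jump 0 (M.loc v) e x) ∂M.sideMeasure e.1)
      = (∑ e ∈ M.edges P, ∫ x, (P.h (M.side e.1) ^ 3)⁻¹ *
        (jump 0 (M.loc u) e x * jump 0 (M.loc v) e x) ∂M.sideMeasure e.1)
      - ∑ s ∈ M.dirichletSides P, ∫ x, (P.h (M.side s) ^ 3)⁻¹ *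
        (g x * M.loc v s.1 x) ∂M.sideMeasure s := by
    rw [← sum_boundaryTerm, ← Finset.sum_sub_distrib]
    refine Finset.sum_congr rfl fun e he => ?_
    simp only [jump_eq_add g, add_mul]
    simp only [integral_const_mul]
    rw [integral_add (integrable_mul_of_memLp (j0 e he u) (j0 e he v))
      (integrable_mul_of_memLp (memLp_boundaryTerm hg he) (j0 e he v))]
    rcases e with ⟨s, _ | t⟩
    · simp [boundaryTerm, jump, integral_neg]
      ring
    · simp [boundaryTerm]
  have e0 : (fun _ => 0 : Plane → ℝ) = 0 := rfl
  rw [form, formWithData, formWithData, t3, t5, t6, t7, rhs]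
  simp only [Pi.zero_apply, PiLp.zero_apply, e0]
  ring

lemma isLinearMap_rhs {Ω₁ Ω₂ : Set Plane} (hG : M.IsFoldGeometry Ω₁ Ω₂ P) {f g : Plane → ℝ}
    {Φ : Plane → Plane} (hf : MemLp f 2 (volume.restrict Ω))
    (hg : ∀ s ∈ M.dirichletSides P, MemLp g 2 (M.sideMeasure s))
    (hΦ : ∀ i, ∀ s ∈ M.dirichletSides P, MemLp (fun x => Φ x i) 2 (M.sideMeasure s)) :
    IsLinearMap ℝ fun v => M.rhs P f g Φ v := by
  -- Linearity of the right-hand side is read off from `formWithData_eq` with `u = 0`.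
  have e : (fun v => M.rhs P f g Φ v)
      = fun v => M.form P 0 v + M.load f v - M.formWithData P g Φ 0 v := by
    ext v
    rw [formWithData_eq hG f hg hΦ]
    ring
  rw [e]
  exact ((M.isLinearMap_form_right 0).add' (M.isLinearMap_load hG.isBounded hf)).sub'
    (M.isLinearMap_formWithData hg (fun s hs i => hΦ i s hs) 0)

/-- If the form is definite, linear problems are uniquely solvable. -/
lemma exists_unique_form_eq (h : ∀ u : DGSpace k N, M.form P u u = 0 → u = 0)
    {r : DGSpace k N → ℝ} (hr : IsLinearMap ℝ r) :
    ∃ u : DGSpace k N, ∀ w, (∀ v, M.form P w v = r v) ↔ w = u := by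
  have hinj : Function.Injective (M.formBilin P) := by
    rw [injective_iff_map_eq_zero]
    intro u hu
    exact h u (LinearMap.congr_fun hu u)
  -- The space and its dual have equal dimension, so injectivity of `u ↦ a_h(u, ·)` gives
  -- surjectivity.
  have hfin : Module.finrank ℝ (DGSpace k N) = Module.finrank ℝ (DGSpace k N →ₗ[ℝ] ℝ) :=
    Subspace.dual_finrank_eq.symm
  obtain ⟨u, hu⟩ := (LinearMap.injective_iff_surjective_of_finrank_eq_finrank hfin).1 hinj
    (hr.mk' r)
  refine ⟨u, fun w => ⟨fun hw => hinj ?_, ?_⟩⟩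
  · rw [hu]
    exact LinearMap.ext hw
  · rintro rfl v
    exact LinearMap.congr_fun hu v

end IsoMesh

end

theorem mainTheorem3 (k : ℕ) (hk : 1 ≤ k) (σ : ℝ) (hσ : 0 < σ) :
    ∃ γmin c : ℝ, 0 < γmin ∧ 0 < c ∧
      ∀ (N : ℕ) (Ω Ω₁ Ω₂ : Set Plane) (M : IsoMesh k N Ω) (P : DGParams N),
        M.IsFoldGeometry Ω₁ Ω₂ P → M.ShapeRegular σ → M.MeshSize σ P.h →
        γmin ≤ P.γ₀ → γmin ≤ P.γ₁ →
          (∀ v : DGSpace k N, 1 / 2 * M.dgNorm P v ^ 2 ≤ M.form P v v) ∧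
          (∀ v w : DGSpace k N, |M.form P v w| ≤ c * M.dgNorm P v * M.dgNorm P w) ∧
          (M.ClampedOn P Ω₁ → M.ClampedOn P Ω₂ →
            ∀ (f g : Plane → ℝ) (Φ : Plane → Plane),
              MeasureTheory.MemLp f 2 (MeasureTheory.volume.restrict Ω) →
              (∀ s ∈ M.dirichletSides P, MeasureTheory.MemLp g 2 (M.sideMeasure s)) →
              (∀ s ∈ M.dirichletSides P, MeasureTheory.MemLp Φ 2 (M.sideMeasure s)) →
              ∃ u : DGSpace k N,
                (∀ w, M.IsDGSolution P f g Φ w ↔ w = u) ∧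
                (∀ w, (∀ v : DGSpace k N, M.form P w v = M.rhs P f g Φ v) ↔ w = u)) := by
  obtain ⟨γmin, hγ, h⟩ := IsoMesh.exists_form_self_bounds k hσ
  refine ⟨γmin, 2, hγ, two_pos, fun N Ω Ω₁ Ω₂ M P hG hM hS h₀ h₁ => ?_⟩
  have hb := h N Ω M P hM hS h₀ h₁
  refine ⟨fun v => (hb v).1, IsoMesh.abs_form_le fun v =>
    ⟨(by positivity : (0 : ℝ) ≤ 1 / 2 * M.dgNorm P v ^ 2).trans (hb v).1, (hb v).2⟩,
    fun hc₁ hc₂ f g Φ hf hg hΦ => ?_⟩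
  have hΦ' : ∀ i, ∀ s ∈ M.dirichletSides P, MemLp (fun x => Φ x i) 2 (M.sideMeasure s) :=
    fun i s hs => (EuclideanSpace.proj (𝕜 := ℝ) i : Plane →L[ℝ] ℝ).comp_memLp' (hΦ s hs)
  obtain ⟨u, hu⟩ := IsoMesh.exists_unique_form_eq (M := M) (P := P) (fun u hu =>
    IsoMesh.eq_zero_of_dgNorm_eq_zero hσ hG hM hS (hγ.trans_le h₀) (hγ.trans_le h₁) hc₁ hc₂
      (pow_eq_zero_iff two_ne_zero |>.1 (le_antisymm (by linarith [(hb u).1]) (sq_nonneg _))))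
    (IsoMesh.isLinearMap_rhs hG hf hg hΦ')
  refine ⟨u, fun w => ?_, hu⟩
  -- The equation with boundary data and the equation with `ℓ_h` are equivalent for each test
  -- function, so they have the same unique solution.
  rw [← hu w]
  refine forall_congr' fun v => ?_
  rw [IsoMesh.formWithData_eq hG f hg hΦ']
  constructor <;> intro h' <;> linarith
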